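/- **Setting.** Let $(\mathcal M,g_{ab})$ be an axisymmetric stationary spacetime $\mathcal M=\mathbb R_t\times\Sigma$ ($\Sigma$ a smooth 3-manifold) with Killing fields $t^a=\partial_t$ and $\phi^a$, where $\phi^a$ is tangent to the slices $t=\mathrm{const}$, does not vanish identically (it may vanish on an axis) and has closed orbits of period $2\pi$. Assume that the slices are spacelike, with induced metric $q_{ab}$ and future unit normal $n^a$, and that $t^a=\alpha n^a-\omega\phi^a$ with a smooth lapse function $\alpha>0$ and a smooth function $\omega$ (the angular velocity of the zero-angular-momentum observers, ZAMOs); that is, $$g=-\alpha^2dt^2+q_{ij}(dx^i-\omega\phi^i\,dt)(dx^j-\omega\phi^j\,dt).$$ Assume Einstein's equations $R_{ab}-\tfrac12Rg_{ab}=8\pi G\,T_{ab}$ with $G>0$, and that the scalar curvature of $(\Sigma,q_{ab})$ is nonnegative. Let $S_0\subset\Sigma$ be an axisymmetric closed two-surface that divides $\Sigma$ into an inside and an outside region, let $\hat r^a$ be its outward unit normal in $\Sigma$, $k_{ab}$ its extrinsic curvature in $\Sigma$ with respect to $\hat r^a$ (positive for round spheres in flat space), $k$ the trace of $k_{ab}$,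 and $S=\mathbb R_t\times S_0$. Put $\rho=T_{ab}n^an^b$ and $P_r=T_{ab}\hat r^a\hat r^b$. * $S$ is a *transversely trapping surface* (TTS) if every light ray (future-directed null geodesic) emitted from a point of $S$ in a direction tangent to $S$ propagates, at least for a short time, on $S$ or inside of $S$. It is a *convex* TTS if moreover both eigenvalues of $k_{ab}$ are nonnegative at every point of $S_0$. * $S_0$ is a *loosely trapped surface* (LTS) if $\Sigma$ has nonnegative scalar curvature, $k>0$ on $S_0$, and $\hat r^aD_ak\ge0$ on $S_0$ for at least one radial foliation near $S_0$, i.e. for at least one smooth function $r$ near $S_0$ with nowhere vanishing differential that vanishes on $S_0$, is positive outside and negative inside. Here $\hat r^a$ and $k$ are extended to the level sets of $r$ as their unit normal and mean curvature. **Proposition 4.** Suppose that $\omega$ is constant on $S_0$ (so that $S$ is a contour surface of the ZAMO angular velocity), that $S$ is a convex TTS whose extrinsic curvature $k_{ab}$ does not vanish at any point of $S_0$, and that $\rho+P_r=0$ on $S$. Then $S_0$ is a loosely trapped surface. -/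

import Mathlib

open scoped Manifold ContDiff Bundle Topology

set_option maxSynthPendingDepth 3

noncomputable section

/-! # Pseudo-Riemannian geometry in coordinates

`E` is a finite-dimensional real vector space and `g x` is, for `x` in an open subset of `E`, a
nondegenerate symmetric bilinear form on `E`. -/

namespace Coord

section

variable {E : Type*} [NormedAddCommGroup E] [NormedSpace ℝ E]

/-- The Christoffel symbols of the first kind,
`Γ(u, v; w) = ½ (∂_u g(v, w) + ∂_v g(u, w) - ∂_w g(u, v))`. -/
def christoffelLower (g : E → E →L[ℝ] E →L[ℝ] ℝ) (x : E) : E →L[ℝ] E →L[ℝ] E →L[ℝ] ℝ :=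
  let d : E →L[ℝ] E →L[ℝ] E →L[ℝ] ℝ := fderiv ℝ g x
  let τ : (E →L[ℝ] E →L[ℝ] ℝ) →L[ℝ] E →L[ℝ] E →L[ℝ] ℝ :=
    (ContinuousLinearMap.flipₗᵢ ℝ E E ℝ).toContinuousLinearEquiv.toContinuousLinearMap
  let d₃ : E →L[ℝ] E →L[ℝ] E →L[ℝ] ℝ := τ.comp d.flip
  (1 / 2 : ℝ) • (d + d.flip - d₃)

theorem christoffelLower_apply (g : E → E →L[ℝ] E →L[ℝ] ℝ) (x u v w : E) :
    christoffelLower g x u v w =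
      (1 / 2 : ℝ) * (fderiv ℝ g x u v w + fderiv ℝ g x v u w - fderiv ℝ g x w u v) := rfl

/-- Raising an index: the vector `ℓ^a` with `g(ℓ^a, ·) = ℓ`. -/
def sharp (g : E → E →L[ℝ] E →L[ℝ] ℝ) (x : E) : (E →L[ℝ] ℝ) →L[ℝ] E := (g x).inverse

/-- The Christoffel symbols `Γ(u, v)` of the Levi-Civita connection. -/
def christoffel (g : E → E →L[ℝ] E →L[ℝ] ℝ) (x : E) : E →L[ℝ] E →L[ℝ] E :=
  (ContinuousLinearMap.compL ℝ E (E →L[ℝ] ℝ) E (sharp g x)).comp (christoffelLower g x)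

theorem christoffel_apply (g : E → E →L[ℝ] E →L[ℝ] ℝ) (x u v : E) :
    christoffel g x u v = sharp g x (christoffelLower g x u v) := rfl

/-- For fixed `v`, `w`, the linear map `u ↦ R(u, v) w`, where
`R(u, v) w = (∂_u Γ)(v, w) - (∂_v Γ)(u, w) + Γ(u, Γ(v, w)) - Γ(v, Γ(u, w))`. -/
def riemann (g : E → E →L[ℝ] E →L[ℝ] ℝ) (x v w : E) : E →L[ℝ] E :=
  let Γ : E →L[ℝ] E →L[ℝ] E := christoffel g x
  let d : E →L[ℝ] E →L[ℝ] E →L[ℝ] E := fderiv ℝ (christoffel g) x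
  let d₁ : E →L[ℝ] E →L[ℝ] E := d.flip v
  let d₂ : E →L[ℝ] E →L[ℝ] E := d v
  d₁.flip w - d₂.flip w + Γ.flip (Γ v w) - (Γ v).comp (Γ.flip w)

theorem riemann_apply (g : E → E →L[ℝ] E →L[ℝ] ℝ) (x u v w : E) :
    riemann g x v w u =
      fderiv ℝ (christoffel g) x u v w - fderiv ℝ (christoffel g) x v u w
        + christoffel g x u (christoffel g x v w)
        - christoffel g x v (christoffel g x u w) := rfl

/-- The Ricci tensor `Ric(v, w) = tr (u ↦ R(u, v) w)`. -/
def ricci (g : E → E →L[ℝ] E →L[ℝ] ℝ) (x : E) : E →ₗ[ℝ] E →ₗ[ℝ] ℝ :=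
  LinearMap.mk₂ ℝ (fun v w => LinearMap.trace ℝ E (riemann g x v w).toLinearMap)
    (fun v v' w => by
      rw [← map_add]; congr 1; ext u
      simp only [LinearMap.add_apply, ContinuousLinearMap.coe_coe, riemann_apply, map_add,
        add_apply]
      abel)
    (fun c v w => by
      rw [← map_smul]; congr 1; ext u
      simp only [LinearMap.smul_apply, ContinuousLinearMap.coe_coe, riemann_apply, map_smul,
        smul_apply, smul_sub, smul_add])
    (fun v w w' => by
      rw [← map_add]; congr 1; ext u
      simp only [LinearMap.add_apply, ContinuousLinearMap.coe_coe, riemann_apply, map_add]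
      abel)
    (fun c v w => by
      rw [← map_smul]; congr 1; ext u
      simp only [LinearMap.smul_apply, ContinuousLinearMap.coe_coe, riemann_apply, map_smul,
        smul_sub, smul_add])

/-- The scalar curvature `R = g^{ab} R_{ab}`. -/
def scalar [FiniteDimensional ℝ E] (g : E → E →L[ℝ] E →L[ℝ] ℝ) (x : E) : ℝ :=
  LinearMap.trace ℝ E
    ((sharp g x : (E →L[ℝ] ℝ) →ₗ[ℝ] E) ∘ₗ
      ((LinearMap.toContinuousLinearMap : (E →ₗ[ℝ] ℝ) ≃ₗ[ℝ] (E →L[ℝ] ℝ)) :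
        (E →ₗ[ℝ] ℝ) →ₗ[ℝ] (E →L[ℝ] ℝ)) ∘ₗ ricci g x)

/-- The Lie derivative `(£_V g)(u, v)`. -/
def lieMetric (g : E → E →L[ℝ] E →L[ℝ] ℝ) (V : E → E) (x u v : E) : ℝ :=
  fderiv ℝ g x (V x) u v + g x (fderiv ℝ V x u) v + g x u (fderiv ℝ V x v)

/-! For a positive definite `g` and a function `f` with `df ≠ 0`, the geometry of the level sets
of `f`, oriented by increasing `f`. -/

/-- The gradient of `f`. -/
def grad (g : E → E →L[ℝ] E →L[ℝ] ℝ) (f : E → ℝ) (x : E) : E := sharp g x (fderiv ℝ f x)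

/-- The unit normal `grad f / |grad f|` of the level sets of `f`. -/
def unitNormal (g : E → E →L[ℝ] E →L[ℝ] ℝ) (f : E → ℝ) (x : E) : E :=
  (Real.sqrt (g x (grad g f x) (grad g f x)))⁻¹ • grad g f x

/-- The covariant derivative `u ↦ D_u r̂` of the unit normal field of the level sets of `f`. -/
def covNormal (g : E → E →L[ℝ] E →L[ℝ] ℝ) (f : E → ℝ) (x : E) : E →L[ℝ] E :=
  fderiv ℝ (unitNormal g f) x + (christoffel g x).flip (unitNormal g f x)

/-- The extrinsic curvature `k(u, v) = g(D_u r̂, v)` of the level set of `f` through `x`; it is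
meant for vectors `u`, `v` tangent to that level set. -/
def extrinsic (g : E → E →L[ℝ] E →L[ℝ] ℝ) (f : E → ℝ) (x u v : E) : ℝ :=
  g x (covNormal g f x u) v

/-- The trace `k` of the extrinsic curvature of the level set of `f` through `x`, as the divergence
`D_a r̂^a` (the normal direction does not contribute, since `D_{r̂} r̂` is orthogonal to `r̂`). -/
def meanCurvature (g : E → E →L[ℝ] E →L[ℝ] ℝ) (f : E → ℝ) (x : E) : ℝ :=
  LinearMap.trace ℝ E (covNormal g f x : E →ₗ[ℝ] E)

/-- The derivative `r̂^a D_a k` of the mean curvature of the level sets of `f` along their unit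
normal. -/
def meanCurvatureRate (g : E → E →L[ℝ] E →L[ℝ] ℝ) (f : E → ℝ) (x : E) : ℝ :=
  fderiv ℝ (meanCurvature g f) x (unitNormal g f x)

end

end Coord

/-! # Tensor fields on manifolds

Tensorial quantities at `p` are computed in the preferred chart at `p`. The tangent space at `p` is
identified with the model space `E` by that same chart, so that tangent vectors at `p` are used
as they are. -/

section

variable {E : Type*} [NormedAddCommGroup E] [NormedSpace ℝ E] {H : Type*} [TopologicalSpace H]
  (I : ModelWithCorners ℝ E H) {N : Type*} [TopologicalSpace N] [ChartedSpace H N]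

/-- A field of bilinear forms on the tangent spaces of `N`. -/
abbrev BilinField (N : Type*) [TopologicalSpace N] [ChartedSpace H N] : Type _ :=
  ∀ p : N, TangentSpace I p →L[ℝ] TangentSpace I p →L[ℝ] ℝ

/-- The components of the field `g` in the chart at `p`. -/
def localForm (g : BilinField I N) (p : N) (y : E) : E →L[ℝ] E →L[ℝ] ℝ :=
  let D : E →L[ℝ] E := mfderiv 𝓘(ℝ, E) I (extChartAt I p).symm y
  let b : E →L[ℝ] E →L[ℝ] ℝ := g ((extChartAt I p).symm y)
  b.bilinearComp D D

/-- The components of the vector field `V` in the chart at `p`. -/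
def localVector (V : ∀ p : N, TangentSpace I p) (p : N) (y : E) : E :=
  mfderiv I 𝓘(ℝ, E) (extChartAt I p) ((extChartAt I p).symm y) (V ((extChartAt I p).symm y))

/-- The function `f` in the chart at `p`. -/
def localFun (f : N → ℝ) (p : N) (y : E) : ℝ := f ((extChartAt I p).symm y)

/-- The Ricci tensor of the pseudo-Riemannian metric `g` at `p`. -/
def ricciAt (g : BilinField I N) (p : N) (u v : TangentSpace I p) : ℝ :=
  Coord.ricci (localForm I g p) (extChartAt I p p) u v

/-- The scalar curvature of the pseudo-Riemannian metric `g` at `p`. -/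
def scalarAt [FiniteDimensional ℝ E] (g : BilinField I N) (p : N) : ℝ :=
  Coord.scalar (localForm I g p) (extChartAt I p p)

/-- `V` is a Killing vector field of the metric `g`. -/
def IsKilling (g : BilinField I N) (V : ∀ p : N, TangentSpace I p) : Prop :=
  ∀ (p : N) (u v : TangentSpace I p),
    Coord.lieMetric (localForm I g p) (localVector I V p) (extChartAt I p p) u v = 0

/-- Einstein's equations `R_{ab} - ½ R g_{ab} = 8πG T_{ab}`. -/
def EinsteinEquations [FiniteDimensional ℝ E] (G : ℝ) (g T : BilinField I N) : Prop :=
  ∀ (p : N) (u v : TangentSpace I p),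
    ricciAt I g p u v - (1 / 2) * scalarAt I g p * g p u v = 8 * Real.pi * G * T p u v

/-- The velocity at parameter `0` of the curve `γ`. -/
def velocity (γ : ℝ → N) : TangentSpace I (γ 0) :=
  (deriv (fun s => extChartAt I (γ 0) (γ s)) 0 : E)

/-- On the parameter interval `(-δ, δ)` the curve `γ` is a (twice continuously differentiable,
affinely parametrized) geodesic of `g` inside the domain of the chart at `γ 0`. -/
def IsLocalGeodesic (g : BilinField I N) (γ : ℝ → N) (δ : ℝ) : Prop :=
  let c : ℝ → E := fun s => extChartAt I (γ 0) (γ s)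
  0 < δ ∧ ContDiffOn ℝ 2 c (Set.Ioo (-δ) δ) ∧
    ∀ s ∈ Set.Ioo (-δ) δ, γ s ∈ (extChartAt I (γ 0)).source ∧
      deriv (deriv c) s
        + Coord.christoffel (localForm I g (γ 0)) (c s) (deriv c s) (deriv c s) = 0

end

/-! # Axisymmetric stationary spacetimes -/

/-- The model space of a three-manifold. -/
abbrev E3 : Type := EuclideanSpace ℝ (Fin 3)

/-- The model with corners of the four-manifold `ℝ × X`, where `X` is a three-manifold. -/
abbrev I4 : ModelWithCorners ℝ (ℝ × E3) (ModelProd ℝ E3) := 𝓘(ℝ, ℝ).prod (𝓡 3)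

section

variable (X : Type*) [TopologicalSpace X] [ChartedSpace E3 X] [IsManifold (𝓡 3) ∞ X]

/-- The fields on a time slice `X` that make up a stationary metric on `ℝ × X`: the induced metric
`q`, the lapse function `α > 0`, the vector field `φ`, and the function `ω` (the angular velocity of
the zero-angular-momentum observers) for which the shift vector is `β = -ω φ`. -/
structure StationaryData where
  q : Bundle.ContMDiffRiemannianMetric (𝓡 3) ∞ E3 (fun x : X => TangentSpace (𝓡 3) x)
  lapse : X → ℝ
  φ : ∀ x : X, TangentSpace (𝓡 3) x
  omega : X → ℝ
  lapse_smooth : ContMDiff (𝓡 3) 𝓘(ℝ, ℝ) ∞ lapse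
  lapse_pos : ∀ x, 0 < lapse x
  φ_smooth : ContMDiff (𝓡 3) (𝓡 3).tangent ∞
    (fun x => (⟨x, φ x⟩ : TangentBundle (𝓡 3) X))
  omega_smooth : ContMDiff (𝓡 3) 𝓘(ℝ, ℝ) ∞ omega

variable {X}

namespace StationaryData

variable (M : StationaryData X)

/-- The shift vector `β = -ω φ`. -/
def shift (x : X) : TangentSpace (𝓡 3) x := -(M.omega x • M.φ x)

/-- The spacetime metric `-α² dt² + q_{ij} (dx^i + β^i dt) (dx^j + β^j dt)` on `ℝ × X`. It does not
depend on `t`, so that `t^a = ∂_t` is a Killing vector field. -/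
def metric : BilinField I4 (ℝ × X) := fun p =>
  let dt : (ℝ × E3) →L[ℝ] ℝ := ContinuousLinearMap.fst ℝ ℝ E3
  let e : (ℝ × E3) →L[ℝ] E3 :=
    ContinuousLinearMap.snd ℝ ℝ E3 + dt.smulRight (show E3 from M.shift p.2)
  let q : E3 →L[ℝ] E3 →L[ℝ] ℝ := M.q.inner p.2
  (-(M.lapse p.2) ^ 2) • dt.smulRight dt + q.bilinearComp e e

/-- The future-directed unit normal `n = (t - β) / α` to the slices of constant `t`. -/
def normal (p : ℝ × X) : TangentSpace I4 p :=
  (((M.lapse p.2)⁻¹, -((M.lapse p.2)⁻¹ • (M.shift p.2 : E3))) : ℝ × E3)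

/-- The vector field `φ`, regarded as a vector field on spacetime. -/
def axial (p : ℝ × X) : TangentSpace I4 p := ((0, (M.φ p.2 : E3)) : ℝ × E3)

/-- The energy density `ρ = T_{ab} n^a n^b` measured by the observers normal to the slices. -/
def energyDensity (T : BilinField I4 (ℝ × X)) (p : ℝ × X) : ℝ :=
  T p (M.normal p) (M.normal p)

end StationaryData

variable (X) in
/-- An axisymmetric stationary spacetime `ℝ × X`, presented by its slices of constant `t`, on which
the shift vector is `-ω φ`: the field `φ` is a Killing vector field of the spacetime that generates
an action of `U(1)`, i.e. it does not vanish identically and all its orbits close up after the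
parameter `2π`. It may vanish at some points (the axis). -/
structure AxisymmetricStationarySpacetime extends StationaryData X where
  φ_killing : IsKilling I4 toStationaryData.metric toStationaryData.axial
  φ_closed : ∀ x : X, ∃ γ : ℝ → X, γ 0 = x ∧ IsMIntegralCurve (I := 𝓡 3) γ φ ∧
    ∀ s, γ (s + 2 * Real.pi) = γ s
  φ_ne_zero : ∃ x, φ x ≠ 0

/-! # Surfaces -/

variable (X) in
/-- A closed two-surface `{f = 0}` that divides `X` into the inside region `{f < 0}` and the outside
region `{f > 0}`, given by a smooth function `f` without critical points on the surface. -/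
structure DividingSurface where
  f : X → ℝ
  smooth : ContMDiff (𝓡 3) 𝓘(ℝ, ℝ) ∞ f
  compact : IsCompact {x | f x = 0}
  regular : ∀ x, f x = 0 → mfderiv (𝓡 3) 𝓘(ℝ, ℝ) f x ≠ 0

namespace DividingSurface

variable (S₀ : DividingSurface X)

/-- The points of the surface. -/
def carrier : Set X := {x | S₀.f x = 0}

/-- The inside region. -/
def inside : Set X := {x | S₀.f x < 0}

/-- The outside region. -/
def outside : Set X := {x | 0 < S₀.f x}

/-- The vector `u` at `x` is tangent to the surface. -/
def IsTangent (x : X) (u : TangentSpace (𝓡 3) x) : Prop :=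
  (mfderiv (𝓡 3) 𝓘(ℝ, ℝ) S₀.f x u : ℝ) = 0

/-- The outward unit normal `r̂` of the surface with respect to the metric `q`. -/
def unitNormal (q : BilinField (𝓡 3) X) (x : X) : TangentSpace (𝓡 3) x :=
  (Coord.unitNormal (localForm (𝓡 3) q x) (localFun (𝓡 3) S₀.f x) (extChartAt (𝓡 3) x x) : E3)

/-- The extrinsic curvature `k_{ab}` of the surface with respect to the metric `q` and the outward
unit normal; it is meant for tangent vectors of the surface. -/
def extrinsic (q : BilinField (𝓡 3) X) (x : X) (u v : TangentSpace (𝓡 3) x) : ℝ :=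
  Coord.extrinsic (localForm (𝓡 3) q x) (localFun (𝓡 3) S₀.f x) (extChartAt (𝓡 3) x x) u v

/-- The surface is convex: both eigenvalues of `k_{ab}` are nonnegative at each point. -/
def IsConvex (q : BilinField (𝓡 3) X) : Prop :=
  ∀ x ∈ S₀.carrier, ∀ u, S₀.IsTangent x u → 0 ≤ S₀.extrinsic q x u u

/-- The surface is a loosely trapped surface in the initial data `X` with metric `q`: the scalar
curvature of `X` is nonnegative, and for at least one smooth radial coordinate `r` on a
neighbourhood `U` of the surface (vanishing on the surface, increasing outwards, with level
sets that form a foliation of `U`) the trace `k` of the extrinsic curvature of the level sets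
satisfies `k > 0` and `r̂^a D_a k ≥ 0` on the surface. -/
def IsLooselyTrapped (q : BilinField (𝓡 3) X) : Prop :=
  (∀ x : X, 0 ≤ scalarAt (𝓡 3) q x) ∧
  ∃ (U : Set X) (r : X → ℝ), IsOpen U ∧ S₀.carrier ⊆ U ∧
    ContMDiffOn (𝓡 3) 𝓘(ℝ, ℝ) ∞ r U ∧
    (∀ x ∈ U, mfderiv (𝓡 3) 𝓘(ℝ, ℝ) r x ≠ 0) ∧
    (∀ x ∈ U, (r x = 0 ↔ x ∈ S₀.carrier) ∧ (0 < r x ↔ x ∈ S₀.outside)) ∧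
    ∀ x ∈ S₀.carrier,
      0 < Coord.meanCurvature (localForm (𝓡 3) q x) (localFun (𝓡 3) r x)
          (extChartAt (𝓡 3) x x) ∧
      0 ≤ Coord.meanCurvatureRate (localForm (𝓡 3) q x) (localFun (𝓡 3) r x)
          (extChartAt (𝓡 3) x x)

/-- The stationary hypersurface `S = ℝ × S₀` swept out by the surface along `t^a = ∂_t` is a
transversely trapping surface of the spacetime metric `g`: every light ray (future-directed null
geodesic) that is emitted from a point of `S` in a direction tangent to `S` propagates, at least
for a short time, on `S` or inside of `S`. -/
def IsTransverselyTrapping (g : BilinField I4 (ℝ × X)) : Prop :=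
  ∀ (γ : ℝ → ℝ × X) (δ : ℝ), IsLocalGeodesic I4 g γ δ →
    (γ 0).2 ∈ S₀.carrier →
    g (γ 0) (velocity I4 γ) (velocity I4 γ) = 0 →
    0 < (velocity I4 γ : ℝ × E3).1 →
    S₀.IsTangent (γ 0).2 (velocity I4 γ : ℝ × E3).2 →
    ∃ ε > 0, ∀ s ∈ Set.Ico 0 ε, (γ s).2 ∈ S₀.carrier ∪ S₀.inside

/-- The radial pressure `P_r = T_{ab} r̂^a r̂^b` at a point of `ℝ × S₀`. -/
def radialPressure (q : BilinField (𝓡 3) X) (T : BilinField I4 (ℝ × X)) (p : ℝ × X) : ℝ :=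
  T p ((0, (S₀.unitNormal q p.2 : E3)) : ℝ × E3) ((0, (S₀.unitNormal q p.2 : E3)) : ℝ × E3)

end DividingSurface

end

end

/-! The radial foliation is chosen so that its lapse `1 / |dr|` equals the spacetime lapse `α` on
`S₀`. For any foliation with lapse `N`, the derivative of `k` along the unit normal `r̂` is
`-Ric(r̂, r̂) - N⁻¹ tr_S (D D N) + N⁻¹ k ∂_r̂ N - k_{ab} k^{ab}`, where `Ric` and `D` belong to `q`
and `tr_S` is the trace over the tangent plane. The terms containing `N` depend only on the values
of `N` on the surface (`IsFoliation.meanCurvatureRate_eq_of_lapse_eq`), so `N` may be replaced by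
`α`.

For the spacetime metric, let `n` be the unit normal of the slices. In `Ric⁴(n, n) + Ric⁴(r̂, r̂)`
the curvature of the plane spanned by `n` and `r̂` cancels. Since `ω` is constant on `S₀`, `dω` is
radial, and the squares coming from the rotation cancel between the curvatures along `n` and the
Gauss equation of the slice. What remains is `Ric(r̂, r̂) + α⁻¹ tr_S (D D α)`
(`IsStationaryOn.ricci_add_ricci`). By Einstein's equations this is `8πG (ρ + P_r) = 0`: the scalar
curvature drops out because `n` and `r̂` have squared norms `-1` and `1`. The derivative of `k` is
therefore `l k - k_{ab} k^{ab}` with `l = α⁻¹ ∂_r̂ α`.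

The trapping condition bounds `k_{ab}` by `l`. The null vectors tangent to `S` are, up to scale, `n
+ u` and `n - u` with `u` a unit tangent vector of `S₀`. Adding the second-order conditions along
both rays removes the terms linear in `u` and leaves `α k(u, u) ≤ ∂_r̂ α`
(`IsStationaryOn.lapse_mul_extrinsic_le`). With convexity, both eigenvalues of `k_{ab}` lie in `[0,
l]`, so `k_{ab} k^{ab} ≤ l k`. A nonnegative form that is not zero has positive trace, which gives
`k > 0`.

All of this is local and is carried out in the chart at a point of `S₀`. The remaining work
transfers smoothness, the Killing equation, the radial function and geodesics between the manifold
and that chart. -/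

namespace Coord

/-! ### Metric connection, curvature and Killing fields in coordinates -/

section Calculus

variable {E : Type*} [NormedAddCommGroup E] [NormedSpace ℝ E]

/-- `g` is a smooth nondegenerate symmetric form on the open set `s`. -/
structure IsMetricOn (g : E → E →L[ℝ] E →L[ℝ] ℝ) (s : Set E) : Prop where
  isOpen : IsOpen s
  smooth : ContDiffOn ℝ ∞ g s
  symm : ∀ x ∈ s, ∀ u v, g x u v = g x v u
  invertible : ∀ x ∈ s, (g x).IsInvertible

theorem contDiffAt_fderiv {F : Type*} [NormedAddCommGroup F] [NormedSpace ℝ F] {f : E → F} {x : E}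
    (hf : ContDiffAt ℝ ∞ f x) : ContDiffAt ℝ ∞ (fderiv ℝ f) x :=
  hf.fderiv_right (m := ∞) (by simp)

theorem fderiv_fderiv_symm {F : Type*} [NormedAddCommGroup F] [NormedSpace ℝ F] {f : E → F} {x : E}
    (hf : ContDiffAt ℝ ∞ f x) (u v : E) :
    fderiv ℝ (fderiv ℝ f) x u v = fderiv ℝ (fderiv ℝ f) x v u :=
  (hf.isSymmSndFDerivAt (by
    rw [minSmoothness_of_isRCLikeNormedField]; exact WithTop.coe_le_coe.2 (le_top : (2 : ℕ∞) ≤ ⊤))).eq u v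

theorem fderiv_apply_apply {F G : Type*} [NormedAddCommGroup F] [NormedSpace ℝ F]
    [NormedAddCommGroup G] [NormedSpace ℝ G] {c : E → F →L[ℝ] G} {V : E → F} {x : E}
    (hc : DifferentiableAt ℝ c x) (hV : DifferentiableAt ℝ V x) (u : E) :
    fderiv ℝ (fun y => c y (V y)) x u = fderiv ℝ c x u (V x) + c x (fderiv ℝ V x u) := by
  rw [fderiv_clm_apply hc hV]
  simp [add_comm]

theorem fderiv_bilin_apply {F F' G : Type*} [NormedAddCommGroup F] [NormedSpace ℝ F]
    [NormedAddCommGroup F'] [NormedSpace ℝ F'] [NormedAddCommGroup G] [NormedSpace ℝ G]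
    {c : E → F →L[ℝ] F' →L[ℝ] G} {V : E → F} {W : E → F'} {x : E}
    (hc : DifferentiableAt ℝ c x) (hV : DifferentiableAt ℝ V x) (hW : DifferentiableAt ℝ W x)
    (u : E) :
    fderiv ℝ (fun y => c y (V y) (W y)) x u =
      fderiv ℝ c x u (V x) (W x) + c x (fderiv ℝ V x u) (W x) + c x (V x) (fderiv ℝ W x u) := by
  rw [fderiv_apply_apply (hc.clm_apply hV) hW, fderiv_apply_apply hc hV]
  simp

namespace IsMetricOn

variable {g : E → E →L[ℝ] E →L[ℝ] ℝ} {s : Set E} {x : E}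

theorem contDiffAt (hg : IsMetricOn g s) (hx : x ∈ s) : ContDiffAt ℝ ∞ g x :=
  hg.smooth.contDiffAt (hg.isOpen.mem_nhds hx)

theorem differentiableAt (hg : IsMetricOn g s) (hx : x ∈ s) : DifferentiableAt ℝ g x :=
  (hg.contDiffAt hx).differentiableAt (by simp)

theorem eventually_mem (hg : IsMetricOn g s) (hx : x ∈ s) : ∀ᶠ y in 𝓝 x, y ∈ s :=
  hg.isOpen.mem_nhds hx

theorem apply_sharp (hg : IsMetricOn g s) (hx : x ∈ s) (l : E →L[ℝ] ℝ) (v : E) :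
    g x (sharp g x l) v = l v := by
  rw [sharp, (hg.invertible x hx).self_apply_inverse]

theorem apply_sharp' (hg : IsMetricOn g s) (hx : x ∈ s) (l : E →L[ℝ] ℝ) (v : E) :
    g x v (sharp g x l) = l v := by
  rw [hg.symm x hx, hg.apply_sharp hx]

theorem eq_of_forall (hg : IsMetricOn g s) (hx : x ∈ s) {a b : E}
    (h : ∀ v, g x a v = g x b v) : a = b :=
  (hg.invertible x hx).injective (ContinuousLinearMap.ext h)

theorem fderiv_symm (hg : IsMetricOn g s) (hx : x ∈ s) (u v w : E) :
    fderiv ℝ g x u v w = fderiv ℝ g x u w v := by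
  have h1 : (fun y => g y v w) =ᶠ[𝓝 x] fun y => g y w v := by
    filter_upwards [hg.eventually_mem hx] with y hy using hg.symm y hy v w
  have h2 := h1.fderiv_eq (𝕜 := ℝ)
  have h3 := congrArg (fun L => L u) h2
  rw [fderiv_bilin_apply (hg.differentiableAt hx) (by fun_prop) (by fun_prop),
    fderiv_bilin_apply (hg.differentiableAt hx) (by fun_prop) (by fun_prop)] at h3
  simpa using h3

theorem apply_christoffel (hg : IsMetricOn g s) (hx : x ∈ s) (u v w : E) :
    g x (christoffel g x u v) w = christoffelLower g x u v w := by
  rw [christoffel_apply, hg.apply_sharp hx]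

theorem apply_christoffel' (hg : IsMetricOn g s) (hx : x ∈ s) (u v w : E) :
    g x w (christoffel g x u v) = christoffelLower g x u v w := by
  rw [christoffel_apply, hg.apply_sharp' hx]

theorem christoffelLower_symm (hg : IsMetricOn g s) (hx : x ∈ s) (u v w : E) :
    christoffelLower g x u v w = christoffelLower g x v u w := by
  simp only [christoffelLower_apply]
  rw [hg.fderiv_symm hx w u v]
  ring

theorem christoffel_symm (hg : IsMetricOn g s) (hx : x ∈ s) (u v : E) :
    christoffel g x u v = christoffel g x v u :=
  hg.eq_of_forall hx fun w => by
    rw [hg.apply_christoffel hx, hg.apply_christoffel hx, hg.christoffelLower_symm hx]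

theorem christoffelLower_add (hg : IsMetricOn g s) (hx : x ∈ s) (u v w : E) :
    christoffelLower g x u v w + christoffelLower g x u w v = fderiv ℝ g x u v w := by
  simp only [christoffelLower_apply]
  rw [hg.fderiv_symm hx u w v, hg.fderiv_symm hx w u v, hg.fderiv_symm hx v u w]
  ring

/-- The metric is parallel. -/
theorem fderiv_eq (hg : IsMetricOn g s) (hx : x ∈ s) (u v w : E) :
    fderiv ℝ g x u v w = g x (christoffel g x u v) w + g x v (christoffel g x u w) := by
  rw [hg.apply_christoffel hx, hg.apply_christoffel' hx, hg.christoffelLower_add hx]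

theorem contDiffAt_christoffelLower (hg : IsMetricOn g s) (hx : x ∈ s) :
    ContDiffAt ℝ ∞ (christoffelLower g) x := by
  have h := contDiffAt_fderiv (hg.contDiffAt hx)
  have hflip : ∀ {F : Type _} [NormedAddCommGroup F] [NormedSpace ℝ F]
      {c : E → E →L[ℝ] E →L[ℝ] F}, ContDiffAt ℝ ∞ c x → ContDiffAt ℝ ∞ (fun y => (c y).flip) x := by
    intro F _ _ c hc
    exact ((ContinuousLinearMap.flipₗᵢ ℝ E E
      F).toContinuousLinearEquiv.toContinuousLinearMap.contDiff.contDiffAt).comp x hc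
  have h1 := hflip h
  have h2 : ContDiffAt ℝ ∞ (fun y => ((ContinuousLinearMap.flipₗᵢ ℝ E E
    ℝ).toContinuousLinearEquiv.toContinuousLinearMap).comp (fderiv ℝ g y).flip) x :=
    contDiffAt_const.clm_comp h1
  exact ((h.add h1).sub h2).const_smul (1 / 2 : ℝ)

theorem fderiv_christoffelLower (hg : IsMetricOn g s) (hx : x ∈ s) (u v w z : E) :
    fderiv ℝ (christoffelLower g) x u v w z =
      (1 / 2 : ℝ) * (fderiv ℝ (fderiv ℝ g) x u v w z + fderiv ℝ (fderiv ℝ g) x u w v z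
        - fderiv ℝ (fderiv ℝ g) x u z v w) := by
  have hd : DifferentiableAt ℝ (fderiv ℝ g) x :=
    (contDiffAt_fderiv (hg.contDiffAt hx)).differentiableAt (by simp)
  have hc : DifferentiableAt ℝ (christoffelLower g) x :=
    (hg.contDiffAt_christoffelLower hx).differentiableAt (by simp)
  have key : ∀ a b c : E, fderiv ℝ (fun y => fderiv ℝ g y a b c) x u =
      fderiv ℝ (fderiv ℝ g) x u a b c := by
    intro a b c
    rw [fderiv_apply_apply (c := fun y => fderiv ℝ g y a b) (V := fun _ => c) (by fun_prop)
      (by fun_prop), fderiv_apply_apply (c := fun y => fderiv ℝ g y a) (V := fun _ => b)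
      (by fun_prop) (by fun_prop), fderiv_apply_apply (V := fun _ => a) hd (by fun_prop)]
    simp
  have key2 : fderiv ℝ (fun y => christoffelLower g y v w z) x u =
      fderiv ℝ (christoffelLower g) x u v w z := by
    rw [fderiv_apply_apply (c := fun y => christoffelLower g y v w) (V := fun _ => z) (by fun_prop)
      (by fun_prop), fderiv_apply_apply (c := fun y => christoffelLower g y v) (V := fun _ => w)
      (by fun_prop) (by fun_prop), fderiv_apply_apply (V := fun _ => v) hc (by fun_prop)]
    simp
  rw [← key2, ← key, ← key, ← key]
  simp only [christoffelLower_apply]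
  rw [fderiv_const_mul (by fun_prop), fderiv_fun_sub (by fun_prop) (by fun_prop),
    fderiv_fun_add (by fun_prop) (by fun_prop)]
  simp

theorem fderiv_fderiv_swap (hg : IsMetricOn g s) (hx : x ∈ s) (u v w z : E) :
    fderiv ℝ (fderiv ℝ g) x u v w z = fderiv ℝ (fderiv ℝ g) x u v z w := by
  have hd : DifferentiableAt ℝ (fderiv ℝ g) x :=
    (contDiffAt_fderiv (hg.contDiffAt hx)).differentiableAt (by simp)
  have h1 : (fun y => fderiv ℝ g y v w z) =ᶠ[𝓝 x] fun y => fderiv ℝ g y v z w := by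
    filter_upwards [hg.eventually_mem hx] with y hy using hg.fderiv_symm hy v w z
  have key : ∀ a b c : E, fderiv ℝ (fun y => fderiv ℝ g y a b c) x u =
      fderiv ℝ (fderiv ℝ g) x u a b c := by
    intro a b c
    rw [fderiv_apply_apply (c := fun y => fderiv ℝ g y a b) (V := fun _ => c) (by fun_prop)
      (by fun_prop), fderiv_apply_apply (c := fun y => fderiv ℝ g y a) (V := fun _ => b)
      (by fun_prop) (by fun_prop), fderiv_apply_apply (V := fun _ => a) hd (by fun_prop)]
    simp
  rw [← key, ← key, h1.fderiv_eq]

variable [FiniteDimensional ℝ E]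

theorem contDiffAt_sharp (hg : IsMetricOn g s) (hx : x ∈ s) : ContDiffAt ℝ ∞ (sharp g) x := by
  have := FiniteDimensional.complete ℝ E
  exact (hg.invertible x hx).contDiffAt_map_inverse.comp x (hg.contDiffAt hx)

theorem contDiffAt_christoffel (hg : IsMetricOn g s) (hx : x ∈ s) :
    ContDiffAt ℝ ∞ (christoffel g) x := by
  have h1 := hg.contDiffAt_sharp hx
  have h2 := hg.contDiffAt_christoffelLower hx
  exact ((ContinuousLinearMap.compL ℝ E (E →L[ℝ] ℝ) E).contDiff.contDiffAt.comp x h1).clm_comp h2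

theorem differentiableAt_christoffel (hg : IsMetricOn g s) (hx : x ∈ s) :
    DifferentiableAt ℝ (christoffel g) x :=
  (hg.contDiffAt_christoffel hx).differentiableAt (by simp)

/-- The curvature tensor with all indices lowered, in terms of the Christoffel symbols. -/
theorem apply_riemann (hg : IsMetricOn g s) (hx : x ∈ s) (u v w z : E) :
    g x (riemann g x v w u) z =
      fderiv ℝ (christoffelLower g) x u v w z - fderiv ℝ (christoffelLower g) x v u w z
        - g x (christoffel g x u z) (christoffel g x v w)
        + g x (christoffel g x v z) (christoffel g x u w) := by
  have hd := hg.differentiableAt_christoffel hx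
  have hl : DifferentiableAt ℝ (christoffelLower g) x :=
    (hg.contDiffAt_christoffelLower hx).differentiableAt (by simp)
  -- Differentiating `g(Γ(b, c), z) = Γ(b, c; z)` trades the derivative of `Γ` for that of its
  -- lowered form; the derivative of `g` is again expressed by `Γ`.
  have key : ∀ a b c : E, g x (fderiv ℝ (christoffel g) x a b c) z =
      fderiv ℝ (christoffelLower g) x a b c z - g x (christoffel g x a (christoffel g x b c)) z
        - g x (christoffel g x b c) (christoffel g x a z) := by
    intro a b c
    have h1 : (fun y => g y (christoffel g y b c) z) =ᶠ[𝓝 x] fun y => christoffelLower g y b c z := by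
      filter_upwards [hg.eventually_mem hx] with y hy using hg.apply_christoffel hy b c z
    have h2 := congrArg (fun L => L a) (h1.fderiv_eq (𝕜 := ℝ))
    rw [fderiv_bilin_apply (hg.differentiableAt hx) (by fun_prop) (by fun_prop),
      fderiv_bilin_apply (c := christoffel g) hd (by fun_prop) (by fun_prop),
      fderiv_apply_apply (c := fun y => christoffelLower g y b c) (V := fun _ => z) (by fun_prop)
      (by fun_prop), fderiv_bilin_apply (c := christoffelLower g) hl (by fun_prop)
      (by fun_prop), hg.fderiv_eq hx] at h2
    simp only [fderiv_fun_const, Pi.zero_apply, zero_apply, map_zero, add_zero] at h2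
    linarith
  rw [riemann_apply]
  simp only [map_add, map_sub, add_apply, sub_apply, key]
  rw [hg.symm x hx (christoffel g x v w) (christoffel g x u z),
    hg.symm x hx (christoffel g x u w) (christoffel g x v z)]
  ring

/-- The curvature tensor with all indices lowered, in terms of the second derivatives of the
metric. -/
theorem apply_riemann_eq (hg : IsMetricOn g s) (hx : x ∈ s) (u v w z : E) :
    g x (riemann g x v w u) z =
      (1 / 2 : ℝ) * (fderiv ℝ (fderiv ℝ g) x u w v z - fderiv ℝ (fderiv ℝ g) x u z v w
        - fderiv ℝ (fderiv ℝ g) x v w u z + fderiv ℝ (fderiv ℝ g) x v z u w)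
        - g x (christoffel g x u z) (christoffel g x v w)
        + g x (christoffel g x v z) (christoffel g x u w) := by
  rw [hg.apply_riemann hx, hg.fderiv_christoffelLower hx, hg.fderiv_christoffelLower hx,
    fderiv_fderiv_symm (hg.contDiffAt hx) u v]
  ring

/-- The symmetry of the curvature tensor under exchange of the two pairs of indices, for a
sectional curvature. -/
theorem riemann_pair_symm (hg : IsMetricOn g s) (hx : x ∈ s) (u v : E) :
    g x (riemann g x v v u) u = g x (riemann g x u u v) v := by
  rw [hg.apply_riemann_eq hx, hg.apply_riemann_eq hx]
  have hS := fun a b : E => fderiv_fderiv_symm (hg.contDiffAt hx) a b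
  rw [hS u v, hg.fderiv_fderiv_swap hx v u u v, hg.symm x hx (christoffel g x v v),
    hg.christoffel_symm hx u v]
  ring

end IsMetricOn

/-! ### Covariant derivatives of vector fields -/

/-- The covariant derivative `u ↦ ∇_u V`. -/
noncomputable def covDeriv (g : E → E →L[ℝ] E →L[ℝ] ℝ) (V : E → E) (x : E) : E →L[ℝ] E :=
  fderiv ℝ V x + (christoffel g x).flip (V x)

theorem covDeriv_apply (g : E → E →L[ℝ] E →L[ℝ] ℝ) (V : E → E) (x u : E) :
    covDeriv g V x u = fderiv ℝ V x u + christoffel g x u (V x) := rfl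

theorem covDeriv_const (g : E → E →L[ℝ] E →L[ℝ] ℝ) (w x u : E) :
    covDeriv g (fun _ => w) x u = christoffel g x u w := by
  simp [covDeriv_apply]

/-- The second covariant derivative `(∇_u ∇V) v`. -/
noncomputable def covDeriv₂ (g : E → E →L[ℝ] E →L[ℝ] ℝ) (V : E → E) (x u v : E) : E :=
  fderiv ℝ (covDeriv g V) x u v + christoffel g x u (covDeriv g V x v)
    - covDeriv g V x (christoffel g x u v)

variable {g : E → E →L[ℝ] E →L[ℝ] ℝ} {s : Set E} {x : E}

namespace IsMetricOn

theorem fderiv_apply_fields (hg : IsMetricOn g s) (hx : x ∈ s) {V W : E → E}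
    (hV : DifferentiableAt ℝ V x) (hW : DifferentiableAt ℝ W x) (u : E) :
    fderiv ℝ (fun y => g y (V y) (W y)) x u =
      g x (covDeriv g V x u) (W x) + g x (V x) (covDeriv g W x u) := by
  rw [fderiv_bilin_apply (hg.differentiableAt hx) hV hW, hg.fderiv_eq hx, covDeriv_apply,
    covDeriv_apply]
  simp only [map_add, add_apply]
  ring

variable [FiniteDimensional ℝ E]

theorem contDiffAt_covDeriv (hg : IsMetricOn g s) (hx : x ∈ s) {V : E → E}
    (hV : ContDiffAt ℝ ∞ V x) : ContDiffAt ℝ ∞ (covDeriv g V) x := by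
  have h1 := hg.contDiffAt_christoffel hx
  have hflip : ContDiffAt ℝ ∞ (fun y => (christoffel g y).flip) x :=
    ((ContinuousLinearMap.flipₗᵢ ℝ E E
      E).toContinuousLinearEquiv.toContinuousLinearMap.contDiff.contDiffAt).comp x h1
  exact (contDiffAt_fderiv hV).add (hflip.clm_apply hV)

theorem fderiv_covDeriv_apply (hg : IsMetricOn g s) (hx : x ∈ s) {V : E → E}
    (hV : ContDiffAt ℝ ∞ V x) (u v : E) :
    fderiv ℝ (covDeriv g V) x u v = fderiv ℝ (fderiv ℝ V) x u v
      + fderiv ℝ (christoffel g) x u v (V x) + christoffel g x v (fderiv ℝ V x u) := by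
  have hA := (hg.contDiffAt_covDeriv hx hV).differentiableAt (by simp)
  have hV' := (contDiffAt_fderiv hV).differentiableAt (by simp)
  have h : fderiv ℝ (fun y => covDeriv g V y v) x u = fderiv ℝ (covDeriv g V) x u v := by
    rw [fderiv_apply_apply hA (by fun_prop)]; simp
  rw [← h]
  simp only [covDeriv_apply]
  have hV1 : DifferentiableAt ℝ V x := hV.differentiableAt (by simp)
  have hΓ := hg.differentiableAt_christoffel hx
  rw [fderiv_fun_add (by fun_prop) (by fun_prop), add_apply,
    fderiv_apply_apply hV' (by fun_prop), fderiv_bilin_apply hΓ (by fun_prop) hV1]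
  simp
  abel

/-- The Ricci identity. -/
theorem riemann_apply_field (hg : IsMetricOn g s) (hx : x ∈ s) {V : E → E}
    (hV : ContDiffAt ℝ ∞ V x) (u v : E) :
    riemann g x v (V x) u = covDeriv₂ g V x u v - covDeriv₂ g V x v u := by
  simp only [covDeriv₂, hg.fderiv_covDeriv_apply hx hV, riemann_apply, covDeriv_apply, map_add]
  rw [fderiv_fderiv_symm hV u v, hg.christoffel_symm hx u v]
  abel

/-- The derivative of `g(∇_v V, W)`. -/
theorem fderiv_apply_covDeriv (hg : IsMetricOn g s) (hx : x ∈ s) {V W Y : E → E}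
    (hV : ContDiffAt ℝ ∞ V x) (hW : DifferentiableAt ℝ W x) (hY : DifferentiableAt ℝ Y x) (u : E) :
    fderiv ℝ (fun y => g y (covDeriv g V y (W y)) (Y y)) x u =
      g x (covDeriv₂ g V x u (W x)) (Y x) + g x (covDeriv g V x (covDeriv g W x u)) (Y x)
        + g x (covDeriv g V x (W x)) (covDeriv g Y x u) := by
  have hA := (hg.contDiffAt_covDeriv hx hV).differentiableAt (by simp)
  rw [hg.fderiv_apply_fields hx (V := fun y => covDeriv g V y (W y)) (by fun_prop) hY,
    covDeriv_apply g (fun y => covDeriv g V y (W y)), fderiv_apply_apply hA hW]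
  simp only [covDeriv₂, covDeriv_apply g W, map_add, map_sub, add_apply, sub_apply]
  ring

end IsMetricOn

/-! ### Killing fields -/

/-- `V` is a Killing field of `g` on `s`. -/
def IsKillingOn (g : E → E →L[ℝ] E →L[ℝ] ℝ) (V : E → E) (s : Set E) : Prop :=
  ∀ x ∈ s, ∀ u v, lieMetric g V x u v = 0

namespace IsMetricOn

/-- The symmetry of `Γ` lets the derivative of `g` along `V` be absorbed into covariant derivatives
of `V`, so that the Killing equation becomes antisymmetry of `∇V`. -/
theorem lieMetric_eq (hg : IsMetricOn g s) (hx : x ∈ s) (V : E → E) (u v : E) :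
    lieMetric g V x u v = g x (covDeriv g V x u) v + g x u (covDeriv g V x v) := by
  rw [lieMetric, hg.fderiv_eq hx, covDeriv_apply, covDeriv_apply, hg.christoffel_symm hx u,
    hg.christoffel_symm hx v]
  simp only [map_add, add_apply]
  ring

theorem killing_antisymm (hg : IsMetricOn g s) {V : E → E} (hK : IsKillingOn g V s) (hx : x ∈ s)
    (u v : E) : g x (covDeriv g V x u) v = - g x u (covDeriv g V x v) := by
  have := hK x hx u v
  rw [hg.lieMetric_eq hx] at this
  linarith

/-- The covariant derivative of a Killing field in terms of the exterior derivative of the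
corresponding covector field. -/
theorem two_mul_apply_covDeriv_killing (hg : IsMetricOn g s) {V : E → E} (hK : IsKillingOn g V s)
    (hx : x ∈ s) (hV : DifferentiableAt ℝ V x) (u w : E) :
    2 * g x (covDeriv g V x u) w =
      fderiv ℝ (fun y => g y (V y) w) x u - fderiv ℝ (fun y => g y (V y) u) x w := by
  have h := hg.killing_antisymm hK hx u w
  rw [hg.fderiv_apply_fields hx hV (by fun_prop), hg.fderiv_apply_fields hx hV (by fun_prop),
    covDeriv_const, covDeriv_const, hg.christoffel_symm hx u w, hg.symm x hx (covDeriv g V x w) u]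
  linarith

variable [FiniteDimensional ℝ E]

/-- The curvature along a Killing field in terms of the Hessian of its squared norm. -/
theorem apply_riemann_killing (hg : IsMetricOn g s) {V : E → E} (hK : IsKillingOn g V s)
    (hx : x ∈ s) (hV : ContDiffAt ℝ ∞ V x) (u : E) :
    g x (riemann g x (V x) (V x) u) u = g x (covDeriv g V x u) (covDeriv g V x u)
      - (1 / 2 : ℝ) * (fderiv ℝ (fun y => fderiv ℝ (fun z => g z (V z) (V z)) y u) x u
        - fderiv ℝ (fun z => g z (V z) (V z)) x (christoffel g x u u)) := by
  have hV1 : DifferentiableAt ℝ V x := hV.differentiableAt (by simp)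
  have hVs : ∀ᶠ y in 𝓝 x, DifferentiableAt ℝ V y := by
    have : ∀ᶠ y in 𝓝 x, ContDiffAt ℝ 1 V y := (hV.of_le (by simp)).eventually (by simp)
    exact this.mono fun y hy => hy.differentiableAt (by simp)
  -- the second covariant derivative is antisymmetric
  have anti : ∀ w v z : E, g x (covDeriv₂ g V x w v) z = - g x (covDeriv₂ g V x w z) v := by
    intro w v z
    have h1 : (fun y => g y (covDeriv g V y v) z) =ᶠ[𝓝 x]
        fun y => - g y (covDeriv g V y z) v := by
      filter_upwards [hg.eventually_mem hx] with y hy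
      rw [hg.killing_antisymm hK hy, hg.symm y hy]
    have h2 := congrArg (fun L => L w) (h1.fderiv_eq (𝕜 := ℝ))
    simp only [fderiv_fun_neg, neg_apply] at h2
    rw [hg.fderiv_apply_covDeriv hx hV (by fun_prop) (by fun_prop),
      hg.fderiv_apply_covDeriv hx hV (by fun_prop) (by fun_prop)] at h2
    simp only [covDeriv_const] at h2
    have h3 := hg.killing_antisymm hK hx (christoffel g x w v) z
    have h4 := hg.killing_antisymm hK hx (christoffel g x w z) v
    rw [hg.symm x hx (christoffel g x w v)] at h3
    rw [hg.symm x hx (christoffel g x w z)] at h4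
    linarith
  have hnorm : ∀ y ∈ s, DifferentiableAt ℝ V y → ∀ v,
      fderiv ℝ (fun z => g z (V z) (V z)) y v = 2 * g y (covDeriv g V y v) (V y) := by
    intro y hy hVy v
    rw [hg.fderiv_apply_fields hy hVy hVy, hg.symm y hy (V y)]
    ring
  have h5 : (fun y => fderiv ℝ (fun z => g z (V z) (V z)) y u) =ᶠ[𝓝 x]
      fun y => 2 * g y (covDeriv g V y u) (V y) := by
    filter_upwards [hg.eventually_mem hx, hVs] with y hy hVy using hnorm y hy hVy u
  rw [h5.fderiv_eq, hnorm x hx hV1, hg.riemann_apply_field hx hV]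
  have hd : DifferentiableAt ℝ (fun y => g y (covDeriv g V y u) (V y)) x := by
    have hA := (hg.contDiffAt_covDeriv hx hV).differentiableAt (by simp)
    have := hg.differentiableAt hx
    fun_prop
  rw [fderiv_const_mul hd]
  simp only [smul_apply, smul_eq_mul]
  rw [hg.fderiv_apply_covDeriv hx hV (by fun_prop) hV1]
  simp only [covDeriv_const, map_sub, sub_apply]
  -- The Ricci identity leaves two second covariant derivatives of `V`. Antisymmetry turns the first
  -- into `-g(∇²V(u, u), V)`, a part of the Hessian of the squared norm, and makes the second equal
  -- to its own negative.
  have h6 := anti u (V x) u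
  have h7 := anti (V x) u u
  linarith

end IsMetricOn

/-! ### Traces -/

/-- A basis that is orthonormal up to the signs `ε`. -/
structure IsPseudoOrthonormal {ι : Type*} [DecidableEq ι] (B : E →L[ℝ] E →L[ℝ] ℝ) (ε : ι → ℝ)
    (b : ι → E) : Prop where
  sign : ∀ i, ε i * ε i = 1
  apply : ∀ i j, B (b i) (b j) = if i = j then ε i else 0

theorem IsPseudoOrthonormal.linearIndependent {ι : Type*} [Fintype ι] [DecidableEq ι]
    {B : E →L[ℝ] E →L[ℝ] ℝ} {ε : ι → ℝ} {b : ι → E} (h : IsPseudoOrthonormal B ε b) :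
    LinearIndependent ℝ b := by
  rw [Fintype.linearIndependent_iff]
  intro c hc i
  have h1 := congrArg (fun v => B v (b i)) hc
  simp only [map_sum, map_smul, FunLike.coe_sum, Finset.sum_apply, smul_apply,
    h.apply, map_zero, zero_apply, smul_eq_mul, mul_ite, mul_zero] at h1
  simp at h1
  rcases h1 with h1 | h1
  · exact h1
  · have := h.sign i
    simp [h1] at this

theorem IsPseudoOrthonormal.sum_eq {ι : Type*} [Fintype ι] [DecidableEq ι] [FiniteDimensional ℝ E]
    {B : E →L[ℝ] E →L[ℝ] ℝ} {ε : ι → ℝ} {b : ι → E} (h : IsPseudoOrthonormal B ε b)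
    (hcard : Fintype.card ι = Module.finrank ℝ E) (v : E) :
    ∑ i, (ε i * B v (b i)) • b i = v := by
  have hspan : v ∈ Submodule.span ℝ (Set.range b) := by
    rw [h.linearIndependent.span_eq_top_of_card_eq_finrank' hcard]; trivial
  obtain ⟨c, rfl⟩ := (Submodule.mem_span_range_iff_exists_fun ℝ).1 hspan
  refine Finset.sum_congr rfl fun i _ => ?_
  congr 1
  simp only [map_sum, map_smul, FunLike.coe_sum, Finset.sum_apply, smul_apply,
    h.apply, smul_eq_mul, mul_ite, mul_zero]
  simp
  rw [mul_left_comm, h.sign, mul_one]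

theorem IsPseudoOrthonormal.trace_eq {ι : Type*} [Fintype ι] [DecidableEq ι]
    [FiniteDimensional ℝ E]
    {B : E →L[ℝ] E →L[ℝ] ℝ} {ε : ι → ℝ} {b : ι → E} (h : IsPseudoOrthonormal B ε b)
    (hcard : Fintype.card ι = Module.finrank ℝ E) (A : E →ₗ[ℝ] E) :
    LinearMap.trace ℝ E A = ∑ i, ε i * B (A (b i)) (b i) := by
  -- Expanding `A v` in the basis writes `A` as a sum of rank-one maps, whose traces are read off on
  -- a one-dimensional space.
  have hA : A = ∑ i, (LinearMap.toSpanSingleton ℝ E (b i)) ∘ₗ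
      ((ε i) • ((B.flip (b i) : E →L[ℝ] ℝ) : E →ₗ[ℝ] ℝ)) ∘ₗ A := by
    ext v
    conv_lhs => rw [← h.sum_eq hcard (A v)]
    simp
  conv_lhs => rw [hA]
  rw [map_sum]
  refine Finset.sum_congr rfl fun i _ => ?_
  rw [LinearMap.trace_comp_comm', LinearMap.trace_eq_matrix_trace ℝ (Module.Basis.singleton Unit ℝ)]
  simp [Matrix.trace, LinearMap.toMatrix_apply]

end Calculus

end Coord

namespace Coord

/-! ### Functions that are constant on a regular level set -/

section Lagrange

variable {E : Type*} [NormedAddCommGroup E] [NormedSpace ℝ E] [CompleteSpace E]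

/-- A function that is constant on a regular level set has a differential proportional to that of
the defining function. -/
theorem exists_fderiv_eq_smul_of_const_on_level {f F : E → ℝ} {x : E} {c : ℝ}
    (hf : ContDiffAt ℝ ∞ f x) (hF : ContDiffAt ℝ ∞ F x) (hx : f x = 0) (hreg : fderiv ℝ f x ≠ 0)
    (h : ∀ᶠ y in 𝓝 x, f y = 0 → F y = c) : ∃ a : ℝ, fderiv ℝ F x = a • fderiv ℝ f x := by
  -- Constancy on the level set makes `x` a constrained extremum, so Lagrange multipliers apply; the
  -- one on `dF` cannot vanish because `df ≠ 0`.
  have hext : IsLocalExtrOn F {y | f y = f x} x := by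
    left
    have h1 : ∀ᶠ y in 𝓝[{y | f y = f x}] x, F x ≤ F y := by
      rw [eventually_nhdsWithin_iff]
      filter_upwards [h] with y hy hy'
      rw [hy (by rw [← hx]; exact hy'), h.self_of_nhds hx]
    exact h1
  obtain ⟨a, b, hab, h2⟩ := hext.exists_multipliers_of_hasStrictFDerivAt_1d
    (hf.hasStrictFDerivAt (by simp)) (hF.hasStrictFDerivAt (by simp))
  have hb : b ≠ 0 := by
    rintro rfl
    have ha : a ≠ 0 := by
      rintro rfl; exact hab rfl
    simp [ha, hreg] at h2
  refine ⟨-(b⁻¹ * a), ?_⟩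
  have h3 : b • fderiv ℝ F x = -(a • fderiv ℝ f x) := by
    rw [eq_neg_iff_add_eq_zero, add_comm]; exact h2
  rw [neg_smul, mul_smul, ← smul_neg, ← h3, smul_smul, inv_mul_cancel₀ hb, one_smul]

/-- The second derivatives along a regular level set of a function that is constant on it. -/
theorem fderiv_fderiv_of_const_on_level {f F : E → ℝ} {x : E} {c : ℝ} {s : Set E} (hs : IsOpen s)
    (hxs : x ∈ s)
    (hf : ContDiffOn ℝ ∞ f s) (hF : ContDiffOn ℝ ∞ F s) (hx : f x = 0) (hreg : fderiv ℝ f x ≠ 0)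
    (h : ∀ᶠ y in 𝓝 x, f y = 0 → F y = c) {u : E} (hu : fderiv ℝ f x u = 0) (w : E) :
    fderiv ℝ (fderiv ℝ F) x u u * fderiv ℝ f x w
      = fderiv ℝ F x w * fderiv ℝ (fderiv ℝ f) x u u := by
  have hfy : ∀ y ∈ s, ContDiffAt ℝ ∞ f y := fun y hy => hf.contDiffAt (hs.mem_nhds hy)
  have hFy : ∀ y ∈ s, ContDiffAt ℝ ∞ F y := fun y hy => hF.contDiffAt (hs.mem_nhds hy)
  have hf1 := contDiffAt_fderiv (hfy x hxs)
  have hF1 := contDiffAt_fderiv (hFy x hxs)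
  -- `G` is a `2 × 2` minor of the pair `dF`, `df`. It vanishes on the level set because the
  -- differentials are proportional there, so the first-order statement applies to `G` as well: `dG`
  -- vanishes on the tangent vector `u`.
  set G : E → ℝ := fun y => fderiv ℝ F y u * fderiv ℝ f y w - fderiv ℝ F y w * fderiv ℝ f y u
    with hG
  have hGc : ContDiffAt ℝ ∞ G x :=
    ((hF1.clm_apply contDiffAt_const).mul (hf1.clm_apply contDiffAt_const)).sub
      ((hF1.clm_apply contDiffAt_const).mul (hf1.clm_apply contDiffAt_const))
  have hreg' : ∀ᶠ y in 𝓝 x, fderiv ℝ f y ≠ 0 := hf1.continuousAt.eventually_ne hreg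
  have hG0 : ∀ᶠ y in 𝓝 x, f y = 0 → G y = 0 := by
    filter_upwards [h.eventually_nhds, hreg', hs.mem_nhds hxs] with y hy hry hys hy0
    obtain ⟨a, ha⟩ := exists_fderiv_eq_smul_of_const_on_level (hfy y hys) (hFy y hys) hy0 hry hy
    simp [hG, ha]; ring
  obtain ⟨a, ha⟩ := exists_fderiv_eq_smul_of_const_on_level (hfy x hxs) hGc hx hreg hG0
  obtain ⟨b, hb⟩ := exists_fderiv_eq_smul_of_const_on_level (hfy x hxs) (hFy x hxs) hx hreg h
  have hdf := hf1.differentiableAt (n := ∞) (by simp)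
  have hdF := hF1.differentiableAt (n := ∞) (by simp)
  have h3 := congrArg (fun L => L u) ha
  simp only [hG, smul_apply, hu, smul_zero] at h3
  rw [fderiv_fun_sub (by fun_prop) (by fun_prop), fderiv_fun_mul (by fun_prop) (by fun_prop),
    fderiv_fun_mul (by fun_prop) (by fun_prop)] at h3
  simp only [sub_apply, add_apply, smul_apply, smul_eq_mul] at h3
  rw [fderiv_apply_apply hdF (by fun_prop), fderiv_apply_apply hdf (by fun_prop),
    fderiv_apply_apply hdF (by fun_prop), fderiv_apply_apply hdf (by fun_prop)] at h3
  simp only [fderiv_fun_const, Pi.zero_apply, zero_apply, map_zero, add_zero, hb, smul_apply, hu,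
    smul_eq_mul, mul_zero, zero_mul] at h3
  rw [hb]
  simp only [smul_apply, smul_eq_mul]
  linarith

end Lagrange

/-! ### Unit normal, lapse and acceleration of a foliation -/

section Foliation

variable {E : Type*} [NormedAddCommGroup E] [NormedSpace ℝ E]

/-- The Hessian of the function `F`. -/
noncomputable def hess (g : E → E →L[ℝ] E →L[ℝ] ℝ) (F : E → ℝ) (x u v : E) : ℝ :=
  fderiv ℝ (fderiv ℝ F) x u v - fderiv ℝ F x (christoffel g x u v)

theorem fderiv_fderiv_apply {F : E → ℝ} {x : E} (hF : ContDiffAt ℝ ∞ F x) (u v : E) :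
    fderiv ℝ (fun y => fderiv ℝ F y v) x u = fderiv ℝ (fderiv ℝ F) x u v := by
  rw [fderiv_apply_apply ((contDiffAt_fderiv hF).differentiableAt (by simp)) (by fun_prop)]
  simp

/-- The level sets of `r` in the open set `s` form a foliation, and `q` is a Riemannian metric
on `s`. -/
structure IsFoliation (q : E → E →L[ℝ] E →L[ℝ] ℝ) (r : E → ℝ) (s : Set E) : Prop where
  metric : IsMetricOn q s
  pos : ∀ x ∈ s, ∀ v, v ≠ 0 → 0 < q x v v
  smooth : ContDiffOn ℝ ∞ r s
  regular : ∀ x ∈ s, fderiv ℝ r x ≠ 0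

/-- The lapse function `1 / |grad r|` of the foliation by the level sets of `r`. -/
noncomputable def foliationLapse (q : E → E →L[ℝ] E →L[ℝ] ℝ) (r : E → ℝ) (x : E) : ℝ :=
  (Real.sqrt (q x (grad q r x) (grad q r x)))⁻¹

namespace IsFoliation

variable {q : E → E →L[ℝ] E →L[ℝ] ℝ} {r : E → ℝ} {s : Set E} {x : E}

theorem contDiffAt (h : IsFoliation q r s) (hx : x ∈ s) : ContDiffAt ℝ ∞ r x :=
  h.smooth.contDiffAt (h.metric.isOpen.mem_nhds hx)

theorem eventually_mem (h : IsFoliation q r s) (hx : x ∈ s) : ∀ᶠ y in 𝓝 x, y ∈ s :=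
  h.metric.isOpen.mem_nhds hx

theorem apply_grad (h : IsFoliation q r s) (hx : x ∈ s) (v : E) :
    q x (grad q r x) v = fderiv ℝ r x v := h.metric.apply_sharp hx _ _

theorem normSq_grad_pos (h : IsFoliation q r s) (hx : x ∈ s) :
    0 < q x (grad q r x) (grad q r x) := by
  refine h.pos x hx _ fun h0 => h.regular x hx ?_
  ext v
  rw [← h.apply_grad hx, h0]; simp

theorem lapse_pos (h : IsFoliation q r s) (hx : x ∈ s) : 0 < foliationLapse q r x :=
  inv_pos.2 (Real.sqrt_pos.2 (h.normSq_grad_pos hx))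

theorem unitNormal_eq (q : E → E →L[ℝ] E →L[ℝ] ℝ) (r : E → ℝ) (x : E) :
    unitNormal q r x = foliationLapse q r x • grad q r x := rfl

theorem apply_unitNormal (h : IsFoliation q r s) (hx : x ∈ s) (v : E) :
    q x (unitNormal q r x) v = foliationLapse q r x * fderiv ℝ r x v := by
  rw [unitNormal_eq, map_smul, smul_apply, h.apply_grad hx, smul_eq_mul]

theorem lapse_sq (h : IsFoliation q r s) (hx : x ∈ s) :
    foliationLapse q r x ^ 2 * fderiv ℝ r x (grad q r x) = 1 := by
  have h1 := h.normSq_grad_pos hx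
  rw [← h.apply_grad hx, foliationLapse, inv_pow, Real.sq_sqrt h1.le, inv_mul_cancel₀ h1.ne']

theorem fderiv_unitNormal (h : IsFoliation q r s) (hx : x ∈ s) :
    fderiv ℝ r x (unitNormal q r x) = (foliationLapse q r x)⁻¹ := by
  have h1 := h.lapse_sq hx
  have h2 := (h.lapse_pos hx).ne'
  rw [unitNormal_eq, map_smul, smul_eq_mul]
  field_simp
  linarith

theorem unit (h : IsFoliation q r s) (hx : x ∈ s) :
    q x (unitNormal q r x) (unitNormal q r x) = 1 := by
  rw [h.apply_unitNormal hx, h.fderiv_unitNormal hx, mul_inv_cancel₀ (h.lapse_pos hx).ne']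

theorem covNormal_eq (q : E → E →L[ℝ] E →L[ℝ] ℝ) (r : E → ℝ) :
    covNormal q r = covDeriv q (unitNormal q r) := rfl

theorem hess_symm (h : IsFoliation q r s) (hx : x ∈ s) (u v : E) :
    hess q r x u v = hess q r x v u := by
  rw [hess, hess, fderiv_fderiv_symm (h.contDiffAt hx), h.metric.christoffel_symm hx]

variable [FiniteDimensional ℝ E]

theorem contDiffAt_grad (h : IsFoliation q r s) (hx : x ∈ s) : ContDiffAt ℝ ∞ (grad q r) x :=
  (h.metric.contDiffAt_sharp hx).clm_apply (contDiffAt_fderiv (h.contDiffAt hx))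

theorem contDiffAt_lapse (h : IsFoliation q r s) (hx : x ∈ s) :
    ContDiffAt ℝ ∞ (foliationLapse q r) x := by
  have h1 := h.contDiffAt_grad hx
  have h2 : ContDiffAt ℝ ∞ (fun y => q y (grad q r y) (grad q r y)) x :=
    ((h.metric.contDiffAt hx).clm_apply h1).clm_apply h1
  exact (h2.sqrt (h.normSq_grad_pos hx).ne').inv (Real.sqrt_pos.2 (h.normSq_grad_pos hx)).ne'

theorem contDiffAt_unitNormal (h : IsFoliation q r s) (hx : x ∈ s) :
    ContDiffAt ℝ ∞ (unitNormal q r) x :=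
  (h.contDiffAt_lapse hx).smul (h.contDiffAt_grad hx)

theorem differentiableAt_unitNormal (h : IsFoliation q r s) (hx : x ∈ s) :
    DifferentiableAt ℝ (unitNormal q r) x :=
  (h.contDiffAt_unitNormal hx).differentiableAt (by simp)

/-- The normal component of `D_u r̂` vanishes. -/
theorem apply_covNormal_unitNormal (h : IsFoliation q r s) (hx : x ∈ s) (u : E) :
    q x (covDeriv q (unitNormal q r) x u) (unitNormal q r x) = 0 := by
  have h1 : (fun y => q y (unitNormal q r y) (unitNormal q r y)) =ᶠ[𝓝 x] fun _ => 1 := by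
    filter_upwards [h.eventually_mem hx] with y hy using h.unit hy
  have h2 := congrArg (fun L => L u) (h1.fderiv_eq (𝕜 := ℝ))
  rw [h.metric.fderiv_apply_fields hx (h.differentiableAt_unitNormal hx)
    (h.differentiableAt_unitNormal hx), h.metric.symm x hx (unitNormal q r x)] at h2
  simp at h2
  linarith

/-- Differentiate the covector form `N dr` of the unit normal; the Christoffel terms complete the
second derivatives of `r` to its Hessian. -/
theorem apply_covNormal (h : IsFoliation q r s) (hx : x ∈ s) (u v : E) :
    q x (covDeriv q (unitNormal q r) x u) v =
      fderiv ℝ (foliationLapse q r) x u * fderiv ℝ r x v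
        + foliationLapse q r x * hess q r x u v := by
  have h1 : (fun y => q y (unitNormal q r y) v) =ᶠ[𝓝 x]
      fun y => foliationLapse q r y * fderiv ℝ r y v := by
    filter_upwards [h.eventually_mem hx] with y hy using h.apply_unitNormal hy v
  have h2 := congrArg (fun L => L u) (h1.fderiv_eq (𝕜 := ℝ))
  have hN := (h.contDiffAt_lapse hx).differentiableAt (n := ∞) (by simp)
  have hr := (contDiffAt_fderiv (h.contDiffAt hx)).differentiableAt (n := ∞) (by simp)
  rw [h.metric.fderiv_apply_fields hx (h.differentiableAt_unitNormal hx) (by fun_prop),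
    fderiv_fun_mul hN (by fun_prop), covDeriv_const, h.apply_unitNormal hx] at h2
  simp only [add_apply, smul_apply, smul_eq_mul, fderiv_fderiv_apply (h.contDiffAt hx)] at h2
  rw [hess]
  linarith

/-- The acceleration `D_r̂ r̂` of the normal field. -/
theorem apply_covNormal_self (h : IsFoliation q r s) (hx : x ∈ s) (w : E) :
    q x (covDeriv q (unitNormal q r) x (unitNormal q r x)) w =
      fderiv ℝ (foliationLapse q r) x (unitNormal q r x) * fderiv ℝ r x w
        - fderiv ℝ (foliationLapse q r) x w * (foliationLapse q r x)⁻¹ := by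
  have h1 := h.apply_covNormal_unitNormal hx w
  rw [h.apply_covNormal hx, h.fderiv_unitNormal hx] at h1
  rw [h.apply_covNormal hx, h.hess_symm hx]
  linarith

theorem extrinsic_eq (h : IsFoliation q r s) (hx : x ∈ s) {u : E} (hu : fderiv ℝ r x u = 0)
    (v : E) : extrinsic q r x v u = foliationLapse q r x * hess q r x v u := by
  rw [extrinsic, covNormal_eq, h.apply_covNormal hx, hu]
  ring

/-- The acceleration is orthogonal to the normal everywhere, and this identity is differentiated
along the normal. -/
theorem apply_covDeriv₂_normal (h : IsFoliation q r s) (hx : x ∈ s) :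
    q x (covDeriv₂ q (unitNormal q r) x (unitNormal q r x) (unitNormal q r x)) (unitNormal q r x)
      = - q x (covDeriv q (unitNormal q r) x (unitNormal q r x))
          (covDeriv q (unitNormal q r) x (unitNormal q r x)) := by
  have h1 : (fun y => q y (covDeriv q (unitNormal q r) y (unitNormal q r y)) (unitNormal q r y))
      =ᶠ[𝓝 x] fun _ => 0 := by
    filter_upwards [h.eventually_mem hx] with y hy using h.apply_covNormal_unitNormal hy _
  have h2 := congrArg (fun L => L (unitNormal q r x)) (h1.fderiv_eq (𝕜 := ℝ))
  have hd := h.differentiableAt_unitNormal hx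
  rw [h.metric.fderiv_apply_covDeriv hx (h.contDiffAt_unitNormal hx) hd hd,
    h.apply_covNormal_unitNormal hx] at h2
  simp at h2
  linarith

/-- The explicit acceleration `apply_covNormal_self` is differentiated along `e`. The last term
appears because the derivative also hits the direction slot of `D_r̂ r̂`. In the trace over a frame
the squares of `N⁻¹ dN(e)` cancel against the squared acceleration in `apply_covDeriv₂_normal`. -/
theorem apply_covDeriv₂_tangent (h : IsFoliation q r s) (hx : x ∈ s) {e : E}
    (he : fderiv ℝ r x e = 0) :
    q x (covDeriv₂ q (unitNormal q r) x e (unitNormal q r x)) e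
      = fderiv ℝ (foliationLapse q r) x (unitNormal q r x) * hess q r x e e
        - (foliationLapse q r x)⁻¹ * hess q (foliationLapse q r) x e e
        + ((foliationLapse q r x)⁻¹ * fderiv ℝ (foliationLapse q r) x e) ^ 2
        - q x (covDeriv q (unitNormal q r) x (covDeriv q (unitNormal q r) x e)) e := by
  have h1 : (fun y => q y (covDeriv q (unitNormal q r) y (unitNormal q r y)) e)
      =ᶠ[𝓝 x] fun y => fderiv ℝ (foliationLapse q r) y (unitNormal q r y) * fderiv ℝ r y e
        - fderiv ℝ (foliationLapse q r) y e * (foliationLapse q r y)⁻¹ := by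
    filter_upwards [h.eventually_mem hx] with y hy using h.apply_covNormal_self hy _
  have h2 := congrArg (fun L => L e) (h1.fderiv_eq (𝕜 := ℝ))
  have hd := h.differentiableAt_unitNormal hx
  have hN := (h.contDiffAt_lapse hx).differentiableAt (n := ∞) (by simp)
  have hN0 := (h.lapse_pos hx).ne'
  have hN1 := (contDiffAt_fderiv (h.contDiffAt_lapse hx)).differentiableAt (n := ∞) (by simp)
  have hr := (contDiffAt_fderiv (h.contDiffAt hx)).differentiableAt (n := ∞) (by simp)
  have hinv : HasFDerivAt (fun y => (foliationLapse q r y)⁻¹)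
      (-((foliationLapse q r x) ^ 2)⁻¹ • fderiv ℝ (foliationLapse q r) x) x :=
    (hasDerivAt_inv hN0).comp_hasFDerivAt x hN.hasFDerivAt
  rw [h.metric.fderiv_apply_covDeriv hx (h.contDiffAt_unitNormal hx) hd (by fun_prop),
    covDeriv_const, fderiv_fun_sub (DifferentiableAt.fun_mul (by fun_prop) (by fun_prop))
      (DifferentiableAt.fun_mul (by fun_prop) hinv.differentiableAt),
    fderiv_fun_mul (by fun_prop) (by fun_prop), fderiv_fun_mul (by fun_prop) hinv.differentiableAt,
    hinv.fderiv, h.apply_covNormal_self hx] at h2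
  simp only [add_apply, sub_apply, smul_apply, smul_eq_mul, he,
    fderiv_fderiv_apply (h.contDiffAt hx), fderiv_fderiv_apply (h.contDiffAt_lapse hx)] at h2
  rw [hess, hess, mul_pow, inv_pow]
  linarith

/-- The trace is a continuous linear functional, so it commutes with differentiation. -/
theorem differentiableAt_meanCurvature (h : IsFoliation q r s) (hx : x ∈ s) (v : E) :
    fderiv ℝ (meanCurvature q r) x v =
      LinearMap.trace ℝ E (fderiv ℝ (covDeriv q (unitNormal q r)) x v : E →ₗ[ℝ] E) := by
  have hA := (h.metric.contDiffAt_covDeriv hx (h.contDiffAt_unitNormal hx)).differentiableAt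
    (n := ∞) (by simp)
  let tr : (E →L[ℝ] E) →L[ℝ] ℝ := LinearMap.toContinuousLinearMap
    ((LinearMap.trace ℝ E).comp (ContinuousLinearMap.coeLM ℝ))
  have h1 : meanCurvature q r = fun y => tr (covDeriv q (unitNormal q r) y) := rfl
  rw [h1, fderiv_apply_apply (by fun_prop) hA]
  simp [tr]

end IsFoliation

end Foliation

end Coord

namespace Coord

/-! ### Orthonormal frames and the variation of the mean curvature -/

section Frame

variable {E : Type*} [NormedAddCommGroup E] [NormedSpace ℝ E]

/-- The vectors `n`, `e₁`, `e₂` are orthonormal. -/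
structure IsOrthonormalFrame (B : E →L[ℝ] E →L[ℝ] ℝ) (n e₁ e₂ : E) : Prop where
  symm : ∀ u v, B u v = B v u
  nn : B n n = 1
  n₁ : B n e₁ = 0
  n₂ : B n e₂ = 0
  e₁₁ : B e₁ e₁ = 1
  e₁₂ : B e₁ e₂ = 0
  e₂₂ : B e₂ e₂ = 1

namespace IsOrthonormalFrame

variable {B : E →L[ℝ] E →L[ℝ] ℝ} {n e₁ e₂ : E}

theorem isPseudoOrthonormal (h : IsOrthonormalFrame B n e₁ e₂) :
    IsPseudoOrthonormal B (fun _ : Fin 3 => (1 : ℝ)) ![n, e₁, e₂] where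
  sign _ := one_mul 1
  apply i j := by
    have h1 := h.symm e₁ n
    have h2 := h.symm e₂ n
    have h3 := h.symm e₂ e₁
    fin_cases i <;> fin_cases j <;>
      simp [h1, h2, h3, h.nn, h.n₁, h.n₂, h.e₁₁, h.e₁₂, h.e₂₂]

variable [FiniteDimensional ℝ E]

theorem sum_eq (h : IsOrthonormalFrame B n e₁ e₂) (hE : Module.finrank ℝ E = 3) (v : E) :
    v = B v n • n + B v e₁ • e₁ + B v e₂ • e₂ := by
  conv_lhs => rw [← h.isPseudoOrthonormal.sum_eq (by simp [hE]) v]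
  simp [Fin.sum_univ_three]

theorem trace_eq (h : IsOrthonormalFrame B n e₁ e₂) (hE : Module.finrank ℝ E = 3)
    (A : E →ₗ[ℝ] E) :
    LinearMap.trace ℝ E A = B (A n) n + B (A e₁) e₁ + B (A e₂) e₂ := by
  rw [h.isPseudoOrthonormal.trace_eq (by simp [hE])]
  simp [Fin.sum_univ_three]

theorem apply_eq (h : IsOrthonormalFrame B n e₁ e₂) (hE : Module.finrank ℝ E = 3) (v w : E) :
    B v w = B v n * B w n + B v e₁ * B w e₁ + B v e₂ * B w e₂ := by
  conv_lhs => rw [h.sum_eq hE v]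
  simp only [map_add, map_smul, add_apply, smul_apply, smul_eq_mul]
  rw [h.symm n, h.symm e₁, h.symm e₂]

end IsOrthonormalFrame

/-- Any unit vector of a three-dimensional Euclidean space belongs to an orthonormal frame. -/
theorem exists_isOrthonormalFrame [FiniteDimensional ℝ E] (hE : Module.finrank ℝ E = 3)
    {B : E →L[ℝ] E →L[ℝ] ℝ} (hs : ∀ u v, B u v = B v u) (hpos : ∀ v, v ≠ 0 → 0 < B v v)
    {n : E} (hn : B n n = 1) : ∃ e₁ e₂, IsOrthonormalFrame B n e₁ e₂ := by
  have key : ∀ a b : E, ∃ e, B a e = 0 ∧ B b e = 0 ∧ B e e = 1 := by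
    intro a b
    let L : E →ₗ[ℝ] ℝ × ℝ := (B a : E →ₗ[ℝ] ℝ).prod (B b : E →ₗ[ℝ] ℝ)
    have hker : L.ker ≠ ⊥ := by
      intro h0
      have := LinearMap.finrank_le_finrank_of_injective (LinearMap.ker_eq_bot.1 h0)
      simp [hE] at this
    obtain ⟨v, hv, hv0⟩ := Submodule.exists_mem_ne_zero_of_ne_bot hker
    have hv' : B a v = 0 ∧ B b v = 0 := by simpa [L] using hv
    have hp := hpos v hv0
    refine ⟨(Real.sqrt (B v v))⁻¹ • v, by simp [hv'], by simp [hv'], ?_⟩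
    simp only [map_smul, smul_apply, smul_eq_mul]
    rw [← mul_assoc, ← mul_inv, Real.mul_self_sqrt hp.le, inv_mul_cancel₀ hp.ne']
  obtain ⟨e₁, h1, -, h2⟩ := key n n
  obtain ⟨e₂, h3, h4, h5⟩ := key n e₁
  exact ⟨e₁, e₂, hs, hn, h1, h3, h2, h4, h5⟩

theorem ricci_apply (g : E → E →L[ℝ] E →L[ℝ] ℝ) (x v w : E) :
    ricci g x v w = LinearMap.trace ℝ E (riemann g x v w).toLinearMap := rfl

namespace IsFoliation

variable {q : E → E →L[ℝ] E →L[ℝ] ℝ} {r : E → ℝ} {s : Set E} {x : E}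

theorem fderiv_tangent (h : IsFoliation q r s) (hx : x ∈ s) {v : E}
    (hv : q x (unitNormal q r x) v = 0) : fderiv ℝ r x v = 0 := by
  rw [h.apply_unitNormal hx] at hv
  exact (mul_eq_zero.1 hv).resolve_left (h.lapse_pos hx).ne'

variable [FiniteDimensional ℝ E]

theorem meanCurvature_eq (h : IsFoliation q r s) (hE : Module.finrank ℝ E = 3) (hx : x ∈ s)
    {e₁ e₂ : E} (hf : IsOrthonormalFrame (q x) (unitNormal q r x) e₁ e₂) :
    meanCurvature q r x = extrinsic q r x e₁ e₁ + extrinsic q r x e₂ e₂ := by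
  rw [meanCurvature, hf.trace_eq hE]
  have := h.apply_covNormal_unitNormal hx (unitNormal q r x)
  simp only [ContinuousLinearMap.coe_coe, covNormal_eq, extrinsic]
  linarith

/-- The derivative of the mean curvature along the unit normal, for an arbitrary foliation. -/
theorem meanCurvatureRate_eq (h : IsFoliation q r s) (hE : Module.finrank ℝ E = 3) (hx : x ∈ s)
    {e₁ e₂ : E} (hf : IsOrthonormalFrame (q x) (unitNormal q r x) e₁ e₂) :
    meanCurvatureRate q r x = - ricci q x (unitNormal q r x) (unitNormal q r x)
      - (foliationLapse q r x)⁻¹ *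
        (hess q (foliationLapse q r) x e₁ e₁ + hess q (foliationLapse q r) x e₂ e₂)
      + (foliationLapse q r x)⁻¹ * meanCurvature q r x
        * fderiv ℝ (foliationLapse q r) x (unitNormal q r x)
      - (extrinsic q r x e₁ e₁ ^ 2 + 2 * extrinsic q r x e₁ e₂ * extrinsic q r x e₂ e₁
        + extrinsic q r x e₂ e₂ ^ 2) := by
  set ν := unitNormal q r x with hν
  set N := foliationLapse q r with hN
  have hN0 := (h.lapse_pos hx).ne'
  have he₁ := h.fderiv_tangent hx hf.n₁
  have he₂ := h.fderiv_tangent hx hf.n₂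
  have hV := h.contDiffAt_unitNormal hx
  have hE' : ∀ A : E →ₗ[ℝ] E, LinearMap.trace ℝ E A = _ := hf.trace_eq hE
  -- the trace of the derivative of the shape operator
  have h1 : meanCurvatureRate q r x = q x (covDeriv₂ q (unitNormal q r) x ν ν) ν
      + q x (covDeriv₂ q (unitNormal q r) x ν e₁) e₁
      + q x (covDeriv₂ q (unitNormal q r) x ν e₂) e₂ := by
    rw [meanCurvatureRate, h.differentiableAt_meanCurvature hx, hE']
    -- The Christoffel corrections in the covariant derivative of the shape operator form a
    -- commutator with `Γ(ν, ·)`, which has trace zero.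
    have hc := LinearMap.trace_mul_comm ℝ ((christoffel q x ν : E →L[ℝ] E) : E →ₗ[ℝ] E)
      ((covDeriv q (unitNormal q r) x : E →L[ℝ] E) : E →ₗ[ℝ] E)
    rw [hE', hE'] at hc
    simp only [Module.End.mul_apply, ContinuousLinearMap.coe_coe] at hc
    simp only [ContinuousLinearMap.coe_coe, covDeriv₂, map_add, map_sub, add_apply, sub_apply]
    linarith
  -- The trace of the Ricci identity for the unit normal: one order of differentiation yields the
  -- rate of `k`, the other the derivatives of the acceleration.
  have h2 : ricci q x ν ν = (q x (covDeriv₂ q (unitNormal q r) x ν ν) ν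
      + q x (covDeriv₂ q (unitNormal q r) x e₁ ν) e₁
      + q x (covDeriv₂ q (unitNormal q r) x e₂ ν) e₂) - meanCurvatureRate q r x := by
    rw [h1, ricci_apply, hE']
    simp only [ContinuousLinearMap.coe_coe, hν, h.metric.riemann_apply_field hx hV, map_sub,
      sub_apply]
    ring
  have hkk : ∀ e, q x (covDeriv q (unitNormal q r) x (covDeriv q (unitNormal q r) x e)) e
      = extrinsic q r x e e₁ * extrinsic q r x e₁ e + extrinsic q r x e e₂ * extrinsic q r x e₂ e := by
    intro e
    have h3 := h.apply_covNormal_unitNormal hx e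
    conv_lhs => rw [hf.sum_eq hE (covDeriv q (unitNormal q r) x e), h3]
    simp only [map_add, map_smul, add_apply, smul_apply, smul_eq_mul, extrinsic, covNormal_eq]
    ring
  have h4 := h.apply_covDeriv₂_normal hx
  rw [hf.apply_eq hE (covDeriv q (unitNormal q r) x (unitNormal q r x)),
    h.apply_covNormal_unitNormal hx, h.apply_covNormal_self hx, h.apply_covNormal_self hx, he₁,
    he₂] at h4
  have h5 := h.apply_covDeriv₂_tangent hx he₁
  have h6 := h.apply_covDeriv₂_tangent hx he₂
  rw [hkk] at h5 h6
  have h7 := h.extrinsic_eq hx he₁ e₁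
  have h8 := h.extrinsic_eq hx he₂ e₂
  have h9 : hess q r x e₁ e₁ = (N x)⁻¹ * extrinsic q r x e₁ e₁ := by
    rw [h7]; exact (inv_mul_cancel_left₀ hN0 _).symm
  have h10 : hess q r x e₂ e₂ = (N x)⁻¹ * extrinsic q r x e₂ e₂ := by
    rw [h8]; exact (inv_mul_cancel_left₀ hN0 _).symm
  rw [h9] at h5
  rw [h10] at h6
  rw [h.meanCurvature_eq hE hx hf]
  simp only [← hν, ← hN] at h4 h5 h6
  rw [h4, h5, h6] at h2
  linarith

/-- The derivative of the mean curvature along the unit normal, for a foliation whose lapse function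
agrees with `α` on the level set `{r = 0}`. -/
theorem meanCurvatureRate_eq_of_lapse_eq (h : IsFoliation q r s) (hE : Module.finrank ℝ E = 3)
    (hx : x ∈ s) (hrx : r x = 0) {α : E → ℝ} (hα : ContDiffOn ℝ ∞ α s)
    (hαN : ∀ᶠ y in 𝓝 x, r y = 0 → foliationLapse q r y = α y)
    {e₁ e₂ : E} (hf : IsOrthonormalFrame (q x) (unitNormal q r x) e₁ e₂) :
    meanCurvatureRate q r x = - ricci q x (unitNormal q r x) (unitNormal q r x)
      - (α x)⁻¹ * (hess q α x e₁ e₁ + hess q α x e₂ e₂)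
      + (α x)⁻¹ * meanCurvature q r x * fderiv ℝ α x (unitNormal q r x)
      - (extrinsic q r x e₁ e₁ ^ 2 + 2 * extrinsic q r x e₁ e₂ * extrinsic q r x e₂ e₁
        + extrinsic q r x e₂ e₂ ^ 2) := by
  have he₁ := h.fderiv_tangent hx hf.n₁
  have he₂ := h.fderiv_tangent hx hf.n₂
  have hNx : foliationLapse q r x = α x := hαN.self_of_nhds hrx
  have hN0 := (h.lapse_pos hx).ne'
  rw [h.meanCurvatureRate_eq hE hx hf]
  have hN : ∀ y ∈ s, ContDiffAt ℝ ∞ (foliationLapse q r) y := fun y hy => h.contDiffAt_lapse hy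
  have hαx : ∀ y ∈ s, ContDiffAt ℝ ∞ α y := fun y hy => hα.contDiffAt (h.metric.isOpen.mem_nhds hy)
  have hF : ContDiffOn ℝ ∞ (fun y => foliationLapse q r y - α y) s := fun y hy =>
    ((hN y hy).sub (hαx y hy)).contDiffWithinAt
  have hzero : ∀ᶠ y in 𝓝 x, r y = 0 → (fun y => foliationLapse q r y - α y) y = 0 := by
    filter_upwards [hαN] with y hy hy0
    simp [hy hy0]
  have hd1 : ∀ y ∈ s, fderiv ℝ (fun y => foliationLapse q r y - α y) y =
      fderiv ℝ (foliationLapse q r) y - fderiv ℝ α y := fun y hy =>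
    fderiv_fun_sub ((hN y hy).differentiableAt (by simp)) ((hαx y hy).differentiableAt (by simp))
  have hd2 : fderiv ℝ (fderiv ℝ (fun y => foliationLapse q r y - α y)) x =
      fderiv ℝ (fderiv ℝ (foliationLapse q r)) x - fderiv ℝ (fderiv ℝ α) x := by
    have h1 : fderiv ℝ (fun y => foliationLapse q r y - α y) =ᶠ[𝓝 x]
        fun y => fderiv ℝ (foliationLapse q r) y - fderiv ℝ α y := by
      filter_upwards [h.eventually_mem hx] with y hy using hd1 y hy
    rw [h1.fderiv_eq, fderiv_fun_sub ((contDiffAt_fderiv (hN x hx)).differentiableAt (by simp))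
      ((contDiffAt_fderiv (hαx x hx)).differentiableAt (by simp))]
  obtain ⟨a, ha⟩ := exists_fderiv_eq_smul_of_const_on_level (h.contDiffAt hx)
    (hF.contDiffAt (h.metric.isOpen.mem_nhds hx)) hrx (h.regular x hx) hzero
  -- Two functions that agree on the surface have tangential Hessians differing by the jump of
  -- normal derivatives times `k(e, e)`. Summed over `e₁`, `e₂` this is exactly compensated by the
  -- change of the term `k ∂_r̂ N`.
  have hess_eq : ∀ e, fderiv ℝ r x e = 0 →
      hess q (foliationLapse q r) x e e = hess q α x e e
        + (fderiv ℝ (foliationLapse q r) x (unitNormal q r x) - fderiv ℝ α x (unitNormal q r x))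
          * extrinsic q r x e e := by
    intro e he
    have h1 := fderiv_fderiv_of_const_on_level h.metric.isOpen hx h.smooth hF hrx
      (h.regular x hx) hzero he (unitNormal q r x)
    have h2 := congrArg (fun L => L (christoffel q x e e)) ha
    have h3 := congrArg (fun L => L (unitNormal q r x)) ha
    rw [hd2, hd1 x hx, h.fderiv_unitNormal hx] at h1
    rw [hd1 x hx] at h2 h3
    simp only [sub_apply, smul_apply, smul_eq_mul, h.fderiv_unitNormal hx] at h1 h2 h3
    rw [h.extrinsic_eq hx he]
    simp only [hess]
    rw [h3] at h1 ⊢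
    field_simp at h1 ⊢
    rw [mul_sub, ← h2]
    linarith
  rw [hess_eq e₁ he₁, hess_eq e₂ he₂, h.meanCurvature_eq hE hx hf, hNx]
  ring

end IsFoliation

end Frame

end Coord

namespace Coord

/-! ### Connection of a stationary metric with shift `-Ω φ` -/

section ADM

variable {E : Type*} [NormedAddCommGroup E] [NormedSpace ℝ E]

theorem isInvertible_of_nondegenerate {V : Type*} [NormedAddCommGroup V] [NormedSpace ℝ V]
    [FiniteDimensional ℝ V] {B : V →L[ℝ] V →L[ℝ] ℝ}
    (h : ∀ v, (∀ w, B v w = 0) → v = 0) : B.IsInvertible := by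
  have hinj : Function.Injective (B : V →ₗ[ℝ] (V →L[ℝ] ℝ)) := by
    rw [← LinearMap.ker_eq_bot, LinearMap.ker_eq_bot']
    intro v hv
    exact h v fun w => by
      have := congrArg (fun L : V →L[ℝ] ℝ => L w) hv
      simpa using this
  have hfr : Module.finrank ℝ V = Module.finrank ℝ (V →L[ℝ] ℝ) := by
    rw [← (LinearMap.toContinuousLinearMap : (V →ₗ[ℝ] ℝ) ≃ₗ[ℝ] (V →L[ℝ] ℝ)).finrank_eq]
    exact (Subspace.dual_finrank_eq (K := ℝ) (V := V)).symm
  refine ⟨(LinearEquiv.ofInjectiveOfFinrankEq _ hinj hfr).toContinuousLinearEquiv, ?_⟩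
  ext v w
  rfl

/-- The metric `-α² dt² + q(dx + β dt, dx + β dt)` on `ℝ × E`. -/
noncomputable def admMetric (q : E → E →L[ℝ] E →L[ℝ] ℝ) (α : E → ℝ) (β : E → E) (p : ℝ × E) :
    (ℝ × E) →L[ℝ] (ℝ × E) →L[ℝ] ℝ :=
  let dt : (ℝ × E) →L[ℝ] ℝ := ContinuousLinearMap.fst ℝ ℝ E
  let e : (ℝ × E) →L[ℝ] E := ContinuousLinearMap.snd ℝ ℝ E + dt.smulRight (β p.2)
  (-(α p.2) ^ 2) • dt.smulRight dt + (q p.2).bilinearComp e e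

theorem admMetric_apply (q : E → E →L[ℝ] E →L[ℝ] ℝ) (α : E → ℝ) (β : E → E) (p U V : ℝ × E) :
    admMetric q α β p U V =
      -(α p.2) ^ 2 * (U.1 * V.1) + q p.2 (U.2 + U.1 • β p.2) (V.2 + V.1 • β p.2) := by
  simp [admMetric, smul_eq_mul]

theorem IsMetricOn.admMetric [FiniteDimensional ℝ E] {q : E → E →L[ℝ] E →L[ℝ] ℝ} {α : E → ℝ}
    {β : E → E} {s : Set E} (hq : IsMetricOn q s) (hpos : ∀ x ∈ s, ∀ v, v ≠ 0 → 0 < q x v v)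
    (hα : ContDiffOn ℝ ∞ α s) (hα0 : ∀ x ∈ s, 0 < α x) (hβ : ContDiffOn ℝ ∞ β s) :
    IsMetricOn (admMetric q α β) (Set.univ ×ˢ s) where
  isOpen := isOpen_univ.prod hq.isOpen
  smooth := by
    have hq' : ContDiffOn ℝ ∞ (fun p : ℝ × E => q p.2) (Set.univ ×ˢ s) :=
      hq.smooth.comp contDiff_snd.contDiffOn fun p hp => hp.2
    have hα' : ContDiffOn ℝ ∞ (fun p : ℝ × E => α p.2) (Set.univ ×ˢ s) :=
      hα.comp contDiff_snd.contDiffOn fun p hp => hp.2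
    have hβ' : ContDiffOn ℝ ∞ (fun p : ℝ × E => β p.2) (Set.univ ×ˢ s) :=
      hβ.comp contDiff_snd.contDiffOn fun p hp => hp.2
    rw [contDiffOn_clm_apply]
    intro U
    rw [contDiffOn_clm_apply]
    intro V
    simp only [admMetric_apply]
    have hU : ContDiffOn ℝ ∞ (fun p : ℝ × E => U.2 + U.1 • β p.2) (Set.univ ×ˢ s) :=
      contDiffOn_const.add (contDiffOn_const.smul hβ')
    have hV : ContDiffOn ℝ ∞ (fun p : ℝ × E => V.2 + V.1 • β p.2) (Set.univ ×ˢ s) :=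
      contDiffOn_const.add (contDiffOn_const.smul hβ')
    exact ((hα'.pow 2).neg.mul contDiffOn_const).add ((hq'.clm_apply hU).clm_apply hV)
  symm p hp u v := by
    rw [admMetric_apply, admMetric_apply, hq.symm p.2 hp.2, mul_comm u.1]
  invertible p hp := by
    refine isInvertible_of_nondegenerate fun v hv => ?_
    -- Testing against the spatial vector `v.2 + v.1 • β` forces `v` to be a multiple of the slice
    -- normal; testing against `∂_t` then kills the multiple, as `α ≠ 0`.
    have h1 := hv (0, v.2 + v.1 • β p.2)
    simp only [admMetric_apply, mul_zero, zero_smul, add_zero, zero_add] at h1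
    have h2 : v.2 + v.1 • β p.2 = 0 := by
      by_contra h0
      exact (hpos p.2 hp.2 _ h0).ne' h1
    have h3 := hv (1, 0)
    rw [admMetric_apply, h2] at h3
    have h4 := (hα0 p.2 hp.2).ne'
    have h5 : v.1 = 0 := by simpa [h4] using h3
    rw [h5, zero_smul, add_zero] at h2
    exact Prod.ext h5 h2

theorem fderiv_comp_snd {F : Type*} [NormedAddCommGroup F] [NormedSpace ℝ F] {f : E → F}
    {p : ℝ × E} (hf : DifferentiableAt ℝ f p.2) (U : ℝ × E) :
    fderiv ℝ (fun p : ℝ × E => f p.2) p U = fderiv ℝ f p.2 U.2 := by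
  have h : HasFDerivAt (fun p : ℝ × E => f p.2)
      ((fderiv ℝ f p.2).comp (ContinuousLinearMap.snd ℝ ℝ E)) p :=
    hf.hasFDerivAt.comp p hasFDerivAt_snd
  rw [h.fderiv]; rfl

/-- The fields on `s` define a stationary spacetime metric with shift vector `-Ω φ` for which `φ` is
a Killing field. -/
structure IsStationaryOn (q : E → E →L[ℝ] E →L[ℝ] ℝ) (α Ω : E → ℝ) (φ : E → E) (s : Set E) :
    Prop where
  metric : IsMetricOn q s
  pos : ∀ x ∈ s, ∀ v, v ≠ 0 → 0 < q x v v
  lapse_smooth : ContDiffOn ℝ ∞ α s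
  lapse_pos : ∀ x ∈ s, 0 < α x
  omega_smooth : ContDiffOn ℝ ∞ Ω s
  axial_smooth : ContDiffOn ℝ ∞ φ s
  killing : IsKillingOn (admMetric q α (fun y => -(Ω y • φ y))) (fun p => ((0 : ℝ), φ p.2))
    (Set.univ ×ˢ s)

namespace IsStationaryOn

variable {q : E → E →L[ℝ] E →L[ℝ] ℝ} {α Ω : E → ℝ} {φ : E → E} {s : Set E} {x : E} {t : ℝ}

theorem contDiffAt_lapse (h : IsStationaryOn q α Ω φ s) (hx : x ∈ s) : ContDiffAt ℝ ∞ α x :=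
  h.lapse_smooth.contDiffAt (h.metric.isOpen.mem_nhds hx)

theorem contDiffAt_omega (h : IsStationaryOn q α Ω φ s) (hx : x ∈ s) : ContDiffAt ℝ ∞ Ω x :=
  h.omega_smooth.contDiffAt (h.metric.isOpen.mem_nhds hx)

theorem contDiffAt_axial (h : IsStationaryOn q α Ω φ s) (hx : x ∈ s) : ContDiffAt ℝ ∞ φ x :=
  h.axial_smooth.contDiffAt (h.metric.isOpen.mem_nhds hx)

theorem contDiffAt_shift (h : IsStationaryOn q α Ω φ s) (hx : x ∈ s) :
    ContDiffAt ℝ ∞ (fun y => -(Ω y • φ y)) x :=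
  ((h.contDiffAt_omega hx).smul (h.contDiffAt_axial hx)).neg

variable [FiniteDimensional ℝ E]

theorem isMetricOn (h : IsStationaryOn q α Ω φ s) :
    IsMetricOn (admMetric q α (fun y => -(Ω y • φ y))) (Set.univ ×ˢ s) :=
  h.metric.admMetric h.pos h.lapse_smooth h.lapse_pos (h.omega_smooth.smul h.axial_smooth).neg

/-- The derivative of the components of the spacetime metric. -/
theorem fderiv_metric (h : IsStationaryOn q α Ω φ s) (hx : x ∈ s) (U V W : ℝ × E) :
    fderiv ℝ (admMetric q α (fun y => -(Ω y • φ y))) (t, x) U V W =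
      fderiv ℝ (fun y => -(α y) ^ 2 * (V.1 * W.1)
        + q y (V.2 + V.1 • -(Ω y • φ y)) (W.2 + W.1 • -(Ω y • φ y))) x U.2 := by
  have hd := h.isMetricOn.differentiableAt (x := (t, x)) ⟨trivial, hx⟩
  have h1 : fderiv ℝ (fun p => admMetric q α (fun y => -(Ω y • φ y)) p V W) (t, x) U =
      fderiv ℝ (admMetric q α (fun y => -(Ω y • φ y))) (t, x) U V W := by
    rw [fderiv_bilin_apply hd (by fun_prop) (by fun_prop)]; simp
  rw [← h1]
  simp only [admMetric_apply]
  have hq := h.metric.differentiableAt hx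
  have hα := (h.contDiffAt_lapse hx).differentiableAt (n := ∞) (by simp)
  have hΩ := (h.contDiffAt_omega hx).differentiableAt (n := ∞) (by simp)
  have hφ := (h.contDiffAt_axial hx).differentiableAt (n := ∞) (by simp)
  exact fderiv_comp_snd (p := (t, x)) (f := fun y => -(α y) ^ 2 * (V.1 * W.1)
        + q y (V.2 + V.1 • -(Ω y • φ y)) (W.2 + W.1 • -(Ω y • φ y))) (by fun_prop) U

/-- Spatial vectors see neither lapse nor shift. Hence in the Gauss equation the second derivatives
of the metric are those of `q`, and only the Christoffel terms have to be compared. -/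
theorem fderiv_metric_spatial (h : IsStationaryOn q α Ω φ s) (hx : x ∈ s) (U : ℝ × E) (v w : E) :
    fderiv ℝ (admMetric q α (fun y => -(Ω y • φ y))) (t, x) U (0, v) (0, w) =
      fderiv ℝ q x U.2 v w := by
  rw [h.fderiv_metric hx]
  simp only [zero_smul, add_zero, mul_zero, zero_add]
  rw [fderiv_bilin_apply (h.metric.differentiableAt hx) (by fun_prop) (by fun_prop)]
  simp

theorem fderiv_fderiv_metric_spatial (h : IsStationaryOn q α Ω φ s) (hx : x ∈ s) (u v w z : E) :
    fderiv ℝ (fderiv ℝ (admMetric q α (fun y => -(Ω y • φ y)))) (t, x) (0, u) (0, v) (0, w) (0, z) =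
      fderiv ℝ (fderiv ℝ q) x u v w z := by
  have hp : (t, x) ∈ (Set.univ ×ˢ s : Set (ℝ × E)) := ⟨trivial, hx⟩
  have hd : DifferentiableAt ℝ (fderiv ℝ (admMetric q α (fun y => -(Ω y • φ y)))) (t, x) :=
    (contDiffAt_fderiv (h.isMetricOn.contDiffAt hp)).differentiableAt (by simp)
  have hdq : DifferentiableAt ℝ (fderiv ℝ q) x :=
    (contDiffAt_fderiv (h.metric.contDiffAt hx)).differentiableAt (by simp)
  have h1 : (fun p => fderiv ℝ (admMetric q α (fun y => -(Ω y • φ y))) p (0, v) (0, w) (0, z))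
      =ᶠ[𝓝 (t, x)] fun p => fderiv ℝ q p.2 v w z := by
    filter_upwards [h.isMetricOn.eventually_mem hp] with p hp
    exact h.fderiv_metric_spatial hp.2 (0, v) w z
  have h2 := congrArg (fun L => L ((0 : ℝ), u)) (h1.fderiv_eq (𝕜 := ℝ))
  rw [fderiv_comp_snd (f := fun y => fderiv ℝ q y v w z) (by fun_prop),
    fderiv_apply_apply
      (c := fun p => fderiv ℝ (admMetric q α (fun y => -(Ω y • φ y))) p (0, v) (0, w))
      (by fun_prop) (by fun_prop),
    fderiv_apply_apply
      (c := fun p => fderiv ℝ (admMetric q α (fun y => -(Ω y • φ y))) p (0, v))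
      (by fun_prop) (by fun_prop), fderiv_apply_apply hd (by fun_prop),
    fderiv_apply_apply (c := fun y => fderiv ℝ q y v w) (by fun_prop) (by fun_prop),
    fderiv_apply_apply (c := fun y => fderiv ℝ q y v) (by fun_prop) (by fun_prop),
    fderiv_apply_apply hdq (by fun_prop)] at h2
  simpa using h2

/-- The field `φ` is a Killing field of the spatial metric. -/
theorem lie_spatial (h : IsStationaryOn q α Ω φ s) (hx : x ∈ s) (u v : E) :
    fderiv ℝ q x (φ x) u v + q x (fderiv ℝ φ x u) v + q x u (fderiv ℝ φ x v) = 0 := by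
  have h1 := h.killing (0, x) ⟨trivial, hx⟩ (0, u) (0, v)
  have hφ := (h.contDiffAt_axial hx).differentiableAt (n := ∞) (by simp)
  have h2 : ∀ w : E, fderiv ℝ (fun p : ℝ × E => ((0 : ℝ), φ p.2)) (0, x) (0, w) =
      (0, fderiv ℝ φ x w) := by
    intro w
    rw [fderiv_comp_snd (f := fun y => ((0 : ℝ), φ y)) (p := (0, x))
      ((differentiableAt_const _).prodMk hφ), ((hasFDerivAt_const (0 : ℝ) x).prodMk
      hφ.hasFDerivAt).fderiv]
    rfl
  rw [lieMetric, h.fderiv_metric_spatial hx, h2, h2, admMetric_apply, admMetric_apply] at h1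
  simpa using h1

/-- The second fundamental form of the slices. -/
theorem christoffel_spatial (h : IsStationaryOn q α Ω φ s) (hx : x ∈ s) (u v : E) :
    christoffel (admMetric q α (fun y => -(Ω y • φ y))) (t, x) (0, u) (0, v) =
      ((0 : ℝ), christoffel q x u v) + ((2 * α x)⁻¹ * (fderiv ℝ Ω x u * q x (φ x) v
        + fderiv ℝ Ω x v * q x (φ x) u)) • ((α x)⁻¹ • ((1 : ℝ), Ω x • φ x)) := by
  have hp : (t, x) ∈ (Set.univ ×ˢ s : Set (ℝ × E)) := ⟨trivial, hx⟩
  have hα0 := (h.lapse_pos x hx).ne'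
  have hq := h.metric.differentiableAt hx
  have hα := (h.contDiffAt_lapse hx).differentiableAt (n := ∞) (by simp)
  have hΩ := (h.contDiffAt_omega hx).differentiableAt (n := ∞) (by simp)
  have hφ := (h.contDiffAt_axial hx).differentiableAt (n := ∞) (by simp)
  refine h.isMetricOn.eq_of_forall hp fun W => ?_
  -- Test vectors are split into a spatial part and a multiple of `(1, Ω φ)`, which is `α` times the
  -- unit normal.
  have hW : W = (0, W.2 - W.1 • (Ω x • φ x)) + W.1 • ((1 : ℝ), Ω x • φ x) := by
    ext <;> simp
  rw [hW]
  generalize W.2 - W.1 • (Ω x • φ x) = w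
  generalize W.1 = τ
  simp only [map_add, map_smul, h.isMetricOn.apply_christoffel hp]
  have h1 : christoffelLower (admMetric q α (fun y => -(Ω y • φ y))) (t, x) (0, u) (0, v) (0, w) =
      christoffelLower q x u v w := by
    simp only [christoffelLower_apply, h.fderiv_metric_spatial hx]
  have hβ : ∀ a, fderiv ℝ (fun y => Ω x • φ x + (1 : ℝ) • -(Ω y • φ y)) x a =
      -(Ω x • fderiv ℝ φ x a + fderiv ℝ Ω x a • φ x) := by
    intro a
    simp only [one_smul]
    rw [fderiv_const_add, fderiv_fun_neg, fderiv_fun_smul hΩ hφ]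
    simp
  have h3 : ∀ a b : E, fderiv ℝ (admMetric q α (fun y => -(Ω y • φ y))) (t, x) (0, a) (0, b)
      (1, Ω x • φ x) = -(Ω x * q x b (fderiv ℝ φ x a) + fderiv ℝ Ω x a * q x b (φ x)) := by
    intro a b
    rw [h.fderiv_metric hx]
    simp only [zero_smul, add_zero, zero_mul, mul_zero, zero_add]
    rw [fderiv_bilin_apply hq (by fun_prop) (by fun_prop), hβ]
    simp
  -- The terms with derivatives of `q` and `φ` make up the Killing equation of `φ` and drop out;
  -- only those with `dΩ` survive.
  have h2 : christoffelLower (admMetric q α (fun y => -(Ω y • φ y))) (t, x) (0, u) (0, v)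
      (1, Ω x • φ x) = -(1 / 2) * (fderiv ℝ Ω x u * q x (φ x) v + fderiv ℝ Ω x v * q x (φ x) u) := by
    rw [christoffelLower_apply, h3, h3, h.fderiv_metric_spatial hx]
    have := h.lie_spatial hx u v
    rw [h.metric.symm x hx (φ x) v, h.metric.symm x hx (φ x) u]
    rw [h.metric.symm x hx _ v] at this
    simp only [map_smul, smul_apply, smul_eq_mul]
    linear_combination (-(1 / 2) * Ω x) * this
  rw [h1, h2]
  simp only [admMetric_apply, add_apply, smul_apply, smul_eq_mul, ← h.metric.apply_christoffel hx]
  simp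
  field_simp
  simp

end IsStationaryOn

end ADM

end Coord

namespace Coord

/-! ### Gauss equation and the Ricci components along the two normals -/

section Einstein

variable {E : Type*} [NormedAddCommGroup E] [NormedSpace ℝ E]

namespace IsStationaryOn

variable {q : E → E →L[ℝ] E →L[ℝ] ℝ} {α Ω : E → ℝ} {φ : E → E} {s : Set E} {x : E} {t : ℝ}
  [FiniteDimensional ℝ E]

/-- The Gauss equation for the slices of constant time. -/
theorem apply_riemann_spatial (h : IsStationaryOn q α Ω φ s) (hx : x ∈ s) (u v : E) :
    admMetric q α (fun y => -(Ω y • φ y)) (t, x)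
        (riemann (admMetric q α (fun y => -(Ω y • φ y))) (t, x) (0, v) (0, v) (0, u)) (0, u) =
      q x (riemann q x v v u) u
        + ((α x)⁻¹ * (fderiv ℝ Ω x u * q x (φ x) u)) * ((α x)⁻¹ * (fderiv ℝ Ω x v * q x (φ x) v))
        - ((2 * α x)⁻¹ * (fderiv ℝ Ω x u * q x (φ x) v + fderiv ℝ Ω x v * q x (φ x) u)) ^ 2 := by
  have hp : (t, x) ∈ (Set.univ ×ˢ s : Set (ℝ × E)) := ⟨trivial, hx⟩
  have hα0 := (h.lapse_pos x hx).ne'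
  -- With a spatial part plus a multiple of the timelike unit normal, the products of Christoffel
  -- symbols split into those of `q` and products of second fundamental forms, the latter with a
  -- minus sign.
  have hn : ∀ (a b : E) (y z : ℝ), admMetric q α (fun y => -(Ω y • φ y)) (t, x)
      (((0 : ℝ), a) + y • ((α x)⁻¹ • ((1 : ℝ), Ω x • φ x)))
      (((0 : ℝ), b) + z • ((α x)⁻¹ • ((1 : ℝ), Ω x • φ x))) = q x a b - y * z := by
    intro a b y z
    rw [admMetric_apply]
    have h1 : ∀ (a : E) (y : ℝ), (((0 : ℝ), a) + y • ((α x)⁻¹ • ((1 : ℝ), Ω x • φ x))).2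
        + (((0 : ℝ), a) + y • ((α x)⁻¹ • ((1 : ℝ), Ω x • φ x))).1 • -(Ω x • φ x) = a := by
      intro a y
      simp [smul_smul, mul_assoc]
    rw [h1, h1]
    simp
    field_simp
    ring
  rw [h.isMetricOn.apply_riemann_eq hp, h.metric.apply_riemann_eq hx]
  simp only [h.fderiv_fderiv_metric_spatial hx, h.christoffel_spatial hx, hn]
  rw [mul_inv]
  ring

/-- The combination `∂_t + c φ` of Killing fields is a Killing field. -/
theorem killing_add (h : IsStationaryOn q α Ω φ s) (c : ℝ) :
    IsKillingOn (admMetric q α (fun y => -(Ω y • φ y))) (fun p => ((1 : ℝ), c • φ p.2))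
      (Set.univ ×ˢ s) := by
  rintro ⟨t, x⟩ ⟨-, hx⟩ u v
  have h1 := h.killing (t, x) ⟨trivial, hx⟩ u v
  have hφ := (h.contDiffAt_axial hx).differentiableAt (n := ∞) (by simp)
  have h2 : ∀ w : ℝ × E, fderiv ℝ (fun p : ℝ × E => ((0 : ℝ), φ p.2)) (t, x) w =
      (0, fderiv ℝ φ x w.2) := by
    intro w
    rw [fderiv_comp_snd (f := fun y => ((0 : ℝ), φ y)) (p := (t, x))
      ((differentiableAt_const _).prodMk hφ), ((hasFDerivAt_const (0 : ℝ) x).prodMk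
      hφ.hasFDerivAt).fderiv]
    rfl
  have h3 : ∀ w : ℝ × E, fderiv ℝ (fun p : ℝ × E => ((1 : ℝ), c • φ p.2)) (t, x) w =
      c • (0, fderiv ℝ φ x w.2) := by
    intro w
    rw [fderiv_comp_snd (f := fun y => ((1 : ℝ), c • φ y)) (p := (t, x))
      ((differentiableAt_const _).prodMk (hφ.const_smul c)), ((hasFDerivAt_const (1 : ℝ) x).prodMk
      (hφ.hasFDerivAt.fun_const_smul c)).fderiv]
    simp
  -- The metric components do not depend on `t`, so the time component of the direction contributes
  -- nothing.
  have h4 : fderiv ℝ (admMetric q α (fun y => -(Ω y • φ y))) (t, x) (1, c • φ x) u v =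
      c * fderiv ℝ (admMetric q α (fun y => -(Ω y • φ y))) (t, x) (0, φ x) u v := by
    rw [h.fderiv_metric hx, h.fderiv_metric hx]
    simp
  rw [lieMetric, h2, h2] at h1
  rw [lieMetric, h3, h3, h4]
  simp only [map_smul, smul_apply, smul_eq_mul]
  linear_combination c * h1

/-- The curvature along the normal direction, at a point where `Ω` does not vary in the tangential
direction `e`. -/
theorem apply_riemann_normal (h : IsStationaryOn q α Ω φ s) (hE : Module.finrank ℝ E = 3)
    (hx : x ∈ s) {n e₁ e₂ : E} (hf : IsOrthonormalFrame (q x) n e₁ e₂)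
    (h₁ : fderiv ℝ Ω x e₁ = 0) (h₂ : fderiv ℝ Ω x e₂ = 0) {e : E} (he : fderiv ℝ Ω x e = 0) :
    admMetric q α (fun y => -(Ω y • φ y)) (t, x)
        (riemann (admMetric q α (fun y => -(Ω y • φ y))) (t, x) (1, Ω x • φ x) (1, Ω x • φ x) (0, e))
        (0, e) =
      α x * hess q α x e e + ((1 / 2) * fderiv ℝ Ω x n * q x (φ x) e) ^ 2 := by
  have hp : (t, x) ∈ (Set.univ ×ˢ s : Set (ℝ × E)) := ⟨trivial, hx⟩
  have hα0 := (h.lapse_pos x hx).ne'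
  -- With the constant `Ω x`, the Killing field `∂_t + Ω(x) φ` equals `α` times the unit normal at
  -- `x`, and its squared norm differs from `-α²` only by a multiple of `(Ω x - Ω)²`.
  have hK := h.killing_add (Ω x)
  have hq := h.metric.differentiableAt hx
  have hα := (h.contDiffAt_lapse hx).differentiableAt (n := ∞) (by simp)
  have hα1 := (contDiffAt_fderiv (h.contDiffAt_lapse hx)).differentiableAt (n := ∞) (by simp)
  have hΩ := (h.contDiffAt_omega hx).differentiableAt (n := ∞) (by simp)
  have hφ := (h.contDiffAt_axial hx).differentiableAt (n := ∞) (by simp)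
  have hV : ContDiffAt ℝ ∞ (fun p : ℝ × E => ((1 : ℝ), Ω x • φ p.2)) (t, x) :=
    contDiffAt_const.prodMk (contDiffAt_const.smul
      ((h.contDiffAt_axial hx).comp (t, x) contDiffAt_snd))
  -- the squared norm of the Killing field
  set H : E → ℝ := fun y => -(α y) ^ 2 + (Ω x - Ω y) ^ 2 * q y (φ y) (φ y) with hH
  have hnorm : (fun p : ℝ × E => admMetric q α (fun y => -(Ω y • φ y)) p (1, Ω x • φ p.2)
      (1, Ω x • φ p.2)) = fun p => H p.2 := by
    funext p
    rw [admMetric_apply]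
    simp [hH, ← sub_eq_add_neg, ← sub_smul]
    ring
  have hHd : ∀ y ∈ s, ContDiffAt ℝ ∞ H y := fun y hy =>
    ((h.contDiffAt_lapse hy).pow 2).neg.add (((contDiffAt_const.sub (h.contDiffAt_omega hy)).pow
      2).mul (((h.metric.contDiffAt hy).clm_apply (h.contDiffAt_axial hy)).clm_apply
        (h.contDiffAt_axial hy)))
  have hdH : ∀ y ∈ s, ∀ u, fderiv ℝ H y u = -(2 * α y * fderiv ℝ α y u)
      + (Ω x - Ω y) * ((Ω x - Ω y) * fderiv ℝ (fun y => q y (φ y) (φ y)) y u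
        - 2 * fderiv ℝ Ω y u * q y (φ y) (φ y)) := by
    intro y hy u
    have hqy := h.metric.differentiableAt hy
    have hαy := (h.contDiffAt_lapse hy).differentiableAt (n := ∞) (by simp)
    have hΩy := (h.contDiffAt_omega hy).differentiableAt (n := ∞) (by simp)
    have hφy := (h.contDiffAt_axial hy).differentiableAt (n := ∞) (by simp)
    have hN : DifferentiableAt ℝ (fun y => q y (φ y) (φ y)) y := by fun_prop
    rw [hH, fderiv_fun_add (by fun_prop) (by fun_prop), fderiv_fun_neg,
      fderiv_fun_mul (by fun_prop) hN, fderiv_fun_pow _ hαy, fderiv_fun_pow _ (by fun_prop),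
      fderiv_const_sub]
    simp
    ring
  have hdH0 : ∀ u, fderiv ℝ H x u = -(2 * α x * fderiv ℝ α x u) := by
    intro u; rw [hdH x hx]; ring
  -- The correction `(Ω x - Ω)² |φ|²` contributes only `2 dΩ(e)² |φ|²` here, which is zero by `he`.
  have hddH : fderiv ℝ (fun y => fderiv ℝ H y e) x e =
      -(2 * α x * fderiv ℝ (fderiv ℝ α) x e e) - 2 * fderiv ℝ α x e ^ 2 := by
    have h5 : (fun y => fderiv ℝ H y e) =ᶠ[𝓝 x] fun y => -(2 * α y * fderiv ℝ α y e)
      + (Ω x - Ω y) * ((Ω x - Ω y) * fderiv ℝ (fun y => q y (φ y) (φ y)) y e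
        - 2 * fderiv ℝ Ω y e * q y (φ y) (φ y)) := by
      filter_upwards [h.metric.eventually_mem hx] with y hy using hdH y hy e
    have hΩ1 := (contDiffAt_fderiv (h.contDiffAt_omega hx)).differentiableAt (n := ∞) (by simp)
    have hN1 := (contDiffAt_fderiv (((h.metric.contDiffAt hx).clm_apply
      (h.contDiffAt_axial hx)).clm_apply (h.contDiffAt_axial hx))).differentiableAt
        (n := ∞) (by simp)
    rw [h5.fderiv_eq, fderiv_fun_add (by fun_prop) (by fun_prop), fderiv_fun_neg,
      fderiv_fun_mul (by fun_prop) (by fun_prop), fderiv_const_mul hα,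
      fderiv_fun_mul (by fun_prop) (by fun_prop), fderiv_const_sub]
    simp only [add_apply, neg_apply, smul_apply, smul_eq_mul, sub_self, zero_mul, he,
      fderiv_fderiv_apply (h.contDiffAt_lapse hx)]
    ring
  have hR := h.isMetricOn.apply_riemann_killing hK hp hV (0, e)
  simp only [hnorm] at hR
  have hHp : ∀ y ∈ s, ∀ (t : ℝ) (U : ℝ × E),
      fderiv ℝ (fun p : ℝ × E => H p.2) (t, y) U = fderiv ℝ H y U.2 := fun y hy t U =>
    fderiv_comp_snd (p := (t, y)) ((hHd y hy).differentiableAt (by simp)) U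
  have hH2 : fderiv ℝ (fun p => fderiv ℝ (fun p : ℝ × E => H p.2) p (0, e)) (t, x) (0, e) =
      fderiv ℝ (fun y => fderiv ℝ H y e) x e := by
    have h5 : (fun p => fderiv ℝ (fun p : ℝ × E => H p.2) p (0, e)) =ᶠ[𝓝 (t, x)]
        fun p => fderiv ℝ H p.2 e := by
      filter_upwards [h.isMetricOn.eventually_mem hp] with p hp
      exact hHp p.2 hp.2 p.1 (0, e)
    have hH1 := (contDiffAt_fderiv (hHd x hx)).differentiableAt (n := ∞) (by simp)
    rw [h5.fderiv_eq, fderiv_comp_snd (f := fun y => fderiv ℝ H y e) (by fun_prop)]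
  rw [hH2, hddH, hHp x hx, h.christoffel_spatial hx, hdH0] at hR
  simp only [he, zero_mul, add_zero, mul_zero, zero_smul] at hR
  -- the derivative of the Killing field
  set Y := covDeriv (admMetric q α (fun y => -(Ω y • φ y)))
    (fun p : ℝ × E => ((1 : ℝ), Ω x • φ p.2)) (t, x) (0, e) with hY
  have hV1 := hV.differentiableAt (by simp)
  have hYx : admMetric q α (fun y => -(Ω y • φ y)) (t, x) Y (1, Ω x • φ x) =
      -(α x * fderiv ℝ α x e) := by
    have h6 := h.isMetricOn.fderiv_apply_fields hp hV1 hV1 (0, e)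
    simp only [hnorm] at h6
    rw [hHp x hx, hdH0, h.isMetricOn.symm _ hp (1, Ω x • φ x), ← hY] at h6
    simp only at h6
    linarith
  -- On spatial vectors the covector of the Killing field is `(Ω x - Ω) q(φ, ·)`; at `x` only the
  -- derivative of the first factor survives in its exterior derivative.
  have hYs : ∀ w : E, admMetric q α (fun y => -(Ω y • φ y)) (t, x) Y (0, w) =
      (1 / 2) * fderiv ℝ Ω x w * q x (φ x) e := by
    intro w
    have h6 := h.isMetricOn.two_mul_apply_covDeriv_killing hK hp hV1 (0, e) (0, w)
    have h7 : ∀ a b : E, fderiv ℝ (fun p => admMetric q α (fun y => -(Ω y • φ y)) p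
        (1, Ω x • φ p.2) (0, a)) (t, x) (0, b) = - (fderiv ℝ Ω x b * q x (φ x) a) := by
      intro a b
      have h8 : (fun p => admMetric q α (fun y => -(Ω y • φ y)) p (1, Ω x • φ p.2) (0, a)) =
          fun p : ℝ × E => (fun y => (Ω x - Ω y) * q y (φ y) a) p.2 := by
        funext p
        rw [admMetric_apply]
        simp
        ring
      rw [h8, fderiv_comp_snd (f := fun y => (Ω x - Ω y) * q y (φ y) a) (by fun_prop),
        fderiv_fun_mul (by fun_prop) (by fun_prop), fderiv_const_sub]
      simp
      ring
    rw [h7, h7, he, ← hY] at h6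
    linarith
  -- The vector `Y` is split along the slice normal and the frame. The timelike part `-dα(e)²` later
  -- cancels the same square from the Hessian of `-α²`; the spatial part is radial because `dΩ` is.
  have hYY : admMetric q α (fun y => -(Ω y • φ y)) (t, x) Y Y =
      -(fderiv ℝ α x e) ^ 2 + ((1 / 2) * fderiv ℝ Ω x n * q x (φ x) e) ^ 2 := by
    have h8 : Y = (0, Y.2 - Y.1 • (Ω x • φ x)) + Y.1 • ((1 : ℝ), Ω x • φ x) := by
      ext <;> simp
    have h9 : ∀ w : E, q x (Y.2 - Y.1 • (Ω x • φ x)) w = (1 / 2) * fderiv ℝ Ω x w * q x (φ x) e := by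
      intro w
      rw [← hYs, admMetric_apply]
      simp [sub_eq_add_neg]
    have h10 : Y.1 = (α x)⁻¹ * fderiv ℝ α x e := by
      have h11 : -(α x) ^ 2 * Y.1 = -(α x * fderiv ℝ α x e) := by
        rw [← hYx, admMetric_apply]
        simp
      field_simp
      have : α x * (Y.1 * α x) = α x * fderiv ℝ α x e := by linarith
      linarith [mul_left_cancel₀ hα0 this]
    rw [admMetric_apply]
    have h12 : Y.2 + Y.1 • -(Ω x • φ x) = Y.2 - Y.1 • (Ω x • φ x) := by
      rw [smul_neg, sub_eq_add_neg]
    simp only at h12 ⊢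
    rw [h12, hf.apply_eq hE, h9, h9, h9, h₁, h₂, h10]
    field_simp
    ring
  rw [hYY] at hR
  rw [hR, hess]
  ring

/-- The sum of the normal-normal and radial-radial components of the Ricci tensor, at a point where
the differential of `Ω` is radial. -/
theorem ricci_add_ricci (h : IsStationaryOn q α Ω φ s) (hE : Module.finrank ℝ E = 3)
    (hx : x ∈ s) {n e₁ e₂ : E} (hf : IsOrthonormalFrame (q x) n e₁ e₂)
    (h₁ : fderiv ℝ Ω x e₁ = 0) (h₂ : fderiv ℝ Ω x e₂ = 0) :
    ricci (admMetric q α (fun y => -(Ω y • φ y))) (t, x) ((α x)⁻¹ • ((1 : ℝ), Ω x • φ x))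
        ((α x)⁻¹ • ((1 : ℝ), Ω x • φ x))
      + ricci (admMetric q α (fun y => -(Ω y • φ y))) (t, x) (0, n) (0, n) =
      ricci q x n n + (α x)⁻¹ * (hess q α x e₁ e₁ + hess q α x e₂ e₂) := by
  have hp : (t, x) ∈ (Set.univ ×ˢ s : Set (ℝ × E)) := ⟨trivial, hx⟩
  have hα0 := (h.lapse_pos x hx).ne'
  set g := admMetric q α (fun y => -(Ω y • φ y)) with hg
  set N : ℝ × E := (α x)⁻¹ • ((1 : ℝ), Ω x • φ x) with hN
  have hNN : g (t, x) N N = -1 := by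
    rw [hg, admMetric_apply]
    simp [hN, smul_smul]
    field_simp
  have hNs : ∀ w : E, g (t, x) N (0, w) = 0 := by
    intro w
    rw [hg, admMetric_apply]
    simp [hN, smul_smul]
  have hsN : ∀ w : E, g (t, x) (0, w) N = 0 := fun w => by rw [h.isMetricOn.symm _ hp, hNs]
  have hss : ∀ v w : E, g (t, x) (0, v) (0, w) = q x v w := by
    intro v w
    rw [hg, admMetric_apply]
    simp
  have hb : IsPseudoOrthonormal (g (t, x)) (![-1, 1, 1, 1] : Fin 4 → ℝ)
      ![N, (0, n), (0, e₁), (0, e₂)] :=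
    { sign := fun i => by fin_cases i <;> simp
      apply := fun i j => by
        have s1 := hf.symm e₁ n
        have s2 := hf.symm e₂ n
        have s3 := hf.symm e₂ e₁
        fin_cases i <;> fin_cases j <;>
          simp [hNN, hNs, hsN, hss, s1, s2, s3, hf.nn, hf.n₁, hf.n₂, hf.e₁₁, hf.e₁₂, hf.e₂₂] }
  have htr := fun A : (ℝ × E) →ₗ[ℝ] (ℝ × E) => hb.trace_eq (by simp [hE]) A
  have hself : ∀ v w : ℝ × E, riemann g (t, x) v w v = 0 := fun v w => by
    rw [riemann_apply]; abel
  have hself' : ∀ v w : E, riemann q x v w v = 0 := fun v w => by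
    rw [riemann_apply]; abel
  -- The curvature of the plane of `N` and `n` enters the two Ricci components with opposite signs,
  -- since `N` is timelike.
  have hpair := h.isMetricOn.riemann_pair_symm hp N (0, n)
  have hG := h.apply_riemann_spatial (t := t) hx
  have hnormal : ∀ e, fderiv ℝ Ω x e = 0 → g (t, x) (riemann g (t, x) N N (0, e)) (0, e) =
      (α x)⁻¹ * hess q α x e e + ((2 * α x)⁻¹ * fderiv ℝ Ω x n * q x (φ x) e) ^ 2 := by
    intro e he
    have h1 := h.apply_riemann_normal (t := t) hE hx hf h₁ h₂ he
    have h2 : riemann g (t, x) N N (0, e) = ((α x)⁻¹ * (α x)⁻¹) •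
        riemann g (t, x) (1, Ω x • φ x) (1, Ω x • φ x) (0, e) := by
      rw [hN]
      simp only [riemann_apply, map_smul, smul_apply, smul_sub, smul_add, smul_smul]
    rw [h2, map_smul, smul_apply, h1, smul_eq_mul, mul_inv]
    field_simp
  rw [ricci_apply, ricci_apply, ricci_apply, htr, htr, hf.trace_eq hE]
  simp only [Fin.sum_univ_four, ContinuousLinearMap.coe_coe]
  simp only [Matrix.cons_val_zero, Matrix.cons_val_one, Matrix.cons_val, hself, hself', map_zero,
    zero_apply, mul_zero, one_mul, zero_add, neg_mul, add_zero]
  -- For `dΩ(e) = 0` the second fundamental form has `K(e, e) = 0`, so Gauss contributes only `-K(e,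
  -- n)²`. This is the negative of the square in `hnormal`.
  rw [hnormal e₁ h₁, hnormal e₂ h₂, hG e₁ n, hG e₂ n, h₁, h₂, ← hpair]
  ring

end IsStationaryOn

end Einstein

end Coord

namespace Coord

/-! ### Geodesics touching a hypersurface from inside -/

section Geodesic

/-- A function that vanishes to first order and does not increase to the right has nonpositive
second derivative. -/
theorem second_deriv_nonpos_of_nonpos_right {F F' : ℝ → ℝ} {a : ℝ}
    (hF : ∀ᶠ s in 𝓝 (0 : ℝ), HasDerivAt F (F' s) s) (hF' : HasDerivAt F' a 0) (h0 : F 0 = 0)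
    (h1 : F' 0 = 0) (hle : ∃ ε > 0, ∀ s ∈ Set.Ico 0 ε, F s ≤ 0) : a ≤ 0 := by
  by_contra! ha
  -- If `a > 0`, then `F'` is positive just to the right of `0`, so `F` increases strictly from `F 0
  -- = 0`, contrary to `hle`.
  have h2 := hasDerivAt_iff_tendsto_slope.1 hF'
  have h3 : ∀ᶠ s in 𝓝[≠] (0 : ℝ), 0 < slope F' 0 s := h2.eventually (lt_mem_nhds ha)
  rw [eventually_nhdsWithin_iff] at h3
  obtain ⟨η, hη, hb⟩ := Metric.eventually_nhds_iff.1 (hF.and h3)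
  obtain ⟨ε, hε, hle⟩ := hle
  set δ := min η ε / 2 with hδ
  have hδ0 : 0 < δ := by positivity
  have hδη : δ < η := by
    have := min_le_left η ε
    have : 0 < min η ε := by positivity
    linarith
  have hδε : δ < ε := by
    have := min_le_right η ε
    have : 0 < min η ε := by positivity
    linarith
  have hin : ∀ s ∈ Set.Icc 0 δ, dist s 0 < η := by
    intro s hs
    rw [Real.dist_eq, sub_zero, abs_of_nonneg hs.1]
    exact hs.2.trans_lt hδη
  have hmono : StrictMonoOn F (Set.Icc 0 δ) := by
    refine strictMonoOn_of_deriv_pos (convex_Icc 0 δ)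
      (fun s hs => (hb (hin s hs)).1.continuousAt.continuousWithinAt) fun s hs => ?_
    rw [interior_Icc] at hs
    have h4 := hb (hin s (Set.Ioo_subset_Icc_self hs))
    rw [h4.1.deriv]
    have h5 := h4.2 hs.1.ne'
    rw [slope_def_field, h1, sub_zero, sub_zero] at h5
    exact (div_pos_iff_of_pos_right hs.1).1 h5
  have h6 := hmono ⟨le_rfl, hδ0.le⟩ ⟨hδ0.le, le_rfl⟩ hδ0
  rw [h0] at h6
  exact absurd (hle δ ⟨hδ0.le, hδε⟩) (not_le.2 h6)

variable {E : Type*} [NormedAddCommGroup E] [NormedSpace ℝ E]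

/-- A geodesic that starts tangentially to the surface `{f = 0}` and stays in `{f ≤ 0}`. -/
theorem hess_nonpos_of_geodesic {f : E → ℝ} {s : Set E} (hs : IsOpen s) (hf : ContDiffOn ℝ ∞ f s)
    {c : ℝ → E} {δ : ℝ} (hδ : 0 < δ) {w : E} (hmem : ∀ τ ∈ Set.Ioo (-δ) δ, c τ ∈ s)
    (hc : ∀ τ ∈ Set.Ioo (-δ) δ, HasDerivAt c (deriv c τ) τ) (hc2 : HasDerivAt (deriv c) w 0)
    (h0 : f (c 0) = 0) (h1 : fderiv ℝ f (c 0) (deriv c 0) = 0)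
    (hle : ∃ ε > 0, ∀ τ ∈ Set.Ico 0 ε, f (c τ) ≤ 0) :
    fderiv ℝ (fderiv ℝ f) (c 0) (deriv c 0) (deriv c 0) + fderiv ℝ f (c 0) w ≤ 0 := by
  have hI : (0 : ℝ) ∈ Set.Ioo (-δ) δ := ⟨by linarith, hδ⟩
  have hfc : ∀ τ ∈ Set.Ioo (-δ) δ, ContDiffAt ℝ ∞ f (c τ) := fun τ hτ =>
    hf.contDiffAt (hs.mem_nhds (hmem τ hτ))
  refine second_deriv_nonpos_of_nonpos_right (F := fun τ => f (c τ))
    (F' := fun τ => fderiv ℝ f (c τ) (deriv c τ)) ?_ ?_ h0 h1 hle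
  · filter_upwards [isOpen_Ioo.mem_nhds hI] with τ hτ
    exact ((hfc τ hτ).differentiableAt (by simp)).hasFDerivAt.comp_hasDerivAt τ (hc τ hτ)
  · have h2 := ((contDiffAt_fderiv (hfc 0 hI)).differentiableAt
      (by simp)).hasFDerivAt.comp_hasDerivAt 0 (hc 0 hI)
    exact h2.clm_apply hc2

variable [FiniteDimensional ℝ E]

/-- Local existence of geodesics. -/
theorem IsMetricOn.exists_geodesic {g : E → E →L[ℝ] E →L[ℝ] ℝ} {s : Set E} (hg : IsMetricOn g s)
    {x : E} (hx : x ∈ s) (v : E) :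
    ∃ (c : ℝ → E) (δ : ℝ), 0 < δ ∧ c 0 = x ∧ deriv c 0 = v ∧ ContDiffOn ℝ 2 c (Set.Ioo (-δ) δ) ∧
      (∀ τ ∈ Set.Ioo (-δ) δ, c τ ∈ s) ∧ ∀ τ ∈ Set.Ioo (-δ) δ,
        HasDerivAt c (deriv c τ) τ ∧
        HasDerivAt (deriv c) (-christoffel g (c τ) (deriv c τ) (deriv c τ)) τ := by
  have := FiniteDimensional.complete ℝ E
  -- The geodesic equation as an autonomous first-order system for position and velocity.
  set X : E × E → E × E := fun z => (z.2, -christoffel g z.1 z.2 z.2) with hX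
  have hXd : ContDiffAt ℝ 1 X (x, v) := by
    have h1 : ContDiffAt ℝ 1 (fun z : E × E => christoffel g z.1) (x, v) :=
      ((hg.contDiffAt_christoffel hx).of_le (by simp)).comp (x, v) contDiffAt_fst
    exact contDiffAt_snd.prodMk ((h1.clm_apply contDiffAt_snd).clm_apply contDiffAt_snd).neg
  obtain ⟨z, hz0, ε, hε, hz⟩ :=
    hXd.exists_forall_mem_closedBall_exists_eq_forall_mem_Ioo_hasDerivAt₀ 0
  simp only [zero_sub, zero_add] at hz
  have hz1 : ∀ τ ∈ Set.Ioo (-ε) ε, HasDerivAt (fun τ => (z τ).1) (z τ).2 τ := fun τ hτ =>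
    (hasFDerivAt_fst (p := z τ)).comp_hasDerivAt τ (hz τ hτ)
  have hz2 : ∀ τ ∈ Set.Ioo (-ε) ε, HasDerivAt (fun τ => (z τ).2)
      (-christoffel g (z τ).1 (z τ).2 (z τ).2) τ := fun τ hτ =>
    (hasFDerivAt_snd (p := z τ)).comp_hasDerivAt τ (hz τ hτ)
  have h0 : (0 : ℝ) ∈ Set.Ioo (-ε) ε := ⟨by linarith, hε⟩
  have hc : ContinuousAt (fun τ => (z τ).1) 0 := (hz1 0 h0).continuousAt
  have hs : ∀ᶠ τ in 𝓝 (0 : ℝ), (z τ).1 ∈ s :=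
    hc.eventually (by simpa only [hz0] using hg.eventually_mem hx)
  obtain ⟨η, hη, hb⟩ := Metric.eventually_nhds_iff.1 hs
  set δ := min η ε with hδ
  have hδ0 : 0 < δ := lt_min hη hε
  have hsub : Set.Ioo (-δ) δ ⊆ Set.Ioo (-ε) ε :=
    Set.Ioo_subset_Ioo (neg_le_neg (min_le_right _ _)) (min_le_right _ _)
  have hmem : ∀ τ ∈ Set.Ioo (-δ) δ, (z τ).1 ∈ s := by
    intro τ hτ
    refine hb ?_
    rw [Real.dist_eq, sub_zero, abs_lt]
    exact ⟨by linarith [hτ.1, min_le_left η ε], by linarith [hτ.2, min_le_left η ε]⟩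
  have hderiv : ∀ τ ∈ Set.Ioo (-δ) δ, deriv (fun τ => (z τ).1) τ = (z τ).2 := fun τ hτ =>
    (hz1 τ (hsub hτ)).deriv
  have hev : ∀ τ ∈ Set.Ioo (-δ) δ, deriv (fun τ => (z τ).1) =ᶠ[𝓝 τ] fun τ => (z τ).2 := by
    intro τ hτ
    filter_upwards [isOpen_Ioo.mem_nhds hτ] with σ hσ using hderiv σ hσ
  have hd2 : ∀ τ ∈ Set.Ioo (-δ) δ, HasDerivAt (deriv (fun τ => (z τ).1))
      (-christoffel g (z τ).1 (deriv (fun τ => (z τ).1) τ) (deriv (fun τ => (z τ).1) τ)) τ := by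
    intro τ hτ
    rw [hderiv τ hτ]
    exact (hz2 τ (hsub hτ)).congr_of_eventuallyEq (hev τ hτ)
  refine ⟨fun τ => (z τ).1, δ, hδ0, by simp [hz0], ?_, ?_, hmem, fun τ hτ => ⟨?_, hd2 τ hτ⟩⟩
  · rw [hderiv 0 ⟨by linarith, hδ0⟩, hz0]
  -- The solution of the first-order system is only known to be differentiable; continuity of the
  -- second derivative is read off from the geodesic equation.
  · rw [show (2 : ℕ∞ω) = 1 + 1 by norm_num, contDiffOn_succ_iff_deriv_of_isOpen isOpen_Ioo]
    refine ⟨fun τ hτ => (hz1 τ (hsub hτ)).differentiableAt.differentiableWithinAt, by simp, ?_⟩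
    rw [show (1 : ℕ∞ω) = 0 + 1 by norm_num, contDiffOn_succ_iff_deriv_of_isOpen isOpen_Ioo]
    refine ⟨fun τ hτ => (hd2 τ hτ).differentiableAt.differentiableWithinAt, by simp, ?_⟩
    rw [contDiffOn_zero]
    have hcz : ContinuousOn z (Set.Ioo (-δ) δ) := fun τ hτ =>
      (hz τ (hsub hτ)).continuousAt.continuousWithinAt
    have hcΓ : ContinuousOn (fun τ => christoffel g (z τ).1) (Set.Ioo (-δ) δ) := fun τ hτ =>
      ContinuousAt.comp_continuousWithinAt (f := fun τ => (z τ).1) (g := christoffel g)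
        (hg.contDiffAt_christoffel (hmem τ hτ)).continuousAt
        (continuous_fst.continuousAt.comp_continuousWithinAt (hcz τ hτ))
    have hc2 : ContinuousOn (fun τ => (z τ).2) (Set.Ioo (-δ) δ) :=
      continuous_snd.comp_continuousOn hcz
    refine ((hcΓ.clm_apply hc2).clm_apply hc2).neg.congr fun τ hτ => ?_
    rw [(hd2 τ hτ).deriv, hderiv τ hτ]
    rfl
  · rw [hderiv τ hτ]; exact hz1 τ (hsub hτ)

end Geodesic

/-! ### The trapping condition as a bound on the extrinsic curvature -/

section Trapping

variable {E : Type*} [NormedAddCommGroup E] [NormedSpace ℝ E] [FiniteDimensional ℝ E]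

/-- The transversely trapping condition, for a surface that contains the orbits of the axial
field. -/
theorem IsStationaryOn.lapse_mul_extrinsic_le {q : E → E →L[ℝ] E →L[ℝ] ℝ} {α Ω f : E → ℝ}
    {φ : E → E} {s : Set E} {x : E} {t : ℝ} (h : IsStationaryOn q α Ω φ s)
    (hfol : IsFoliation q f s) (hx : x ∈ s) (hfx : f x = 0)
    (hφ : ∀ y ∈ s, f y = 0 → fderiv ℝ f y (φ y) = 0) {c : ℝ} (hΩ : ∀ y ∈ s, f y = 0 → Ω y = c)
    (htrap : ∀ l : ℝ × E, 0 < l.1 → admMetric q α (fun y => -(Ω y • φ y)) (t, x) l l = 0 →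
      fderiv ℝ f x l.2 = 0 → fderiv ℝ (fderiv ℝ f) x l.2 l.2
        - fderiv ℝ f x (christoffel (admMetric q α (fun y => -(Ω y • φ y))) (t, x) l l).2 ≤ 0)
    {u : E} (hu : fderiv ℝ f x u = 0) (huu : q x u u = 1) :
    α x * extrinsic q f x u u ≤ fderiv ℝ α x (unitNormal q f x) := by
  have hp : (t, x) ∈ (Set.univ ×ˢ s : Set (ℝ × E)) := ⟨trivial, hx⟩
  have hα0 := h.lapse_pos x hx
  have hfd := hfol.contDiffAt hx
  have hf1 := (contDiffAt_fderiv hfd).differentiableAt (n := ∞) (by simp)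
  have hqd := h.metric.differentiableAt hx
  have hαd := (h.contDiffAt_lapse hx).differentiableAt (n := ∞) (by simp)
  have hΩd := (h.contDiffAt_omega hx).differentiableAt (n := ∞) (by simp)
  have hφd := (h.contDiffAt_axial hx).differentiableAt (n := ∞) (by simp)
  set g := admMetric q α (fun y => -(Ω y • φ y)) with hg
  set β : E → E := fun y => -(Ω y • φ y) with hβ
  have hgm : IsMetricOn g (Set.univ ×ˢ s) := h.isMetricOn
  have hβd : DifferentiableAt ℝ β x := by fun_prop
  have hfβ : ∀ y ∈ s, f y = 0 → fderiv ℝ f y (β y) = 0 := by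
    intro y hy hy0
    simp [hβ, hφ y hy hy0]
  have hfβx := hfβ x hx hfx
  -- the second derivative along the shift vector
  have hshift : fderiv ℝ (fderiv ℝ f) x (β x) (β x) + fderiv ℝ f x (fderiv ℝ β x (β x)) = 0 := by
    obtain ⟨a, ha⟩ := exists_fderiv_eq_smul_of_const_on_level (F := fun y => fderiv ℝ f y (β y))
      (c := 0) hfd ((contDiffAt_fderiv hfd).clm_apply (h.contDiffAt_shift hx)) hfx
      (hfol.regular x hx) (by
        filter_upwards [hfol.eventually_mem hx] with y hy using hfβ y hy)
    have h1 := congrArg (fun L => L (β x)) ha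
    rw [fderiv_apply_apply hf1 hβd] at h1
    simpa [hfβx] using h1
  have hΩu : fderiv ℝ Ω x u = 0 := by
    obtain ⟨a, ha⟩ := exists_fderiv_eq_smul_of_const_on_level hfd (h.contDiffAt_omega hx) hfx
      (hfol.regular x hx) (c := c) (by
        filter_upwards [hfol.eventually_mem hx] with y hy using hΩ y hy)
    rw [ha]; simp [hu]
  -- `m` is `α` times the unit normal of the slice, so `m + a u` with `u` a unit tangent vector is
  -- null exactly when `a = ± α`; both signs occur among the admissible light rays.
  set m : ℝ × E := (1, -β x) with hm
  have hnull : ∀ a : ℝ, a ^ 2 = α x ^ 2 → g (t, x) (m + a • (0, u)) (m + a • (0, u)) = 0 := by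
    intro a ha
    rw [hg, admMetric_apply]
    simp [hm, huu]
    linarith
  have hkey : ∀ a : ℝ, a ^ 2 = α x ^ 2 →
      (fderiv ℝ (fderiv ℝ f) x (β x) (β x) + a ^ 2 * fderiv ℝ (fderiv ℝ f) x u u
        - 2 * a * fderiv ℝ (fderiv ℝ f) x (β x) u)
      - (fderiv ℝ f x (christoffel g (t, x) m m).2
        + 2 * a * fderiv ℝ f x (christoffel g (t, x) m (0, u)).2
        + a ^ 2 * fderiv ℝ f x (christoffel g (t, x) (0, u) (0, u)).2) ≤ 0 := by
    intro a ha
    have h1 := htrap (m + a • (0, u)) (by simp [hm]) (hnull a ha) (by simp [hm, hu, hfβx])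
    simp only [map_add, map_smul, add_apply, smul_apply, Prod.snd_add, Prod.smul_snd, smul_eq_mul,
      hgm.christoffel_symm hp (0, u) m] at h1
    rw [show m.2 = -β x from rfl] at h1
    simp only [map_neg, neg_apply, neg_neg] at h1
    rw [fderiv_fderiv_symm hfd u (β x)] at h1
    linarith
  -- The mixed terms in `m` and `u` are odd in `a`, so they disappear from the sum of these two
  -- inequalities.
  have hkey1 := hkey (α x) rfl
  have hkey2 := hkey (-α x) (by ring)
  have huu' : (christoffel g (t, x) (0, u) (0, u)).2 = christoffel q x u u := by
    rw [hg, h.christoffel_spatial hx, hΩu]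
    simp
  -- the acceleration of the observers
  have hmm : fderiv ℝ f x (christoffel g (t, x) m m).2 =
      -fderiv ℝ f x (fderiv ℝ β x (β x)) + α x * fderiv ℝ α x (grad q f x) := by
    have h1 : ∀ W : ℝ × E, fderiv ℝ f x W.2 = g (t, x) W (0, grad q f x) := by
      intro W
      rw [hg, admMetric_apply]
      simp only [mul_zero, zero_smul, add_zero, zero_add]
      rw [h.metric.symm x hx, hfol.apply_grad hx, map_add, map_smul, hfβx]
      simp
    have h2 : ∀ a b : ℝ × E, ∀ v, fderiv ℝ g (t, x) v a b =
        fderiv ℝ (fun y => -(α y) ^ 2 * (a.1 * b.1) + q y (a.2 + a.1 • β y) (b.2 + b.1 • β y))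
          x v.2 := fun a b v => h.fderiv_metric hx v a b
    have hb0 : -β x + (1 : ℝ) • β x = 0 := by simp
    have h3 : fderiv ℝ g (t, x) m m (0, grad q f x) = -fderiv ℝ f x (fderiv ℝ β x (β x)) := by
      rw [h2]
      simp only [hm, mul_zero, zero_smul, add_zero, zero_add]
      rw [fderiv_bilin_apply hqd (by fun_prop) (by fun_prop), hb0, fderiv_const_add]
      simp only [one_smul, map_zero, zero_apply, zero_add, fderiv_fun_const, Pi.zero_apply,
        map_neg, neg_apply]
      rw [h.metric.symm x hx, hfol.apply_grad hx]
      simp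
    have h4 : fderiv ℝ g (t, x) (0, grad q f x) m m = -2 * α x * fderiv ℝ α x (grad q f x) := by
      rw [h2]
      simp only [hm, mul_one]
      rw [fderiv_fun_add (by fun_prop) (by fun_prop), add_apply, fderiv_bilin_apply hqd
        (by fun_prop) (by fun_prop), hb0, fderiv_fun_neg, fderiv_fun_pow _ hαd]
      simp
    rw [h1, hgm.apply_christoffel hp, christoffelLower_apply, h3, h4]
    ring
  have hmain : α x * hess q f x u u ≤ fderiv ℝ α x (grad q f x) := by
    have h5 : α x * (α x * hess q f x u u) ≤ α x * fderiv ℝ α x (grad q f x) := by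
      rw [hmm, huu'] at hkey1 hkey2
      rw [hess]
      nlinarith
    exact le_of_mul_le_mul_left h5 hα0
  rw [hfol.extrinsic_eq hx hu, IsFoliation.unitNormal_eq, map_smul, smul_eq_mul]
  have := mul_le_mul_of_nonneg_left hmain (hfol.lapse_pos hx).le
  linarith

end Trapping

end Coord

namespace Coord

/-! ### From the curvature bound to a loosely trapped surface -/

section LooselyTrapped

variable {E : Type*} [NormedAddCommGroup E] [NormedSpace ℝ E]

/-- If `0 ≤ k ≤ c` for a symmetric `2 × 2` matrix `k`, then `tr k² ≤ c tr k`. -/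
theorem sum_sq_le_of_quadratic_bounds {a b d c : ℝ}
    (h0 : ∀ y : ℝ, 0 ≤ a * (y * y) + 2 * b * y + d)
    (h1 : ∀ y : ℝ, a * (y * y) + 2 * b * y + d ≤ c * (y * y + 1)) (ha : 0 ≤ a) (had : a ≤ c) :
    a ^ 2 + 2 * b ^ 2 + d ^ 2 ≤ c * (a + d) := by
  have hd : 0 ≤ d := by simpa using h0 0
  have hdc : d ≤ c := by simpa using h1 0
  -- Both `k` and `c - k` are nonnegative forms, so `b² ≤ a d` and `b² ≤ (c - a)(c - d)`. The
  -- product of these bounds and the inequality of arithmetic and geometric means give `2 b² ≤ a (c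
  -- - a) + d (c - d)`, which is the claim.
  have h2 := discrim_le_zero (a := a) (b := 2 * b) (c := d) fun y => by linarith [h0 y]
  have h3 := discrim_le_zero (a := c - a) (b := -(2 * b)) (c := c - d) fun y => by
    linarith [h1 y]
  rw [discrim] at h2 h3
  have h4 : b ^ 2 ≤ a * d := by linarith
  have h5 : b ^ 2 ≤ (c - a) * (c - d) := by linarith
  have h6 : b ^ 2 * b ^ 2 ≤ (a * d) * ((c - a) * (c - d)) :=
    mul_le_mul h4 h5 (sq_nonneg b) (mul_nonneg ha hd)
  have h7 : (2 * b ^ 2) ^ 2 ≤ (a * (c - a) + d * (c - d)) ^ 2 := by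
    nlinarith [sq_nonneg (a * (c - a) - d * (c - d))]
  have h8 : 0 ≤ a * (c - a) + d * (c - d) :=
    add_nonneg (mul_nonneg ha (by linarith)) (mul_nonneg hd (by linarith))
  have h9 := (le_abs_self _).trans (abs_le_of_sq_le_sq h7 h8)
  linarith

namespace IsFoliation

variable {q : E → E →L[ℝ] E →L[ℝ] ℝ} {f r : E → ℝ} {s : Set E} {x : E}

/-- Rescaling the differential rescales the gradient by the same factor; positivity of `a` keeps the
orientation of the normal. -/
theorem unitNormal_congr {a : ℝ} (ha : 0 < a) (h : fderiv ℝ r x = a • fderiv ℝ f x) :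
    foliationLapse q f x = a * foliationLapse q r x ∧ unitNormal q r x = unitNormal q f x := by
  have hgrad : grad q r x = a • grad q f x := by rw [grad, grad, h, map_smul]
  have h1 : foliationLapse q r x = a⁻¹ * foliationLapse q f x := by
    rw [foliationLapse, foliationLapse, hgrad]
    simp only [map_smul, smul_apply, smul_eq_mul]
    rw [← mul_assoc, Real.sqrt_mul (by positivity), Real.sqrt_mul_self ha.le, mul_inv]
  constructor
  · rw [h1, mul_inv_cancel_left₀ ha.ne']
  · rw [unitNormal_eq, unitNormal_eq, hgrad, h1, smul_smul, mul_right_comm, inv_mul_cancel₀ ha.ne',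
      one_mul]

variable [FiniteDimensional ℝ E]

/-- The extrinsic curvature of a surface does not depend on its defining function. -/
theorem extrinsic_congr (hf : IsFoliation q f s) (hr : IsFoliation q r s) (hx : x ∈ s) {a : ℝ}
    (ha : 0 < a) (h : fderiv ℝ r x = a • fderiv ℝ f x) (hfx : f x = 0)
    (hfr : ∀ y ∈ s, f y = 0 → r y = 0) {u : E} (hu : fderiv ℝ f x u = 0) :
    extrinsic q r x u u = extrinsic q f x u u := by
  have := FiniteDimensional.complete ℝ E
  have hru : fderiv ℝ r x u = 0 := by rw [h]; simp [hu]
  -- Since `r` vanishes on `{f = 0}`, its tangential second derivative is `a` times that of `f`;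
  -- this factor is undone by the ratio of the lapse functions.
  have h1 := fderiv_fderiv_of_const_on_level hf.metric.isOpen hx hf.smooth hr.smooth hfx
    (hf.regular x hx) (c := 0) (by
      filter_upwards [hf.eventually_mem hx] with y hy using hfr y hy) hu (unitNormal q f x)
  have hN := (hf.lapse_pos hx).ne'
  rw [h, smul_apply, hf.fderiv_unitNormal hx, smul_eq_mul, mul_right_comm] at h1
  have h2 := mul_right_cancel₀ (inv_ne_zero hN) h1
  rw [hr.extrinsic_eq hx hru, hf.extrinsic_eq hx hu, hess, hess, h2, h,
    (unitNormal_congr ha h).1]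
  simp only [smul_apply, smul_eq_mul]
  ring

end IsFoliation

variable [FiniteDimensional ℝ E]

/-- The vanishing Ricci sum `hric` removes the curvature and Hessian terms from the variation
formula, leaving `l k - k_{ab} k^{ab}` with `l = α⁻¹ ∂_r̂ α`. Convexity and trapping say `0 ≤ k(u,
u) ≤ l` on unit tangent vectors, which makes this nonnegative. -/
theorem IsStationaryOn.looselyTrapped {q : E → E →L[ℝ] E →L[ℝ] ℝ} {α Ω r : E → ℝ}
    {φ : E → E} {s : Set E} {x : E} {t : ℝ} (h : IsStationaryOn q α Ω φ s)
    (hfol : IsFoliation q r s) (hE : Module.finrank ℝ E = 3) (hx : x ∈ s) (hrx : r x = 0)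
    (hαN : ∀ᶠ y in 𝓝 x, r y = 0 → foliationLapse q r y = α y)
    (hφ : ∀ y ∈ s, r y = 0 → fderiv ℝ r y (φ y) = 0) {c : ℝ} (hΩ : ∀ y ∈ s, r y = 0 → Ω y = c)
    (htrap : ∀ l : ℝ × E, 0 < l.1 → admMetric q α (fun y => -(Ω y • φ y)) (t, x) l l = 0 →
      fderiv ℝ r x l.2 = 0 → fderiv ℝ (fderiv ℝ r) x l.2 l.2
        - fderiv ℝ r x (christoffel (admMetric q α (fun y => -(Ω y • φ y))) (t, x) l l).2 ≤ 0)
    (hconvex : ∀ u, fderiv ℝ r x u = 0 → 0 ≤ extrinsic q r x u u)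
    (hcurved : ∃ u, fderiv ℝ r x u = 0 ∧ extrinsic q r x u u ≠ 0)
    (hric : ricci (admMetric q α (fun y => -(Ω y • φ y))) (t, x) ((α x)⁻¹ • ((1 : ℝ), Ω x • φ x))
        ((α x)⁻¹ • ((1 : ℝ), Ω x • φ x))
      + ricci (admMetric q α (fun y => -(Ω y • φ y))) (t, x) (0, unitNormal q r x)
        (0, unitNormal q r x) = 0) :
    0 < meanCurvature q r x ∧ 0 ≤ meanCurvatureRate q r x := by
  have := FiniteDimensional.complete ℝ E
  have hα0 := h.lapse_pos x hx
  obtain ⟨e₁, e₂, hf⟩ := exists_isOrthonormalFrame hE (h.metric.symm x hx) (h.pos x hx)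
    (hfol.unit hx)
  have he₁ := hfol.fderiv_tangent hx hf.n₁
  have he₂ := hfol.fderiv_tangent hx hf.n₂
  have hΩe : ∀ u, fderiv ℝ r x u = 0 → fderiv ℝ Ω x u = 0 := by
    intro u hu
    obtain ⟨a, ha⟩ := exists_fderiv_eq_smul_of_const_on_level (hfol.contDiffAt hx)
      (h.contDiffAt_omega hx) hrx (hfol.regular x hx) (c := c) (by
        filter_upwards [hfol.eventually_mem hx] with y hy using hΩ y hy)
    rw [ha]; simp [hu]
  rw [h.ricci_add_ricci hE hx hf (hΩe e₁ he₁) (hΩe e₂ he₂)] at hric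
  have hsymm : extrinsic q r x e₂ e₁ = extrinsic q r x e₁ e₂ := by
    rw [hfol.extrinsic_eq hx he₁, hfol.extrinsic_eq hx he₂, hfol.hess_symm hx]
  have hquad : ∀ a b : ℝ, extrinsic q r x (a • e₁ + b • e₂) (a • e₁ + b • e₂) =
      a ^ 2 * extrinsic q r x e₁ e₁ + 2 * a * b * extrinsic q r x e₁ e₂
        + b ^ 2 * extrinsic q r x e₂ e₂ := by
    intro a b
    have := hsymm
    simp only [extrinsic, map_add, map_smul, add_apply, smul_apply, smul_eq_mul] at this ⊢
    rw [this]
    ring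
  have htan : ∀ a b : ℝ, fderiv ℝ r x (a • e₁ + b • e₂) = 0 := by
    intro a b; simp [he₁, he₂]
  have hpos : ∀ a b : ℝ, 0 ≤ a ^ 2 * extrinsic q r x e₁ e₁ + 2 * a * b * extrinsic q r x e₁ e₂
        + b ^ 2 * extrinsic q r x e₂ e₂ := fun a b => by
    rw [← hquad]; exact hconvex _ (htan a b)
  set l := (α x)⁻¹ * fderiv ℝ α x (unitNormal q r x) with hl
  have hle : ∀ a b : ℝ, a ^ 2 * extrinsic q r x e₁ e₁ + 2 * a * b * extrinsic q r x e₁ e₂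
        + b ^ 2 * extrinsic q r x e₂ e₂ ≤ l * (a ^ 2 + b ^ 2) := by
    intro a b
    rcases eq_or_ne (a ^ 2 + b ^ 2) 0 with h0 | h0
    · have ha : a = 0 := by nlinarith [sq_nonneg a, sq_nonneg b]
      have hb : b = 0 := by nlinarith [sq_nonneg a, sq_nonneg b]
      simp [ha, hb]
    · have h1 : 0 < a ^ 2 + b ^ 2 := lt_of_le_of_ne (by positivity) (Ne.symm h0)
      -- The trapping bound is for unit vectors; scaling by `y` extends it to all tangent vectors.
      set y := (Real.sqrt (a ^ 2 + b ^ 2))⁻¹ with hy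
      have hyy : y ^ 2 * (a ^ 2 + b ^ 2) = 1 := by
        rw [hy, inv_pow, Real.sq_sqrt h1.le, inv_mul_cancel₀ h1.ne']
      have h2 := h.lapse_mul_extrinsic_le hfol hx hrx hφ hΩ htrap (htan (y * a) (y * b)) (by
        simp only [map_add, map_smul, add_apply, smul_apply, smul_eq_mul, hf.e₁₁, hf.e₁₂, hf.e₂₂,
          hf.symm e₂ e₁]
        linarith)
      rw [hquad] at h2
      have h3 : y ^ 2 * (a ^ 2 * extrinsic q r x e₁ e₁ + 2 * a * b * extrinsic q r x e₁ e₂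
        + b ^ 2 * extrinsic q r x e₂ e₂) ≤ l := by
        rw [hl, ← div_eq_inv_mul, le_div_iff₀ hα0]
        linarith
      calc _ = (y ^ 2 * (a ^ 2 * extrinsic q r x e₁ e₁ + 2 * a * b * extrinsic q r x e₁ e₂
        + b ^ 2 * extrinsic q r x e₂ e₂)) * (a ^ 2 + b ^ 2) := by
            linear_combination (-(a ^ 2 * extrinsic q r x e₁ e₁
              + 2 * a * b * extrinsic q r x e₁ e₂ + b ^ 2 * extrinsic q r x e₂ e₂)) * hyy
        _ ≤ _ := mul_le_mul_of_nonneg_right h3 h1.le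
  have hk := hfol.meanCurvature_eq hE hx hf
  have h11 : 0 ≤ extrinsic q r x e₁ e₁ := hconvex _ he₁
  have h22 : 0 ≤ extrinsic q r x e₂ e₂ := hconvex _ he₂
  refine ⟨?_, ?_⟩
  · rw [hk]
    refine lt_of_le_of_ne (add_nonneg h11 h22) fun h0 => ?_
    have z11 : extrinsic q r x e₁ e₁ = 0 := by linarith
    have z22 : extrinsic q r x e₂ e₂ = 0 := by linarith
    -- With vanishing diagonal, nonnegativity on `e₁ + e₂` and `e₁ - e₂` forces the off-diagonal
    -- entry to vanish, so `k_{ab} = 0`, contrary to `hcurved`.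
    have p1 := hpos 1 1
    have p2 := hpos 1 (-1)
    rw [z11, z22] at p1 p2
    have z12 : extrinsic q r x e₁ e₂ = 0 := by linarith
    obtain ⟨u, hu, hu0⟩ := hcurved
    refine hu0 ?_
    have hun : q x u (unitNormal q r x) = 0 := by
      rw [h.metric.symm x hx, hfol.apply_unitNormal hx, hu, mul_zero]
    rw [hf.sum_eq hE u, hun, zero_smul, zero_add, hquad, z11, z22, z12]
    ring
  · rw [hfol.meanCurvatureRate_eq_of_lapse_eq hE hx hrx h.lapse_smooth hαN hf, hk, hsymm]
    have h3 := sum_sq_le_of_quadratic_bounds (a := extrinsic q r x e₁ e₁)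
      (b := extrinsic q r x e₁ e₂) (d := extrinsic q r x e₂ e₂) (c := l)
      (fun y => by linarith [hpos y 1]) (fun y => by linarith [hle y 1]) h11
      (by linarith [hle 1 0])
    have h4 : (α x)⁻¹ * (extrinsic q r x e₁ e₁ + extrinsic q r x e₂ e₂) *
        fderiv ℝ α x (unitNormal q r x) =
        l * (extrinsic q r x e₁ e₁ + extrinsic q r x e₂ e₂) := by
      rw [hl]; ring
    rw [h4]
    nlinarith

end LooselyTrapped

end Coord

namespace Coord

/-! ### Locality and coordinate invariance -/

section Congruence

variable {E : Type*} [NormedAddCommGroup E] [NormedSpace ℝ E]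
  {g g' : E → E →L[ℝ] E →L[ℝ] ℝ} {x : E}

/-- Connection and curvature depend only on germs. This is needed because the metric in a chart
agrees with its lapse-and-shift form only over the chart target. -/
theorem christoffelLower_congr (h : g =ᶠ[𝓝 x] g') : christoffelLower g x = christoffelLower g' x := by
  ext u v w
  simp only [christoffelLower_apply, h.fderiv_eq]

theorem christoffel_congr (h : g =ᶠ[𝓝 x] g') : christoffel g x = christoffel g' x := by
  ext u v
  rw [christoffel_apply, christoffel_apply, christoffelLower_congr h, sharp, sharp, h.eq_of_nhds]

theorem ricci_congr (h : g =ᶠ[𝓝 x] g') : ricci g x = ricci g' x := by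
  have h1 : christoffel g =ᶠ[𝓝 x] christoffel g' := by
    filter_upwards [h.eventually_nhds] with y hy using christoffel_congr hy
  ext v w
  rw [ricci_apply, ricci_apply]
  congr 2
  ext u
  rw [riemann_apply, riemann_apply, h1.fderiv_eq, h1.eq_of_nhds]

theorem lieMetric_congr (h : g =ᶠ[𝓝 x] g') {V V' : E → E} (hV : V =ᶠ[𝓝 x] V') (u v : E) :
    lieMetric g V x u v = lieMetric g' V' x u v := by
  rw [lieMetric, lieMetric, h.fderiv_eq, hV.fderiv_eq, h.eq_of_nhds, hV.eq_of_nhds]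

/-- The Lie derivative of a metric is natural under coordinate changes. -/
theorem lieMetric_comp {Φ V V' : E → E} (hΦ : ContDiffAt ℝ ∞ Φ x)
    (hg : ∀ᶠ z in 𝓝 x, ∀ u v, g z u v = g' (Φ z) (fderiv ℝ Φ z u) (fderiv ℝ Φ z v))
    (hV : ∀ᶠ z in 𝓝 x, V' (Φ z) = fderiv ℝ Φ z (V z))
    (dg : DifferentiableAt ℝ g x) (dg' : DifferentiableAt ℝ g' (Φ x))
    (dV : DifferentiableAt ℝ V x) (dV' : DifferentiableAt ℝ V' (Φ x)) (u v : E) :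
    lieMetric g V x u v = lieMetric g' V' (Φ x) (fderiv ℝ Φ x u) (fderiv ℝ Φ x v) := by
  have dΦ := hΦ.differentiableAt (by simp)
  have dΦ1 := (contDiffAt_fderiv hΦ).differentiableAt (n := ∞) (by simp)
  have hg0 := hg.self_of_nhds
  have h1 : ∀ w, fderiv ℝ g x w u v =
      fderiv ℝ g' (Φ x) (fderiv ℝ Φ x w) (fderiv ℝ Φ x u) (fderiv ℝ Φ x v)
        + g' (Φ x) (fderiv ℝ (fderiv ℝ Φ) x w u) (fderiv ℝ Φ x v)
        + g' (Φ x) (fderiv ℝ Φ x u) (fderiv ℝ (fderiv ℝ Φ) x w v) := by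
    intro w
    have h2 : (fun z => g z u v) =ᶠ[𝓝 x]
        fun z => g' (Φ z) (fderiv ℝ Φ z u) (fderiv ℝ Φ z v) := by
      filter_upwards [hg] with z hz using hz u v
    have h3 := congrArg (fun L => L w) (h2.fderiv_eq (𝕜 := ℝ))
    rw [fderiv_bilin_apply dg (by fun_prop) (by fun_prop),
      fderiv_bilin_apply (c := fun z => g' (Φ z)) (dg'.comp x dΦ) (by fun_prop) (by fun_prop),
      show (fun z => g' (Φ z)) = g' ∘ Φ from rfl, fderiv_comp x dg' dΦ,
      fderiv_apply_apply dΦ1 (by fun_prop), fderiv_apply_apply dΦ1 (by fun_prop)] at h3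
    simpa using h3
  have h4 : ∀ w, fderiv ℝ V' (Φ x) (fderiv ℝ Φ x w) =
      fderiv ℝ (fderiv ℝ Φ) x w (V x) + fderiv ℝ Φ x (fderiv ℝ V x w) := by
    intro w
    have h2 : V' ∘ Φ =ᶠ[𝓝 x] fun z => fderiv ℝ Φ z (V z) := hV
    have h3 := congrArg (fun L => L w) (h2.fderiv_eq (𝕜 := ℝ))
    rw [fderiv_comp x dV' dΦ, fderiv_apply_apply dΦ1 dV] at h3
    exact h3
  -- Second derivatives of `Φ` enter on one side through the metric and on the other through the
  -- vector field; they match by symmetry.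
  rw [lieMetric, lieMetric, h1, h4, h4, hg0, hg0, hV.self_of_nhds, fderiv_fderiv_symm hΦ (V x) u,
    fderiv_fderiv_symm hΦ (V x) v]
  simp only [map_add, add_apply]
  ring

end Congruence

end Coord

/-! ### Values and differentials in preferred charts -/

section Charts

variable {E : Type*} [NormedAddCommGroup E] [NormedSpace ℝ E] {H : Type*} [TopologicalSpace H]
  {I : ModelWithCorners ℝ E H} {N : Type*} [TopologicalSpace N] [ChartedSpace H N]

theorem localForm_apply (g : BilinField I N) (p : N) (y u v : E) :
    localForm I g p y u v = g ((extChartAt I p).symm y)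
      (mfderiv 𝓘(ℝ, E) I (extChartAt I p).symm y u)
      (mfderiv 𝓘(ℝ, E) I (extChartAt I p).symm y v) := rfl

theorem localFun_self (f : N → ℝ) (p : N) : localFun I f p (extChartAt I p p) = f p := by
  rw [localFun, extChartAt_to_inv]

variable [IsManifold I ∞ N]

theorem localVector_self (V : ∀ p : N, TangentSpace I p) (p : N) :
    localVector I V p (extChartAt I p p) = (V p : E) := by
  have : IsManifold I 1 N := IsManifold.of_le (n := ∞) (by simp)
  have h : ∀ p' : N, p' = p → (mfderiv I 𝓘(ℝ, E) (extChartAt I p) p' (V p') : E) = V p := by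
    rintro p' rfl
    rw [mfderiv_extChartAt_self]; rfl
  exact h _ (extChartAt_to_inv (I := I) p)

theorem mdifferentiableAt_extChartAt_of_mem {p p' : N} (hp : p' ∈ (extChartAt I p).source) :
    MDifferentiableAt I 𝓘(ℝ, E) (extChartAt I p) p' := by
  rw [extChartAt_source] at hp
  exact (contMDiffAt_extChartAt' (I := I) (n := ∞) hp).mdifferentiableAt (by simp)

theorem contMDiffAt_of_localFun {f : N → ℝ} {p p' : N} (hp : p' ∈ (extChartAt I p).source)
    (hf : ContDiffAt ℝ ∞ (localFun I f p) (extChartAt I p p')) :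
    ContMDiffAt I 𝓘(ℝ, ℝ) ∞ f p' := by
  have h1 : ContMDiffAt I 𝓘(ℝ, ℝ) ∞ (localFun I f p ∘ extChartAt I p) p' := by
    rw [extChartAt_source] at hp
    exact ContMDiffAt.comp p' (contMDiffAt_iff_contDiffAt.2 hf) (contMDiffAt_extChartAt' hp)
  refine h1.congr_of_eventuallyEq ?_
  filter_upwards [(isOpen_extChartAt_source (I := I) p).mem_nhds hp] with z hz
  rw [Function.comp_apply, localFun, (extChartAt I p).left_inv hz]

variable [I.Boundaryless]

theorem mfderiv_extChartAt_comp_mfderiv_symm {p : N} {y : E} (hy : y ∈ (extChartAt I p).target)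
    (v : E) : mfderiv I 𝓘(ℝ, E) (extChartAt I p) ((extChartAt I p).symm y)
      (mfderiv 𝓘(ℝ, E) I (extChartAt I p).symm y v) = v := by
  have : IsManifold I 1 N := IsManifold.of_le (n := ∞) (by simp)
  have h := mfderiv_extChartAt_comp_mfderivWithin_extChartAt_symm (I := I) hy
  rw [I.range_eq_univ, mfderivWithin_univ] at h
  exact congrArg (fun L : E →L[ℝ] E => L v) h

theorem mfderiv_symm_comp_mfderiv_extChartAt {p : N} {y : E} (hy : y ∈ (extChartAt I p).target)
    (v : E) : mfderiv 𝓘(ℝ, E) I (extChartAt I p).symm y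
      (mfderiv I 𝓘(ℝ, E) (extChartAt I p) ((extChartAt I p).symm y) v) = v := by
  have : IsManifold I 1 N := IsManifold.of_le (n := ∞) (by simp)
  have h := mfderivWithin_extChartAt_symm_comp_mfderiv_extChartAt (I := I) hy
  rw [I.range_eq_univ, mfderivWithin_univ] at h
  exact congrArg (fun L : E →L[ℝ] E => L v) h

theorem mfderiv_symm_extChartAt_self (p : N) (v : E) :
    mfderiv 𝓘(ℝ, E) I (extChartAt I p).symm (extChartAt I p p) v = v := by
  have : IsManifold I 1 N := IsManifold.of_le (n := ∞) (by simp)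
  have h := mfderiv_symm_comp_mfderiv_extChartAt (I := I) (mem_extChartAt_target (I := I) p) v
  have h1 : mfderiv I 𝓘(ℝ, E) (extChartAt I p) ((extChartAt I p).symm (extChartAt I p p)) =
      ContinuousLinearMap.id ℝ E := by
    rw [extChartAt_to_inv]
    exact mfderiv_extChartAt_self
  have h2 : (mfderiv I 𝓘(ℝ, E) (extChartAt I p) ((extChartAt I p).symm (extChartAt I p p)) :
    E →L[ℝ] E) v = v := by rw [h1]; rfl
  exact (congrArg (mfderiv 𝓘(ℝ, E) I (extChartAt I p).symm (extChartAt I p p)) h2.symm).trans h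

theorem localForm_self (g : BilinField I N) (p : N) (u v : E) :
    localForm I g p (extChartAt I p p) u v = g p u v := by
  rw [localForm_apply, mfderiv_symm_extChartAt_self, mfderiv_symm_extChartAt_self]
  have h : ∀ p' : N, p' = p → (g p' : E →L[ℝ] E →L[ℝ] ℝ) u v = g p u v := by
    rintro p' rfl; rfl
  exact h _ (extChartAt_to_inv (I := I) p)

theorem mdifferentiableAt_symm_extChartAt {p : N} {y : E} (hy : y ∈ (extChartAt I p).target) :
    MDifferentiableAt 𝓘(ℝ, E) I (extChartAt I p).symm y :=
  ((contMDiffOn_extChartAt_symm (I := I) (n := ∞) p).contMDiffAt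
    ((isOpen_extChartAt_target p).mem_nhds hy)).mdifferentiableAt (by simp)

/-- The differential of a function in a chart. -/
theorem fderiv_localFun {f : N → ℝ} {p : N} {y : E} (hy : y ∈ (extChartAt I p).target)
    (hf : MDifferentiableAt I 𝓘(ℝ, ℝ) f ((extChartAt I p).symm y)) (v : E) :
    fderiv ℝ (localFun I f p) y v = mfderiv I 𝓘(ℝ, ℝ) f ((extChartAt I p).symm y)
      (mfderiv 𝓘(ℝ, E) I (extChartAt I p).symm y v) := by
  rw [← mfderiv_eq_fderiv]
  have h := mfderiv_comp y hf (mdifferentiableAt_symm_extChartAt (I := I) hy)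
  exact congrArg (fun L : E →L[ℝ] ℝ => L v) h

theorem contDiffAt_localFun {f : N → ℝ} {p : N} {y : E} (hy : y ∈ (extChartAt I p).target)
    (hf : ContMDiffAt I 𝓘(ℝ, ℝ) ∞ f ((extChartAt I p).symm y)) :
    ContDiffAt ℝ ∞ (localFun I f p) y := by
  rw [← contMDiffAt_iff_contDiffAt]
  exact hf.comp y ((contMDiffOn_extChartAt_symm (I := I) (n := ∞) p).contMDiffAt
    ((isOpen_extChartAt_target p).mem_nhds hy))

/-- Naturality of the Killing equation: it holds in the chart at `p` away from `p`. -/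
theorem IsKilling.lieMetric_eq_zero {g : BilinField I N} {V : ∀ p : N, TangentSpace I p}
    (hK : IsKilling I g V)
    (hg : ∀ p : N, ∀ y ∈ (extChartAt I p).target, DifferentiableAt ℝ (localForm I g p) y)
    (hV : ∀ p : N, ∀ y ∈ (extChartAt I p).target, DifferentiableAt ℝ (localVector I V p) y)
    {p : N} {y : E} (hy : y ∈ (extChartAt I p).target) (u v : E) :
    Coord.lieMetric (localForm I g p) (localVector I V p) y u v = 0 := by
  set p' : N := (extChartAt I p).symm y with hp'
  -- `IsKilling` tests each point only in its own preferred chart; the transition map to that chart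
  -- carries the equation back to the chart at `p`.
  set Φ : E → E := fun z => extChartAt I p' ((extChartAt I p).symm z) with hΦ
  have hsymm : ∀ z ∈ (extChartAt I p).target, ContMDiffAt 𝓘(ℝ, E) I ∞ (extChartAt I p).symm z :=
    fun z hz => (contMDiffOn_extChartAt_symm (I := I) (n := ∞) p).contMDiffAt
      ((isOpen_extChartAt_target p).mem_nhds hz)
  have hΦd : ContDiffAt ℝ ∞ Φ y := by
    rw [← contMDiffAt_iff_contDiffAt]
    exact ContMDiffAt.comp y (contMDiffAt_extChartAt (I := I) (x := p')) (hsymm y hy)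
  have hev : ∀ᶠ z in 𝓝 y, z ∈ (extChartAt I p).target ∧
      (extChartAt I p).symm z ∈ (extChartAt I p').source := by
    refine Filter.Eventually.and ((isOpen_extChartAt_target (I := I) p).mem_nhds hy) ?_
    exact (hsymm y hy).continuousAt.eventually
      ((isOpen_extChartAt_source (I := I) p').mem_nhds (mem_extChartAt_source (I := I) p'))
  have hfd : ∀ z, z ∈ (extChartAt I p).target →
      (extChartAt I p).symm z ∈ (extChartAt I p').source → ∀ w : E, fderiv ℝ Φ z w =
        mfderiv I 𝓘(ℝ, E) (extChartAt I p') ((extChartAt I p).symm z)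
          (mfderiv 𝓘(ℝ, E) I (extChartAt I p).symm z w) := by
    intro z hz hz' w
    rw [← mfderiv_eq_fderiv]
    have h := mfderiv_comp z (mdifferentiableAt_extChartAt_of_mem (I := I) hz')
      (mdifferentiableAt_symm_extChartAt (I := I) hz)
    exact congrArg (fun L : E →L[ℝ] E => L w) h
  have hback : ∀ z, z ∈ (extChartAt I p).target →
      (extChartAt I p).symm z ∈ (extChartAt I p').source →
      (extChartAt I p').symm (Φ z) = (extChartAt I p).symm z := fun z _ hz' =>
    (extChartAt I p').left_inv hz'
  have hΦt : ∀ z, (extChartAt I p).symm z ∈ (extChartAt I p').source →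
      Φ z ∈ (extChartAt I p').target := fun z hz' => (extChartAt I p').map_source hz'
  have hyt := mem_extChartAt_target (I := I) p'
  rw [Coord.lieMetric_comp (g' := localForm I g p') (V' := localVector I V p') hΦd ?_ ?_ (hg p y hy)
    (hg p' _ hyt) (hV p y hy) (hV p' _ hyt)]
  · exact hK p' _ _
  · filter_upwards [hev] with z ⟨hz, hz'⟩ u v
    have h1 : ∀ a b : N, a = b → ∀ u v : E, (g a : E →L[ℝ] E →L[ℝ] ℝ) u v = g b u v := by
      rintro a b rfl u v; rfl
    have h2 : ∀ w : E, mfderiv 𝓘(ℝ, E) I (extChartAt I p').symm (Φ z) (fderiv ℝ Φ z w) =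
        mfderiv 𝓘(ℝ, E) I (extChartAt I p).symm z w := by
      intro w
      have h3 := mfderiv_symm_comp_mfderiv_extChartAt (I := I) (hΦt z hz')
        (mfderiv 𝓘(ℝ, E) I (extChartAt I p).symm z w)
      rw [hfd z hz hz']
      rw [hback z hz hz'] at h3
      exact h3
    rw [localForm_apply, localForm_apply, h2, h2]
    exact h1 _ _ (hback z hz hz').symm _ _
  · filter_upwards [hev] with z ⟨hz, hz'⟩
    rw [hfd z hz hz']
    have h1 := mfderiv_symm_comp_mfderiv_extChartAt (I := I) hz (V ((extChartAt I p).symm z))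
    have h2 : ∀ a b : N, a = b → (mfderiv I 𝓘(ℝ, E) (extChartAt I p') a (V a) : E) =
        mfderiv I 𝓘(ℝ, E) (extChartAt I p') b (V b) := by
      rintro a b rfl; rfl
    have h3 := h2 _ _ (hback z hz hz')
    rw [localVector, localVector, h3]
    exact congrArg (mfderiv I 𝓘(ℝ, E) (extChartAt I p') ((extChartAt I p).symm z)) h1.symm

end Charts

/-! ### Smoothness of components in a chart -/

section Smoothness

variable {E : Type*} [NormedAddCommGroup E] [NormedSpace ℝ E] {H : Type*} [TopologicalSpace H]
  {I : ModelWithCorners ℝ E H} {N : Type*} [TopologicalSpace N] [ChartedSpace H N]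
  [IsManifold I ∞ N] [I.Boundaryless]

/-- Over the chart domain at `p`, the tangent bundle trivialization at `p` acts on fibres as the
derivative of the chart, so the components are the section read in that trivialization. -/
theorem contDiffAt_localVector {V : ∀ p : N, TangentSpace I p}
    (hV : ContMDiff I I.tangent ∞ (fun x => (⟨x, V x⟩ : TangentBundle I N))) {p : N} {y : E}
    (hy : y ∈ (extChartAt I p).target) : ContDiffAt ℝ ∞ (localVector I V p) y := by
  have : IsManifold I 1 N := IsManifold.of_le (n := ∞) (by simp)
  have : IsManifold I (∞ + 1) N := by simpa
  have hx : (extChartAt I p).symm y ∈ (chartAt H p).source := by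
    rw [← extChartAt_source I]
    exact (extChartAt I p).map_target hy
  have h1 : ContMDiffAt I 𝓘(ℝ, E) ∞ (fun x => (trivializationAt E (TangentSpace I) p ⟨x, V x⟩).2)
      ((extChartAt I p).symm y) :=
    ((trivializationAt E (TangentSpace I) p).contMDiffAt_section_iff (IB := I) (n := ∞)
      (by simpa using hx)).1 (hV _)
  have h2 := h1.comp y ((contMDiffOn_extChartAt_symm (I := I) (n := ∞) p).contMDiffAt
    ((isOpen_extChartAt_target p).mem_nhds hy))
  refine (contMDiffAt_iff_contDiffAt.1 h2).congr_of_eventuallyEq ?_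
  filter_upwards [(isOpen_extChartAt_target (I := I) p).mem_nhds hy] with z hz
  have hz' : (extChartAt I p).symm z ∈ (chartAt H p).source := by
    rw [← extChartAt_source I]
    exact (extChartAt I p).map_target hz
  have h3 := congrArg (fun L : E →L[ℝ] E => L (V ((extChartAt I p).symm z)))
    (TangentBundle.continuousLinearMapAt_trivializationAt (I := I) (𝕜 := ℝ) hz')
  refine h3.symm.trans ?_
  exact congrFun ((trivializationAt E (TangentSpace I) p).coe_linearMapAt_of_mem (R := ℝ)
    (by simpa using hz')) _

theorem mfderiv_symm_injective {p : N} {y : E} (hy : y ∈ (extChartAt I p).target) {v : E}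
    (hv : (mfderiv 𝓘(ℝ, E) I (extChartAt I p).symm y v : E) = 0) : v = 0 := by
  have h := mfderiv_extChartAt_comp_mfderiv_symm (I := I) hy v
  rw [← h]
  exact (congrArg (mfderiv I 𝓘(ℝ, E) (extChartAt I p) ((extChartAt I p).symm y)) hv).trans
    (map_zero _)

variable [FiniteDimensional ℝ E]

/-- The inverse trivialization turns constant vectors into smooth fields, which are the coordinate
fields of the chart; pairing them with `q` gives the components. -/
theorem contDiffAt_localForm
    (q : Bundle.ContMDiffRiemannianMetric I ∞ E (fun x : N => TangentSpace I x)) {p : N} {y : E}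
    (hy : y ∈ (extChartAt I p).target) : ContDiffAt ℝ ∞ (localForm I q.inner p) y := by
  have : IsManifold I 1 N := IsManifold.of_le (n := ∞) (by simp)
  have : IsManifold I (∞ + 1) N := by simpa
  have hopen := isOpen_extChartAt_target (I := I) p
  set e := trivializationAt E (TangentSpace I (M := N)) p with he
  have hbase : ∀ z ∈ (extChartAt I p).target, (extChartAt I p).symm z ∈ (chartAt H p).source := by
    intro z hz
    rw [← extChartAt_source I]
    exact (extChartAt I p).map_target hz
  have hsec : ∀ u : E, ∀ z ∈ (extChartAt I p).target, ContMDiffAt I (I.prod 𝓘(ℝ, E)) ∞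
      (fun x : N => Bundle.TotalSpace.mk' E x (e.symmL ℝ x u)) ((extChartAt I p).symm z) := by
    intro u z hz
    have hz' : (extChartAt I p).symm z ∈ e.baseSet := by simpa [he] using hbase z hz
    rw [e.contMDiffAt_section_iff hz']
    refine (contMDiffAt_const (c := u)).congr_of_eventuallyEq ?_
    filter_upwards [e.open_baseSet.mem_nhds hz'] with x hx
    rw [Bundle.Trivialization.symmL_apply _ hx]
    exact congrArg Prod.snd (e.apply_mk_symm hx u)
  have hsymm : ∀ z ∈ (extChartAt I p).target, ∀ u : E,
      (e.symmL ℝ ((extChartAt I p).symm z) u : E) =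
        mfderiv 𝓘(ℝ, E) I (extChartAt I p).symm z u := by
    intro z hz u
    have h := TangentBundle.symmL_trivializationAt (I := I) (𝕜 := ℝ) (hbase z hz)
    rw [(extChartAt I p).right_inv hz, I.range_eq_univ, mfderivWithin_univ] at h
    exact congrArg (fun L : E →L[ℝ] E => L u) h
  have happ : ∀ u v : E, ContDiffOn ℝ ∞ (fun z => localForm I q.inner p z u v)
      (extChartAt I p).target := by
    intro u v z hz
    have h1 : ContMDiffAt I (I.prod 𝓘(ℝ)) ∞ (fun x : N => Bundle.TotalSpace.mk' ℝ
        (E := Bundle.Trivial N ℝ) x (q.inner x (e.symmL ℝ x u) (e.symmL ℝ x v)))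
        ((extChartAt I p).symm z) := by
      apply ContMDiffAt.clm_bundle_apply₂ (F₁ := E) (F₂ := E)
      · exact q.contMDiff _
      · exact hsec u z hz
      · exact hsec v z hz
    simp only [Bundle.contMDiffAt_totalSpace] at h1
    have h2 := h1.2.comp z ((contMDiffOn_extChartAt_symm (I := I) (n := ∞) p).contMDiffAt
      (hopen.mem_nhds hz))
    refine ContDiffAt.contDiffWithinAt ?_
    refine (contMDiffAt_iff_contDiffAt.1 h2).congr_of_eventuallyEq ?_
    filter_upwards [hopen.mem_nhds hz] with z' hz'
    rw [localForm_apply, ← hsymm z' hz', ← hsymm z' hz']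
    rfl
  have hmain : ContDiffOn ℝ ∞ (localForm I q.inner p) (extChartAt I p).target := by
    rw [contDiffOn_clm_apply]
    intro u
    rw [contDiffOn_clm_apply]
    exact fun v => happ u v
  exact hmain.contDiffAt (hopen.mem_nhds hy)

theorem isMetricOn_localForm
    (q : Bundle.ContMDiffRiemannianMetric I ∞ E (fun x : N => TangentSpace I x)) (p : N) :
    Coord.IsMetricOn (localForm I q.inner p) (extChartAt I p).target ∧
      ∀ y ∈ (extChartAt I p).target, ∀ v, v ≠ 0 → 0 < localForm I q.inner p y v v := by
  have hpos : ∀ y ∈ (extChartAt I p).target, ∀ v, v ≠ 0 → 0 < localForm I q.inner p y v v := by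
    intro y hy v hv
    rw [localForm_apply]
    exact q.pos _ _ fun h0 => hv (mfderiv_symm_injective (I := I) hy h0)
  refine ⟨⟨isOpen_extChartAt_target p, fun y hy => (contDiffAt_localForm q hy).contDiffWithinAt,
    fun y hy u v => ?_, fun y hy => ?_⟩, hpos⟩
  · rw [localForm_apply, localForm_apply]
    exact q.symm _ _ _
  · refine Coord.isInvertible_of_nondegenerate fun v hv => ?_
    by_contra h0
    exact (hpos y hy v h0).ne' (hv v)

end Smoothness

/-! ### The spacetime metric in product charts -/

section Spacetime

variable {X : Type*} [TopologicalSpace X] [ChartedSpace E3 X]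

theorem extChartAt_I4 (p : ℝ × X) :
    extChartAt I4 p = (PartialEquiv.refl ℝ).prod (extChartAt (𝓡 3) p.2) := by
  rw [extChartAt_prod, extChartAt_model_space_eq_id]

variable [IsManifold (𝓡 3) ∞ X]

theorem mfderiv_symm_I4 (p : ℝ × X) {z : ℝ × E3} (hz : z.2 ∈ (extChartAt (𝓡 3) p.2).target)
    (v : ℝ × E3) : (mfderiv 𝓘(ℝ, ℝ × E3) I4 (extChartAt I4 p).symm z v : ℝ × E3) =
      (v.1, (mfderiv 𝓘(ℝ, E3) (𝓡 3) (extChartAt (𝓡 3) p.2).symm z.2 v.2 : E3)) := by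
  have h1 : ((extChartAt I4 p).symm : ℝ × E3 → ℝ × X) =
      Prod.map id (extChartAt (𝓡 3) p.2).symm := by
    rw [extChartAt_I4]; rfl
  have h2 := mfderiv_prodMap (I := 𝓘(ℝ, ℝ)) (J := 𝓘(ℝ, ℝ)) (p := z) (mdifferentiableAt_id (I := 𝓘(ℝ, ℝ)))
    (mdifferentiableAt_symm_extChartAt (I := 𝓡 3) hz)
  rw [mfderiv_id] at h2
  rw [h1, modelWithCornersSelf_prod, ← chartedSpaceSelf_prod]
  exact congrArg (fun L : (ℝ × E3) →L[ℝ] (ℝ × E3) => L v) h2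

end Spacetime

namespace StationaryData

variable {X : Type*} [TopologicalSpace X] [ChartedSpace E3 X] [IsManifold (𝓡 3) ∞ X]
  (M : StationaryData X)

/-- In a chart the spacetime metric is the metric of the local lapse and shift. -/
theorem localForm_metric (p : ℝ × X) {z : ℝ × E3} (hz : z.2 ∈ (extChartAt (𝓡 3) p.2).target) :
    localForm I4 M.metric p z = Coord.admMetric (localForm (𝓡 3) M.q.inner p.2)
      (localFun (𝓡 3) M.lapse p.2)
      (fun y => -(localFun (𝓡 3) M.omega p.2 y • localVector (𝓡 3) M.φ p.2 y)) z := by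
  refine ContinuousLinearMap.ext fun U => ContinuousLinearMap.ext fun V => ?_
  set y := z.2 with hy
  set x : X := (extChartAt (𝓡 3) p.2).symm y with hx
  set A : E3 →L[ℝ] E3 := mfderiv 𝓘(ℝ, E3) (𝓡 3) (extChartAt (𝓡 3) p.2).symm y with hA
  have h1 : ((extChartAt I4 p).symm z).2 = x := by
    rw [extChartAt_I4]; rfl
  have hs : (M.shift x : E3) =
      A (-(localFun (𝓡 3) M.omega p.2 y • localVector (𝓡 3) M.φ p.2 y)) := by
    have h2 := mfderiv_symm_comp_mfderiv_extChartAt (I := 𝓡 3) hz (M.φ x)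
    have h3 : A (localVector (𝓡 3) M.φ p.2 y) = (M.φ x : E3) := h2
    rw [map_neg, map_smul, h3]
    rfl
  have h4 : ∀ W : ℝ × E3, (mfderiv 𝓘(ℝ, ℝ × E3) I4 (extChartAt I4 p).symm z W : ℝ × E3) =
      (W.1, A W.2) := fun W => mfderiv_symm_I4 p hz W
  have h5 : localForm I4 M.metric p z U V =
      (M.metric ((extChartAt I4 p).symm z) : (ℝ × E3) →L[ℝ] (ℝ × E3) →L[ℝ] ℝ)
        (U.1, A U.2) (V.1, A V.2) := by
    rw [← h4, ← h4]; rfl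
  -- With all fields frozen at the point, the metric of the manifold is an `admMetric` with constant
  -- coefficients, and both sides can be evaluated on vectors.
  obtain ⟨Q, hQ⟩ : ∃ Q : E3 →L[ℝ] E3 →L[ℝ] ℝ, Q = M.q.inner x := ⟨_, rfl⟩
  obtain ⟨b, hb⟩ : ∃ b : E3, b = M.shift x := ⟨_, rfl⟩
  have h6 : (M.metric ((extChartAt I4 p).symm z) : (ℝ × E3) →L[ℝ] (ℝ × E3) →L[ℝ] ℝ) =
      Coord.admMetric (fun _ => Q) (fun _ => M.lapse x) (fun _ => b) z := by
    rw [hQ, hb, ← h1]; rfl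
  have h7 : Coord.admMetric (fun _ => Q) (fun _ => M.lapse x) (fun _ => b) z (U.1, A U.2)
      (V.1, A V.2) = Coord.admMetric (localForm (𝓡 3) M.q.inner p.2) (localFun (𝓡 3) M.lapse p.2)
        (fun y => -(localFun (𝓡 3) M.omega p.2 y • localVector (𝓡 3) M.φ p.2 y)) z U V := by
    rw [Coord.admMetric_apply, Coord.admMetric_apply, hb.trans hs, ← map_smul, ← map_smul,
      ← map_add, ← map_add, hQ]
    rfl
  exact h5.trans ((congrArg (fun L : (ℝ × E3) →L[ℝ] (ℝ × E3) →L[ℝ] ℝ =>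
    L (U.1, A U.2) (V.1, A V.2)) h6).trans h7)

theorem localVector_axial (p : ℝ × X) {z : ℝ × E3} (hz : z.2 ∈ (extChartAt (𝓡 3) p.2).target) :
    localVector I4 M.axial p z = ((0 : ℝ), localVector (𝓡 3) M.φ p.2 z.2) := by
  have hz' : z ∈ (extChartAt I4 p).target := by
    rw [extChartAt_I4]; exact ⟨trivial, hz⟩
  have h1 := mfderiv_symm_I4 p hz ((0 : ℝ), localVector (𝓡 3) M.φ p.2 z.2)
  have h2 := mfderiv_extChartAt_comp_mfderiv_symm (I := I4) hz'
    ((0 : ℝ), localVector (𝓡 3) M.φ p.2 z.2)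
  have h3 : ((extChartAt I4 p).symm z).2 = (extChartAt (𝓡 3) p.2).symm z.2 := by
    rw [extChartAt_I4]; rfl
  have h4 := mfderiv_symm_comp_mfderiv_extChartAt (I := 𝓡 3) (p := p.2) hz
    (M.φ ((extChartAt (𝓡 3) p.2).symm z.2))
  have h5 : ∀ a b : X, a = b → (M.φ a : E3) = M.φ b := by rintro a b rfl; rfl
  have h6 : (M.axial ((extChartAt I4 p).symm z) : ℝ × E3) =
      mfderiv 𝓘(ℝ, ℝ × E3) I4 (extChartAt I4 p).symm z
        ((0 : ℝ), localVector (𝓡 3) M.φ p.2 z.2) := by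
    refine Eq.trans ?_ h1.symm
    refine Prod.ext rfl ?_
    exact (h5 _ _ h3).trans h4.symm
  exact (congrArg (mfderiv I4 𝓘(ℝ, ℝ × E3) (extChartAt I4 p) ((extChartAt I4 p).symm z)) h6).trans h2

theorem localForm_metric_eventuallyEq (p : ℝ × X) {z : ℝ × E3}
    (hz : z.2 ∈ (extChartAt (𝓡 3) p.2).target) :
    localForm I4 M.metric p =ᶠ[𝓝 z] Coord.admMetric (localForm (𝓡 3) M.q.inner p.2)
      (localFun (𝓡 3) M.lapse p.2)
      (fun y => -(localFun (𝓡 3) M.omega p.2 y • localVector (𝓡 3) M.φ p.2 y)) := by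
  filter_upwards [continuous_snd.continuousAt.eventually
    ((isOpen_extChartAt_target (I := 𝓡 3) p.2).mem_nhds hz)] with w hw
  exact M.localForm_metric p hw

theorem localVector_axial_eventuallyEq (p : ℝ × X) {z : ℝ × E3}
    (hz : z.2 ∈ (extChartAt (𝓡 3) p.2).target) :
    localVector I4 M.axial p =ᶠ[𝓝 z] fun z => ((0 : ℝ), localVector (𝓡 3) M.φ p.2 z.2) := by
  filter_upwards [continuous_snd.continuousAt.eventually
    ((isOpen_extChartAt_target (I := 𝓡 3) p.2).mem_nhds hz)] with w hw
  exact M.localVector_axial p hw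

theorem contDiffOn_localFun_lapse (p : X) :
    ContDiffOn ℝ ∞ (localFun (𝓡 3) M.lapse p) (extChartAt (𝓡 3) p).target := fun _ hy =>
  (contDiffAt_localFun hy (M.lapse_smooth _)).contDiffWithinAt

theorem contDiffOn_localFun_omega (p : X) :
    ContDiffOn ℝ ∞ (localFun (𝓡 3) M.omega p) (extChartAt (𝓡 3) p).target := fun _ hy =>
  (contDiffAt_localFun hy (M.omega_smooth _)).contDiffWithinAt

theorem contDiffOn_localVector_φ (p : X) :
    ContDiffOn ℝ ∞ (localVector (𝓡 3) M.φ p) (extChartAt (𝓡 3) p).target := fun _ hy =>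
  (contDiffAt_localVector M.φ_smooth hy).contDiffWithinAt

theorem isMetricOn_admMetric (p : X) :
    Coord.IsMetricOn (Coord.admMetric (localForm (𝓡 3) M.q.inner p) (localFun (𝓡 3) M.lapse p)
      (fun y => -(localFun (𝓡 3) M.omega p y • localVector (𝓡 3) M.φ p y)))
      (Set.univ ×ˢ (extChartAt (𝓡 3) p).target) :=
  (isMetricOn_localForm M.q p).1.admMetric (isMetricOn_localForm M.q p).2
    (M.contDiffOn_localFun_lapse p) (fun _ _ => M.lapse_pos _)
    ((M.contDiffOn_localFun_omega p).smul (M.contDiffOn_localVector_φ p)).neg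

end StationaryData

namespace AxisymmetricStationarySpacetime

variable {X : Type*} [TopologicalSpace X] [ChartedSpace E3 X] [IsManifold (𝓡 3) ∞ X]
  (M : AxisymmetricStationarySpacetime X)

/-- The curvature formula for Killing fields differentiates the Killing equation, so it is needed on
an open set of one chart; naturality supplies it from the pointwise definition. -/
theorem isStationaryOn (p : X) :
    Coord.IsStationaryOn (localForm (𝓡 3) M.q.inner p) (localFun (𝓡 3) M.lapse p)
      (localFun (𝓡 3) M.omega p) (localVector (𝓡 3) M.φ p) (extChartAt (𝓡 3) p).target := by
  have hm := isMetricOn_localForm M.q p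
  have hkill : Coord.IsKillingOn (Coord.admMetric (localForm (𝓡 3) M.q.inner p)
      (localFun (𝓡 3) M.lapse p)
      (fun y => -(localFun (𝓡 3) M.omega p y • localVector (𝓡 3) M.φ p y)))
      (fun z => ((0 : ℝ), localVector (𝓡 3) M.φ p z.2))
      (Set.univ ×ˢ (extChartAt (𝓡 3) p).target) := by
    intro z hz u v
    have hz' : ∀ (p : ℝ × X) (z : ℝ × E3), z ∈ (extChartAt I4 p).target ↔
        z.2 ∈ (extChartAt (𝓡 3) p.2).target := by
      intro p z
      rw [extChartAt_I4]
      exact and_iff_right trivial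
    have h1 : localForm I4 M.metric (0, p) =ᶠ[𝓝 z] _ := M.localForm_metric_eventuallyEq (0, p) hz.2
    have h2 : localVector I4 M.axial (0, p) =ᶠ[𝓝 z] _ := M.localVector_axial_eventuallyEq (0, p) hz.2
    rw [← Coord.lieMetric_congr h1 h2]
    refine M.φ_killing.lieMetric_eq_zero (fun p y hy => ?_) (fun p y hy => ?_)
      ((hz' (0, p) z).2 hz.2) u v
    · have hy := (hz' p y).1 hy
      exact ((M.isMetricOn_admMetric p.2).differentiableAt ⟨trivial, hy⟩).congr_of_eventuallyEq
        (M.localForm_metric_eventuallyEq p hy)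
    · have hy := (hz' p y).1 hy
      refine DifferentiableAt.congr_of_eventuallyEq ?_ (M.localVector_axial_eventuallyEq p hy)
      exact (differentiableAt_const _).prodMk (((contDiffAt_localVector M.φ_smooth hy).differentiableAt
        (by simp)).comp y differentiableAt_snd)
  exact ⟨hm.1, hm.2, M.contDiffOn_localFun_lapse p, fun y _ => M.lapse_pos _,
    M.contDiffOn_localFun_omega p, M.contDiffOn_localVector_φ p, hkill⟩

end AxisymmetricStationarySpacetime

/-! ### Restriction to smaller domains and invariance of the lapse -/

namespace Coord

variable {E : Type*} [NormedAddCommGroup E] [NormedSpace ℝ E]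

theorem IsMetricOn.mono {g : E → E →L[ℝ] E →L[ℝ] ℝ} {s t : Set E} (h : IsMetricOn g s)
    (ht : IsOpen t) (hts : t ⊆ s) : IsMetricOn g t :=
  ⟨ht, h.smooth.mono hts, fun x hx => h.symm x (hts hx), fun x hx => h.invertible x (hts hx)⟩

theorem IsStationaryOn.mono {q : E → E →L[ℝ] E →L[ℝ] ℝ} {α Ω : E → ℝ} {φ : E → E} {s t : Set E}
    (h : IsStationaryOn q α Ω φ s) (ht : IsOpen t) (hts : t ⊆ s) : IsStationaryOn q α Ω φ t :=
  ⟨h.metric.mono ht hts, fun x hx => h.pos x (hts hx), h.lapse_smooth.mono hts,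
    fun x hx => h.lapse_pos x (hts hx), h.omega_smooth.mono hts, h.axial_smooth.mono hts,
    fun x hx => h.killing x ⟨trivial, hts hx.2⟩⟩

/-- The lapse function of a foliation is natural under coordinate changes. -/
theorem foliationLapse_comp {q q' : E → E →L[ℝ] E →L[ℝ] ℝ} {f f' : E → ℝ} {x x' : E} {A : E → E}
    (hA : Function.Surjective A) (hq : ∀ u v, q x u v = q' x' (A u) (A v))
    (hf : ∀ u, fderiv ℝ f x u = fderiv ℝ f' x' (A u)) (hi : (q x).IsInvertible)
    (hi' : (q' x').IsInvertible) : foliationLapse q f x = foliationLapse q' f' x' := by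
  have h1 : A (grad q f x) = grad q' f' x' := by
    refine hi'.injective (ContinuousLinearMap.ext fun v => ?_)
    obtain ⟨u, rfl⟩ := hA v
    rw [← hq, grad, sharp, hi.self_apply_inverse, grad, sharp, hi'.self_apply_inverse, hf]
  rw [foliationLapse, foliationLapse, hq, h1]

end Coord

section Charts

variable {E : Type*} [NormedAddCommGroup E] [NormedSpace ℝ E] {H : Type*} [TopologicalSpace H]
  {I : ModelWithCorners ℝ E H} {N : Type*} [TopologicalSpace N] [ChartedSpace H N]

variable (I) in
/-- The lapse function of the foliation by the level sets of `f`. -/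
noncomputable def levelLapse (q : BilinField I N) (f : N → ℝ) (p : N) : ℝ :=
  Coord.foliationLapse (localForm I q p) (localFun I f p) (extChartAt I p p)

variable [IsManifold I ∞ N] [I.Boundaryless]

theorem mfderiv_symm_surjective {p : N} {y : E} (hy : y ∈ (extChartAt I p).target) (v : E) :
    ∃ u : E, (mfderiv 𝓘(ℝ, E) I (extChartAt I p).symm y u : E) = v :=
  ⟨_, mfderiv_symm_comp_mfderiv_extChartAt (I := I) hy v⟩

theorem fderiv_localFun_self {f : N → ℝ} {p : N} (hf : MDifferentiableAt I 𝓘(ℝ, ℝ) f p) (v : E) :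
    fderiv ℝ (localFun I f p) (extChartAt I p p) v = mfderiv I 𝓘(ℝ, ℝ) f p v := by
  have h0 := extChartAt_to_inv (I := I) p
  rw [fderiv_localFun (mem_extChartAt_target (I := I) p) (by rwa [h0]),
    mfderiv_symm_extChartAt_self]
  have h : ∀ p' : N, p' = p → (mfderiv I 𝓘(ℝ, ℝ) f p' : E →L[ℝ] ℝ) v = mfderiv I 𝓘(ℝ, ℝ) f p v := by
    rintro p' rfl; rfl
  exact h _ h0

theorem fderiv_localFun_eq_zero_iff {f : N → ℝ} {p : N} {y : E} (hy : y ∈ (extChartAt I p).target)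
    (hf : MDifferentiableAt I 𝓘(ℝ, ℝ) f ((extChartAt I p).symm y)) :
    fderiv ℝ (localFun I f p) y = 0 ↔ mfderiv I 𝓘(ℝ, ℝ) f ((extChartAt I p).symm y) = 0 := by
  constructor
  · intro h
    refine ContinuousLinearMap.ext fun v => ?_
    obtain ⟨u, hu⟩ := mfderiv_symm_surjective (I := I) hy v
    have h1 := fderiv_localFun hy hf u
    rw [h] at h1
    rw [← hu]
    exact h1.symm
  · intro h
    ext v
    rw [fderiv_localFun hy hf, h]
    rfl

variable [FiniteDimensional ℝ E]

/-- `levelLapse` is evaluated at each point in that point's own chart, which hides its smoothness.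
Invariance of `|df|` identifies it with a smooth expression in one fixed chart. -/
theorem localFun_levelLapse
    (q : Bundle.ContMDiffRiemannianMetric I ∞ E (fun x : N => TangentSpace I x)) {f : N → ℝ} {p : N}
    {y : E} (hy : y ∈ (extChartAt I p).target)
    (hf : MDifferentiableAt I 𝓘(ℝ, ℝ) f ((extChartAt I p).symm y)) :
    localFun I (levelLapse I q.inner f) p y =
      Coord.foliationLapse (localForm I q.inner p) (localFun I f p) y := by
  refine (Coord.foliationLapse_comp (E := E)
    (A := fun u => mfderiv 𝓘(ℝ, E) I (extChartAt I p).symm y u)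
    (mfderiv_symm_surjective (I := I) hy) (fun u v => ?_) (fun u => ?_)
    ((isMetricOn_localForm q p).1.invertible y hy)
    ((isMetricOn_localForm q _).1.invertible _ (mem_extChartAt_target (I := I) _))).symm
  · exact (localForm_self q.inner _ _ _).symm
  · exact (fderiv_localFun hy hf u).trans (fderiv_localFun_self hf _).symm

end Charts

/-! ### The radial function adapted to the spacetime lapse -/

namespace DividingSurface

variable {X : Type*} [TopologicalSpace X] [ChartedSpace E3 X]
  (S₀ : DividingSurface X)

theorem mdifferentiableAt (x : X) : MDifferentiableAt (𝓡 3) 𝓘(ℝ, ℝ) S₀.f x :=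
  (S₀.smooth x).mdifferentiableAt (by simp)

variable [IsManifold (𝓡 3) ∞ X] (M : StationaryData X)

/-- A defining function `r` of the surface for which the lapse function `1 / |dr|` of the foliation
by its level sets agrees on the surface with the lapse function of the spacetime. -/
noncomputable def radius (x : X) : ℝ :=
  S₀.f x * (levelLapse (𝓡 3) M.q.inner S₀.f x * (M.lapse x)⁻¹)

/-- The part of the chart at `p` where `f` has no critical points. -/
def regularDomain (p : X) : Set E3 :=
  {y ∈ (extChartAt (𝓡 3) p).target | fderiv ℝ (localFun (𝓡 3) S₀.f p) y ≠ 0}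

theorem contDiffOn_localFun (p : X) :
    ContDiffOn ℝ ∞ (localFun (𝓡 3) S₀.f p) (extChartAt (𝓡 3) p).target := fun _ hy =>
  (contDiffAt_localFun hy (S₀.smooth _)).contDiffWithinAt

theorem isOpen_regularDomain (p : X) : IsOpen (S₀.regularDomain p) := by
  have h := isOpen_extChartAt_target (I := 𝓡 3) p
  exact ((S₀.contDiffOn_localFun p).continuousOn_fderiv_of_isOpen h (by simp)).isOpen_inter_preimage
    h isOpen_ne

theorem isFoliation_f (p : X) : Coord.IsFoliation (localForm (𝓡 3) M.q.inner p)
    (localFun (𝓡 3) S₀.f p) (S₀.regularDomain p) :=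
  ⟨(isMetricOn_localForm M.q p).1.mono (S₀.isOpen_regularDomain p) fun _ hy => hy.1,
    fun y hy => (isMetricOn_localForm M.q p).2 y hy.1,
    (S₀.contDiffOn_localFun p).mono fun _ hy => hy.1, fun _ hy => hy.2⟩

theorem localFun_radius {p : X} {y : E3} (hy : y ∈ (extChartAt (𝓡 3) p).target) :
    localFun (𝓡 3) (S₀.radius M) p y = localFun (𝓡 3) S₀.f p y *
      (Coord.foliationLapse (localForm (𝓡 3) M.q.inner p) (localFun (𝓡 3) S₀.f p) y *
        (localFun (𝓡 3) M.lapse p y)⁻¹) := by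
  rw [← localFun_levelLapse M.q hy (S₀.mdifferentiableAt _)]
  rfl

theorem radiusFactor_pos {p : X} {y : E3} (hy : y ∈ S₀.regularDomain p) :
    0 < Coord.foliationLapse (localForm (𝓡 3) M.q.inner p) (localFun (𝓡 3) S₀.f p) y *
        (localFun (𝓡 3) M.lapse p y)⁻¹ :=
  mul_pos ((S₀.isFoliation_f M p).lapse_pos hy) (inv_pos.2 (M.lapse_pos _))

theorem contDiffAt_radiusFactor {p : X} {y : E3} (hy : y ∈ S₀.regularDomain p) :
    ContDiffAt ℝ ∞ (fun y => Coord.foliationLapse (localForm (𝓡 3) M.q.inner p)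
      (localFun (𝓡 3) S₀.f p) y * (localFun (𝓡 3) M.lapse p y)⁻¹) y :=
  ((S₀.isFoliation_f M p).contDiffAt_lapse hy).mul
    ((contDiffAt_localFun hy.1 (M.lapse_smooth _)).inv (M.lapse_pos _).ne')

theorem contDiffAt_localFun_radius {p : X} {y : E3} (hy : y ∈ S₀.regularDomain p) :
    ContDiffAt ℝ ∞ (localFun (𝓡 3) (S₀.radius M) p) y := by
  refine (((S₀.isFoliation_f M p).contDiffAt hy).mul
    (S₀.contDiffAt_radiusFactor M hy)).congr_of_eventuallyEq ?_
  filter_upwards [(S₀.isFoliation_f M p).eventually_mem hy] with z hz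
  exact S₀.localFun_radius M hz.1

/-- On the surface `f = 0`, so the derivative of the positive factor does not contribute. -/
theorem fderiv_localFun_radius {p : X} {y : E3} (hy : y ∈ S₀.regularDomain p)
    (h0 : localFun (𝓡 3) S₀.f p y = 0) : fderiv ℝ (localFun (𝓡 3) (S₀.radius M) p) y =
      (Coord.foliationLapse (localForm (𝓡 3) M.q.inner p) (localFun (𝓡 3) S₀.f p) y *
        (localFun (𝓡 3) M.lapse p y)⁻¹) • fderiv ℝ (localFun (𝓡 3) S₀.f p) y := by
  have h1 : localFun (𝓡 3) (S₀.radius M) p =ᶠ[𝓝 y] fun z => localFun (𝓡 3) S₀.f p z *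
      (Coord.foliationLapse (localForm (𝓡 3) M.q.inner p) (localFun (𝓡 3) S₀.f p) z *
        (localFun (𝓡 3) M.lapse p z)⁻¹) := by
    filter_upwards [(S₀.isFoliation_f M p).eventually_mem hy] with z hz
    exact S₀.localFun_radius M hz.1
  rw [h1.fderiv_eq, fderiv_fun_mul (((S₀.isFoliation_f M p).contDiffAt hy).differentiableAt (by simp))
    ((S₀.contDiffAt_radiusFactor M hy).differentiableAt (by simp)), h0, zero_smul, zero_add]

/-- On the surface `dr` is `df` times the lapse of `f` divided by `α`. Hence `|dr| = 1 / α`, with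
the same outward direction. -/
theorem unitNormal_radius {p : X} {y : E3} (hy : y ∈ S₀.regularDomain p)
    (h0 : localFun (𝓡 3) S₀.f p y = 0) :
    Coord.foliationLapse (localForm (𝓡 3) M.q.inner p) (localFun (𝓡 3) (S₀.radius M) p) y =
        localFun (𝓡 3) M.lapse p y ∧
      Coord.unitNormal (localForm (𝓡 3) M.q.inner p) (localFun (𝓡 3) (S₀.radius M) p) y =
        Coord.unitNormal (localForm (𝓡 3) M.q.inner p) (localFun (𝓡 3) S₀.f p) y := by
  have h := Coord.IsFoliation.unitNormal_congr (q := localForm (𝓡 3) M.q.inner p)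
    (S₀.radiusFactor_pos M hy) (S₀.fderiv_localFun_radius M hy h0)
  refine ⟨?_, h.2⟩
  have h1 := ((S₀.isFoliation_f M p).lapse_pos hy).ne'
  have h2 : localFun (𝓡 3) M.lapse p y ≠ 0 := (M.lapse_pos _).ne'
  have h3 := h.1
  rw [mul_assoc, eq_comm, mul_eq_left₀ h1] at h3
  rwa [inv_mul_eq_one₀ h2, eq_comm] at h3

/-- The part of the chart at `p` where neither `f` nor `r` has critical points. -/
def foliatedDomain (p : X) : Set E3 :=
  {y ∈ S₀.regularDomain p | fderiv ℝ (localFun (𝓡 3) (S₀.radius M) p) y ≠ 0}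

theorem isOpen_foliatedDomain (p : X) : IsOpen (S₀.foliatedDomain M p) := by
  have h := S₀.isOpen_regularDomain p
  have h1 : ContDiffOn ℝ ∞ (localFun (𝓡 3) (S₀.radius M) p) (S₀.regularDomain p) := fun _ hy =>
    (S₀.contDiffAt_localFun_radius M hy).contDiffWithinAt
  exact (h1.continuousOn_fderiv_of_isOpen h (by simp)).isOpen_inter_preimage h isOpen_ne

theorem isFoliation_radius (p : X) : Coord.IsFoliation (localForm (𝓡 3) M.q.inner p)
    (localFun (𝓡 3) (S₀.radius M) p) (S₀.foliatedDomain M p) :=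
  ⟨(S₀.isFoliation_f M p).metric.mono (S₀.isOpen_foliatedDomain M p) fun _ hy => hy.1,
    fun y hy => (S₀.isFoliation_f M p).pos y hy.1,
    fun _ hy => (S₀.contDiffAt_localFun_radius M hy.1).contDiffWithinAt, fun _ hy => hy.2⟩

theorem mem_regularDomain_self {x : X} (hx : mfderiv (𝓡 3) 𝓘(ℝ, ℝ) S₀.f x ≠ 0) :
    extChartAt (𝓡 3) x x ∈ S₀.regularDomain x := by
  have h0 := mem_extChartAt_target (I := 𝓡 3) x
  refine ⟨h0, fun h => hx ?_⟩
  rw [fderiv_localFun_eq_zero_iff h0 (S₀.mdifferentiableAt _)] at h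
  rwa [extChartAt_to_inv] at h

theorem mem_foliatedDomain {p : X} (hp : p ∈ S₀.carrier) :
    extChartAt (𝓡 3) p p ∈ S₀.foliatedDomain M p := by
  have h1 := S₀.mem_regularDomain_self (S₀.regular p hp)
  refine ⟨h1, ?_⟩
  rw [S₀.fderiv_localFun_radius M h1 ((localFun_self _ _).trans hp)]
  exact smul_ne_zero (S₀.radiusFactor_pos M h1).ne' h1.2

theorem localFun_radius_eq_zero_iff {p : X} {y : E3} (hy : y ∈ S₀.regularDomain p) :
    localFun (𝓡 3) (S₀.radius M) p y = 0 ↔ localFun (𝓡 3) S₀.f p y = 0 := by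
  rw [S₀.localFun_radius M hy.1, mul_eq_zero, or_iff_left (S₀.radiusFactor_pos M hy).ne']

/-- The open set of regular points of `f` and `r`. -/
def foliatedRegion : Set X :=
  interior {x | mfderiv (𝓡 3) 𝓘(ℝ, ℝ) S₀.f x ≠ 0 ∧ mfderiv (𝓡 3) 𝓘(ℝ, ℝ) (S₀.radius M) x ≠ 0}

theorem contMDiffAt_radius {x : X} (hx : mfderiv (𝓡 3) 𝓘(ℝ, ℝ) S₀.f x ≠ 0) :
    ContMDiffAt (𝓡 3) 𝓘(ℝ, ℝ) ∞ (S₀.radius M) x :=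
  contMDiffAt_of_localFun (mem_extChartAt_source (I := 𝓡 3) x)
    (S₀.contDiffAt_localFun_radius M (S₀.mem_regularDomain_self hx))

theorem radius_sign {x : X} (hx : mfderiv (𝓡 3) 𝓘(ℝ, ℝ) S₀.f x ≠ 0) :
    (S₀.radius M x = 0 ↔ x ∈ S₀.carrier) ∧ (0 < S₀.radius M x ↔ x ∈ S₀.outside) := by
  have h := S₀.mem_regularDomain_self hx
  have h1 := S₀.localFun_radius M h.1
  have h2 := S₀.radiusFactor_pos M h
  rw [localFun_self, localFun_self] at h1
  rw [h1]
  exact ⟨by rw [mul_eq_zero, or_iff_left h2.ne']; rfl, mul_pos_iff_of_pos_right h2⟩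

theorem carrier_subset_foliatedRegion : S₀.carrier ⊆ S₀.foliatedRegion M := by
  intro p hp
  rw [foliatedRegion, mem_interior_iff_mem_nhds]
  have h1 := (continuousAt_extChartAt (I := 𝓡 3) p).eventually
    ((S₀.isOpen_foliatedDomain M p).mem_nhds (S₀.mem_foliatedDomain M hp))
  filter_upwards [h1, (isOpen_extChartAt_source (I := 𝓡 3) p).mem_nhds
    (mem_extChartAt_source (I := 𝓡 3) p)] with x hx hxs
  have h2 := (extChartAt (𝓡 3) p).left_inv hxs
  have h3 : mfderiv (𝓡 3) 𝓘(ℝ, ℝ) S₀.f x ≠ 0 := by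
    intro h
    refine hx.1.2 ?_
    rw [fderiv_localFun_eq_zero_iff hx.1.1 (S₀.mdifferentiableAt _), h2, h]
  refine ⟨h3, fun h => hx.2 ?_⟩
  rw [fderiv_localFun_eq_zero_iff hx.1.1, h2, h]
  rw [h2]
  exact (S₀.contMDiffAt_radius M h3).mdifferentiableAt (by simp)

end DividingSurface

/-! ### Curves given in a chart -/

section Geodesics

variable {E : Type*} [NormedAddCommGroup E] [NormedSpace ℝ E] {H : Type*} [TopologicalSpace H]
  {I : ModelWithCorners ℝ E H} {N : Type*} [TopologicalSpace N] [ChartedSpace H N]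

theorem eqOn_extChartAt_of_eq_symm {γ : ℝ → N} {c : ℝ → E} {p : N} {J : Set ℝ}
    (hγ : ∀ τ, γ τ = (extChartAt I p).symm (c τ)) (hmem : ∀ τ ∈ J, c τ ∈ (extChartAt I p).target) :
    Set.EqOn (fun τ => extChartAt I p (γ τ)) c J := fun τ hτ => by
  show extChartAt I p (γ τ) = c τ
  rw [hγ, (extChartAt I p).right_inv (hmem τ hτ)]

theorem velocity_eq_of_chart {γ : ℝ → N} {c : ℝ → E} {p : N} {δ : ℝ} (hδ : 0 < δ)
    (hγ : ∀ τ, γ τ = (extChartAt I p).symm (c τ)) (h0 : γ 0 = p)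
    (hmem : ∀ τ ∈ Set.Ioo (-δ) δ, c τ ∈ (extChartAt I p).target) :
    (velocity I γ : E) = deriv c 0 := by
  show deriv (fun s => extChartAt I (γ 0) (γ s)) 0 = deriv c 0
  rw [h0]
  exact ((eqOn_extChartAt_of_eq_symm hγ hmem).eventuallyEq_of_mem
    (Ioo_mem_nhds (neg_lt_zero.2 hδ) hδ)).deriv_eq

/-- The coordinate expression of `γ` coincides with `c` only where `c` lies in the chart target;
that holds on an open interval, so both derivatives agree there too. -/
theorem isLocalGeodesic_of_chart {g : BilinField I N} {γ : ℝ → N} {c : ℝ → E} {p : N} {δ : ℝ}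
    (hδ : 0 < δ) (hγ : ∀ τ, γ τ = (extChartAt I p).symm (c τ)) (h0 : γ 0 = p)
    (hmem : ∀ τ ∈ Set.Ioo (-δ) δ, c τ ∈ (extChartAt I p).target)
    (hc : ContDiffOn ℝ 2 c (Set.Ioo (-δ) δ))
    (hgeo : ∀ τ ∈ Set.Ioo (-δ) δ, deriv (deriv c) τ
      + Coord.christoffel (localForm I g p) (c τ) (deriv c τ) (deriv c τ) = 0) :
    IsLocalGeodesic I g γ δ := by
  have heq := eqOn_extChartAt_of_eq_symm (I := I) hγ hmem
  have hd : Set.EqOn (deriv fun τ => extChartAt I p (γ τ)) (deriv c) (Set.Ioo (-δ) δ) :=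
    heq.deriv isOpen_Ioo
  have hd2 := hd.deriv isOpen_Ioo
  unfold IsLocalGeodesic
  rw [h0]
  refine ⟨hδ, hc.congr heq, fun τ hτ => ⟨?_, ?_⟩⟩
  · rw [hγ]
    exact (extChartAt I p).map_target (hmem τ hτ)
  · have h1 := heq hτ
    rw [hd2 hτ, hd hτ]
    dsimp only at h1 ⊢
    rw [h1]
    exact hgeo τ hτ

end Geodesics

namespace Coord

variable {E : Type*} [NormedAddCommGroup E] [NormedSpace ℝ E]

theorem fderiv_fderiv_comp_snd {f : E → ℝ} {p : ℝ × E} (hf : ContDiffAt ℝ ∞ f p.2) (U : ℝ × E) :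
    fderiv ℝ (fderiv ℝ (fun p : ℝ × E => f p.2)) p U U =
      fderiv ℝ (fderiv ℝ f) p.2 U.2 U.2 := by
  have hF : ContDiffAt ℝ ∞ (fun p : ℝ × E => f p.2) p := hf.comp p contDiffAt_snd
  have h1 : (fun z => fderiv ℝ (fun p : ℝ × E => f p.2) z U) =ᶠ[𝓝 p]
      fun z => fderiv ℝ f z.2 U.2 := by
    have h := (hf.of_le (m := 1) (by simp)).eventually (by simp)
    filter_upwards [continuous_snd.continuousAt.eventually h] with z hz
    exact fderiv_comp_snd (hz.differentiableAt (by simp)) U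
  have hd := (contDiffAt_fderiv hf).differentiableAt (n := ∞) (by simp)
  have h2 := congrArg (fun L => L U) (h1.fderiv_eq (𝕜 := ℝ))
  rwa [fderiv_fderiv_apply hF, fderiv_comp_snd (f := fun y => fderiv ℝ f y U.2) (by fun_prop),
    fderiv_fderiv_apply hf] at h2

end Coord

/-! ### Einstein's equations in the chart at a point -/

namespace StationaryData

variable {X : Type*} [TopologicalSpace X] [ChartedSpace E3 X]

theorem extChartAt_I4_self (t : ℝ) (p : X) :
    extChartAt I4 (t, p) (t, p) = (t, extChartAt (𝓡 3) p p) := by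
  rw [extChartAt_I4]; rfl

variable [IsManifold (𝓡 3) ∞ X] (M : StationaryData X)

/-- The components of the spacetime metric in the chart at `p`. -/
noncomputable abbrev chartMetric (p : X) : ℝ × E3 → (ℝ × E3) →L[ℝ] (ℝ × E3) →L[ℝ] ℝ :=
  Coord.admMetric (localForm (𝓡 3) M.q.inner p) (localFun (𝓡 3) M.lapse p)
    (fun y => -(localFun (𝓡 3) M.omega p y • localVector (𝓡 3) M.φ p y))

theorem metric_apply_chart (t : ℝ) (p : X) (U V : ℝ × E3) :
    (M.metric (t, p) : (ℝ × E3) →L[ℝ] (ℝ × E3) →L[ℝ] ℝ) U V =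
      M.chartMetric p (t, extChartAt (𝓡 3) p p) U V := by
  have h := M.localForm_metric (t, p) (z := (t, extChartAt (𝓡 3) p p))
    (mem_extChartAt_target (I := 𝓡 3) p)
  rw [chartMetric, ← h, ← extChartAt_I4_self]
  exact (localForm_self (I := I4) M.metric (t, p) U V).symm

theorem ricciAt_chart (t : ℝ) (p : X) (U V : ℝ × E3) :
    ricciAt I4 M.metric (t, p) U V =
      Coord.ricci (M.chartMetric p) (t, extChartAt (𝓡 3) p p) U V := by
  have h := M.localForm_metric_eventuallyEq (t, p) (z := (t, extChartAt (𝓡 3) p p))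
    (mem_extChartAt_target (I := 𝓡 3) p)
  rw [chartMetric, ← Coord.ricci_congr h, ← extChartAt_I4_self]
  rfl

theorem normal_chart (t : ℝ) (p : X) : (M.normal (t, p) : ℝ × E3) =
    (localFun (𝓡 3) M.lapse p (extChartAt (𝓡 3) p p))⁻¹ • ((1 : ℝ),
      localFun (𝓡 3) M.omega p (extChartAt (𝓡 3) p p) •
        localVector (𝓡 3) M.φ p (extChartAt (𝓡 3) p p)) := by
  rw [localFun_self, localFun_self, localVector_self]
  refine Prod.ext ?_ ?_
  · simp [normal]
  · show -((M.lapse p)⁻¹ • -(M.omega p • M.φ p)) = (M.lapse p)⁻¹ • (M.omega p • M.φ p)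
    rw [smul_neg, neg_neg]

/-- Since `u` and `v` have opposite squared norms, the scalar curvature terms of Einstein's
equations cancel in the sum. -/
theorem ricci_add_ricci_eq_zero {G : ℝ} {T : BilinField I4 (ℝ × X)}
    (hT : EinsteinEquations I4 G M.metric T) {t : ℝ} {p : X} {u v : ℝ × E3}
    (hu : M.chartMetric p (t, extChartAt (𝓡 3) p p) u u = -1)
    (hv : M.chartMetric p (t, extChartAt (𝓡 3) p p) v v = 1)
    (huv : T (t, p) u u + T (t, p) v v = 0) :
    Coord.ricci (M.chartMetric p) (t, extChartAt (𝓡 3) p p) u u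
      + Coord.ricci (M.chartMetric p) (t, extChartAt (𝓡 3) p p) v v = 0 := by
  have h1 := hT (t, p) u u
  have h2 := hT (t, p) v v
  rw [← M.ricciAt_chart, ← M.ricciAt_chart]
  have h3 := (M.metric_apply_chart t p u u).trans hu
  have h4 := (M.metric_apply_chart t p v v).trans hv
  have h5 : M.metric (t, p) u u = -1 := h3
  have h6 : M.metric (t, p) v v = 1 := h4
  rw [h5] at h1
  rw [h6] at h2
  linear_combination h1 + h2 + 8 * Real.pi * G * huv

end StationaryData

/-! ### The trapping condition for the adapted radial function -/

namespace DividingSurface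

variable {X : Type*} [TopologicalSpace X] [ChartedSpace E3 X] [IsManifold (𝓡 3) ∞ X]
  (S₀ : DividingSurface X) (M : AxisymmetricStationarySpacetime X)

theorem fderiv_localFun_localVector_eq_zero {V : ∀ x : X, TangentSpace (𝓡 3) x}
    (hV : ∀ x ∈ S₀.carrier, S₀.IsTangent x (V x)) {p : X} {y : E3}
    (hy : y ∈ (extChartAt (𝓡 3) p).target) (h0 : localFun (𝓡 3) S₀.f p y = 0) :
    fderiv ℝ (localFun (𝓡 3) S₀.f p) y (localVector (𝓡 3) V p y) = 0 := by
  rw [fderiv_localFun hy (S₀.mdifferentiableAt _)]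
  have h1 := mfderiv_symm_comp_mfderiv_extChartAt (I := 𝓡 3) hy (V ((extChartAt (𝓡 3) p).symm y))
  exact (congrArg (mfderiv (𝓡 3) 𝓘(ℝ, ℝ) S₀.f ((extChartAt (𝓡 3) p).symm y)) h1).trans (hV _ h0)

theorem fderiv_radius_eq_zero_iff {p : X} {y : E3} (hy : y ∈ S₀.regularDomain p)
    (h0 : localFun (𝓡 3) S₀.f p y = 0) (u : E3) :
    fderiv ℝ (localFun (𝓡 3) (S₀.radius M.toStationaryData) p) y u = 0 ↔
      fderiv ℝ (localFun (𝓡 3) S₀.f p) y u = 0 := by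
  rw [S₀.fderiv_localFun_radius M.toStationaryData hy h0, smul_apply, smul_eq_mul, mul_eq_zero,
    or_iff_right (S₀.radiusFactor_pos M.toStationaryData hy).ne']

theorem isTangent_iff {x : X} (u : E3) : S₀.IsTangent x u ↔
    fderiv ℝ (localFun (𝓡 3) S₀.f x) (extChartAt (𝓡 3) x x) u = 0 := by
  rw [fderiv_localFun_self (S₀.mdifferentiableAt x)]
  rfl

/-- The light rays emitted tangentially to a transversely trapping surface bend inwards. -/
theorem IsTransverselyTrapping.hess_radius_nonpos {S₀ : DividingSurface X}
    {M : AxisymmetricStationarySpacetime X} (hS : S₀.IsTransverselyTrapping M.metric) {t : ℝ}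
    {p : X} (hp : p ∈ S₀.carrier) {l : ℝ × E3} (hl : 0 < l.1)
    (hnull : M.chartMetric p (t, extChartAt (𝓡 3) p p) l l = 0)
    (htan : fderiv ℝ (localFun (𝓡 3) (S₀.radius M.toStationaryData) p) (extChartAt (𝓡 3) p p) l.2
      = 0) :
    fderiv ℝ (fderiv ℝ (localFun (𝓡 3) (S₀.radius M.toStationaryData) p)) (extChartAt (𝓡 3) p p)
        l.2 l.2
      - fderiv ℝ (localFun (𝓡 3) (S₀.radius M.toStationaryData) p) (extChartAt (𝓡 3) p p)
        (Coord.christoffel (M.chartMetric p) (t, extChartAt (𝓡 3) p p) l l).2 ≤ 0 := by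
  set r := localFun (𝓡 3) (S₀.radius M.toStationaryData) p with hr
  set x₀ := extChartAt (𝓡 3) p p with hx₀
  set s := S₀.foliatedDomain M.toStationaryData p with hs
  have hx : x₀ ∈ s := S₀.mem_foliatedDomain M.toStationaryData hp
  have hf0 : localFun (𝓡 3) S₀.f p x₀ = 0 := (localFun_self _ _).trans hp
  have hst := (M.isStationaryOn p).mono (S₀.isOpen_foliatedDomain M.toStationaryData p)
    fun y hy => hy.1.1
  -- The trapping hypothesis speaks of given geodesics, so a light ray with initial velocity `l` is
  -- first constructed in the chart and then mapped to the spacetime.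
  obtain ⟨c, δ, hδ, hc0, hc1, hc2, hmem, hgeo⟩ := hst.isMetricOn.exists_geodesic
    (x := (t, x₀)) ⟨trivial, hx⟩ l
  have hmem' : ∀ τ ∈ Set.Ioo (-δ) δ, c τ ∈ (extChartAt I4 (t, p)).target := by
    intro τ hτ
    rw [extChartAt_I4]
    exact ⟨trivial, (hmem τ hτ).2.1.1⟩
  obtain ⟨γ, hγ⟩ : ∃ γ : ℝ → ℝ × X, ∀ τ, γ τ = (extChartAt I4 (t, p)).symm (c τ) := ⟨_, fun _ => rfl⟩
  have hγ0 : γ 0 = (t, p) := by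
    rw [hγ, hc0, hx₀, ← StationaryData.extChartAt_I4_self, extChartAt_to_inv]
  have hvel : (velocity I4 γ : ℝ × E3) = l := (velocity_eq_of_chart hδ hγ hγ0 hmem').trans hc1
  have hgeod : IsLocalGeodesic I4 M.metric γ δ := by
    refine isLocalGeodesic_of_chart hδ hγ hγ0 hmem' hc2 fun τ hτ => ?_
    rw [(hgeo τ hτ).2.deriv, Coord.christoffel_congr
      (M.localForm_metric_eventuallyEq (t, p) (z := c τ) (hmem τ hτ).2.1.1)]
    exact neg_add_cancel _
  have hgen : ∀ a b : ℝ × X, a = b → ∀ v w : ℝ × E3, v = w →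
      (M.metric a : (ℝ × E3) →L[ℝ] (ℝ × E3) →L[ℝ] ℝ) v v = M.metric b w w := by
    rintro a b rfl v w rfl; rfl
  have htan' : ∀ a b : ℝ × X, a = b → ∀ v w : ℝ × E3, v = w → S₀.IsTangent b.2 w.2 →
      S₀.IsTangent a.2 v.2 := by
    rintro a b rfl v w rfl h; exact h
  obtain ⟨ε, hε, htrap⟩ := hS γ δ hgeod (by rw [hγ0]; exact hp)
    ((hgen _ _ hγ0 _ _ hvel).trans ((M.metric_apply_chart t p l l).trans hnull))
    (by rw [hvel]; exact hl)
    (htan' _ _ hγ0 _ _ hvel ((S₀.isTangent_iff l.2).2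
      ((S₀.fderiv_radius_eq_zero_iff M hx.1 hf0 l.2).1 htan)))
  have hrs : ContDiffOn ℝ ∞ (fun z : ℝ × E3 => r z.2) (Set.univ ×ˢ s) :=
    (S₀.isFoliation_radius M.toStationaryData p).smooth.comp contDiff_snd.contDiffOn
      fun z hz => hz.2
  have hrx : ContDiffAt ℝ ∞ r x₀ := (S₀.isFoliation_radius M.toStationaryData p).contDiffAt hx
  have h := Coord.hess_nonpos_of_geodesic hst.isMetricOn.isOpen hrs hδ hmem
    (fun τ hτ => (hgeo τ hτ).1) (hgeo 0 ⟨by linarith, hδ⟩).2 ?_ ?_ ?_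
  · rw [hc0, hc1, Coord.fderiv_fderiv_comp_snd (by exact hrx),
      Coord.fderiv_comp_snd (f := r) (hrx.differentiableAt (by simp))] at h
    rw [sub_eq_add_neg, ← map_neg]
    exact h
  · rw [hc0]
    exact (S₀.localFun_radius_eq_zero_iff M.toStationaryData hx.1).2 hf0
  · rw [hc0, hc1, Coord.fderiv_comp_snd (f := r) (hrx.differentiableAt (by simp))]
    exact htan
  -- Up to `δ` the ray stays in the foliated domain, where `r` and `f` have the same sign; up to `ε`
  -- the trapping condition holds.
  · refine ⟨min ε δ, lt_min hε hδ, fun τ hτ => ?_⟩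
    have hτδ : τ ∈ Set.Ioo (-δ) δ := ⟨by linarith [hτ.1], hτ.2.trans_le (min_le_right _ _)⟩
    have hy := (hmem τ hτδ).2.1
    have h1 : S₀.f (γ τ).2 ≤ 0 := by
      rcases htrap τ ⟨hτ.1, hτ.2.trans_le (min_le_left _ _)⟩ with h | h
      · exact le_of_eq h
      · exact le_of_lt h
    have h2 : S₀.f (γ τ).2 = localFun (𝓡 3) S₀.f p (c τ).2 := by
      rw [hγ, extChartAt_I4]; rfl
    rw [h2] at h1
    show r (c τ).2 ≤ 0
    rw [hr, S₀.localFun_radius M.toStationaryData hy.1]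
    exact mul_nonpos_of_nonpos_of_nonneg h1 (S₀.radiusFactor_pos M.toStationaryData hy).le

end DividingSurface

/-! ### Extrinsic curvature in terms of the adapted function, and the conclusion -/

namespace DividingSurface

variable {X : Type*} [TopologicalSpace X] [ChartedSpace E3 X] [IsManifold (𝓡 3) ∞ X]
  (S₀ : DividingSurface X) (M : StationaryData X)

theorem extrinsic_radius {p : X} (hp : p ∈ S₀.carrier) {u : E3}
    (hu : fderiv ℝ (localFun (𝓡 3) S₀.f p) (extChartAt (𝓡 3) p p) u = 0) :
    Coord.extrinsic (localForm (𝓡 3) M.q.inner p) (localFun (𝓡 3) (S₀.radius M) p)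
      (extChartAt (𝓡 3) p p) u u = S₀.extrinsic M.q.inner p u u := by
  have hx := S₀.mem_foliatedDomain M hp
  have hf0 : localFun (𝓡 3) S₀.f p (extChartAt (𝓡 3) p p) = 0 := (localFun_self _ _).trans hp
  have hf : Coord.IsFoliation (localForm (𝓡 3) M.q.inner p) (localFun (𝓡 3) S₀.f p)
      (S₀.foliatedDomain M p) :=
    ⟨(S₀.isFoliation_radius M p).metric, (S₀.isFoliation_radius M p).pos,
      (S₀.isFoliation_f M p).smooth.mono fun _ hy => hy.1, fun _ hy => hy.1.2⟩
  exact hf.extrinsic_congr (S₀.isFoliation_radius M p) hx (S₀.radiusFactor_pos M hx.1)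
    (S₀.fderiv_localFun_radius M hx.1 hf0) hf0
    (fun y hy h0 => (S₀.localFun_radius_eq_zero_iff M hy.1).2 h0) hu

end DividingSurface

theorem proposition4 {X : Type*} [TopologicalSpace X] [T2Space X] [SecondCountableTopology X]
    [ChartedSpace E3 X] [IsManifold (𝓡 3) ∞ X]
    (M : AxisymmetricStationarySpacetime X)
    (G : ℝ) (hG : 0 < G) (T : BilinField I4 (ℝ × X))
    (hT : EinsteinEquations I4 G M.metric T)
    (hR : ∀ x : X, 0 ≤ scalarAt (𝓡 3) M.q.inner x)
    (S₀ : DividingSurface X)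
    (haxi : ∀ x ∈ S₀.carrier, S₀.IsTangent x (M.φ x))
    (hω : ∃ c : ℝ, ∀ x ∈ S₀.carrier, M.omega x = c)
    (hTTS : S₀.IsTransverselyTrapping M.metric)
    (hconvex : S₀.IsConvex M.q.inner)
    (hcurved : ∀ x ∈ S₀.carrier, ∃ u, S₀.IsTangent x u ∧ S₀.extrinsic M.q.inner x u u ≠ 0)
    (hP : ∀ (t : ℝ), ∀ x ∈ S₀.carrier,
      M.energyDensity T (t, x) + S₀.radialPressure M.q.inner T (t, x) = 0) :
    S₀.IsLooselyTrapped M.q.inner := by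
  -- The witness is the radial function whose lapse is `α` on `S₀`, on the interior of the set where
  -- it and `f` are both regular.
  refine ⟨hR, S₀.foliatedRegion M.toStationaryData, S₀.radius M.toStationaryData, isOpen_interior,
    S₀.carrier_subset_foliatedRegion M.toStationaryData, fun x hx =>
      (S₀.contMDiffAt_radius M.toStationaryData (interior_subset hx).1).contMDiffWithinAt,
    fun x hx => (interior_subset hx).2,
    fun x hx => S₀.radius_sign M.toStationaryData (interior_subset hx).1, fun p hp => ?_⟩
  obtain ⟨c, hc⟩ := hω
  have hx := S₀.mem_foliatedDomain M.toStationaryData hp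
  have hfol := S₀.isFoliation_radius M.toStationaryData p
  have hst := (M.isStationaryOn p).mono (S₀.isOpen_foliatedDomain M.toStationaryData p)
    fun y hy => hy.1.1
  have hr0 : ∀ y ∈ S₀.foliatedDomain M.toStationaryData p,
      localFun (𝓡 3) (S₀.radius M.toStationaryData) p y = 0 → localFun (𝓡 3) S₀.f p y = 0 :=
    fun y hy => (S₀.localFun_radius_eq_zero_iff M.toStationaryData hy.1).1
  have hf0 : localFun (𝓡 3) S₀.f p (extChartAt (𝓡 3) p p) = 0 := (localFun_self _ _).trans hp
  have hu := S₀.unitNormal_radius M.toStationaryData hx.1 hf0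
  -- The conclusion concerns the slice only, so the spacetime hypotheses are used at the single time
  -- `0`.
  refine hst.looselyTrapped (t := 0) (c := c) hfol (by simp) hx
    ((S₀.localFun_radius_eq_zero_iff M.toStationaryData hx.1).2 hf0) ?_ ?_ ?_ ?_ ?_ ?_ ?_
  · filter_upwards [hfol.eventually_mem hx] with y hy h0
    exact (S₀.unitNormal_radius M.toStationaryData hy.1 (hr0 y hy h0)).1
  · intro y hy h0
    rw [S₀.fderiv_radius_eq_zero_iff M hy.1 (hr0 y hy h0)]
    exact S₀.fderiv_localFun_localVector_eq_zero haxi hy.1.1 (hr0 y hy h0)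
  · exact fun y hy h0 => hc _ (hr0 y hy h0)
  · exact fun l hl hnull htan => hTTS.hess_radius_nonpos hp hl hnull htan
  · intro u h
    rw [S₀.fderiv_radius_eq_zero_iff M hx.1 hf0] at h
    rw [S₀.extrinsic_radius M.toStationaryData hp h]
    exact hconvex p hp u ((S₀.isTangent_iff u).2 h)
  · obtain ⟨u, hu, hu0⟩ := hcurved p hp
    have h := (S₀.isTangent_iff u).1 hu
    refine ⟨u, (S₀.fderiv_radius_eq_zero_iff M hx.1 hf0 u).2 h, ?_⟩
    rw [S₀.extrinsic_radius M.toStationaryData hp h]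
    exact hu0
  · refine M.ricci_add_ricci_eq_zero hT ?_ ?_ ?_
    · have hα := (hst.lapse_pos _ hx).ne'
      rw [Coord.admMetric_apply]
      simp only [Prod.smul_fst, Prod.smul_snd, smul_eq_mul, mul_one, smul_neg, add_neg_cancel,
        map_zero, add_zero]
      field_simp
    · rw [Coord.admMetric_apply]
      simpa using hfol.unit hx
    -- `P_r` is defined with the normal computed from `f`; by `hu` it coincides on the surface with
    -- the one computed from the radial function.
    · rw [← M.normal_chart, hu.2]
      exact hP 0 p hp
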